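/- Let $s,r\ge 0$ be integers, $n=s+r$, and let $(w,z,\zeta)$ be coordinates on $\mathbb{C}^{n+1}=\mathbb{C}\oplus\mathbb{C}^s\oplus\mathbb{C}^{r}$. For a neighborhood $U$ of $0$ in $\mathbb{C}^r$ and $s\times s$ matrix valued functions $H$ (Hermitian) and $S$ (symmetric) of $\zeta\in U$ (written as functions of $(\zeta,\overline\zeta)$) with $H(0,0)$ nondegenerate, consider the real hypersurface $$\Re(w)=z^TH(\zeta,\overline{\zeta})\overline{z}+\Re\big(\overline{z}^TS(\zeta,\overline{\zeta})\overline{z}\big).\qquad(1)$$ For a smooth real hypersurface $M$ let $\mathcal{H}=T^{1,0}M$. Let $\mathcal{K}_2\subset\mathcal{H}$ be the Levi kernel, consisting of the values $X_p$ of local sections $X$ of $\mathcal H$ with $[X,\overline{Y}]_p\in\mathcal{H}_p\oplus\overline{\mathcal{H}}_p$ for all local sections $Y$ of $\mathcal{H}$, and let $\mathcal{K}_3\subset\mathcal K_2$ consist of the values $X_p$ of local sections $X$ of $\mathcal{K}_2$ with $[[X,\overline{Y_1}],\overline{Y_2}]_p\in\mathcal{H}_p\oplus\overline{\mathcal{H}}_p$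 for all local sections $Y_1,Y_2$ of $\mathcal{H}$. Call $M$ uniformly $2$-nondegenerate near $0$ (with Levi rank $s$) if at all points of $M$ near $0$ the Levi form has rank $s$ (that is, $\dim_{\mathbb C}\mathcal{H}/\mathcal{K}_2=s$), $\mathcal{K}_2\neq 0$ and $\mathcal{K}_3=0$. A $2$-nondegenerate model is a hypersurface of the form (1) with real analytic $H,S$ that is uniformly $2$-nondegenerate near $0$. A holomorphic infinitesimal symmetry of $M$ at $0$ is the germ at $0$ of a holomorphic vector field on $\mathbb{C}^{n+1}$ whose real part is tangent to $M$. A set of such symmetries acts locally transitively at $0$ on the space of leaves of the Levi kernel if the values at $0$ of their real parts span the tangent space $T_0M/\Re(\mathcal{K}_2\oplus\overline{\mathcal{K}_2})_0$ of the local leaf space over $\mathbb{R}$. **Theorem.** Let $M$ be given by (1) with $H,S$ smooth, and suppose that $M$ is uniformly $2$-nondegenerate near $0$ and that some set of its holomorphic infinitesimal symmetries acts locally transitively at $0$ on the space of leaves of the Levi kernel. Then there are an $s\times s$ nondegenerate Hermitian matrix $\mathbf{H}$ and an $s\times s$ symmetric matrix $\mathbf{S}(\zeta)$ of holomorphic functions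 of $\zeta_1,\dots,\zeta_r$ near $0$, vanishing at $0$, with linearly independent (over $\mathbb{C}$) partial derivatives $\mathbf{S}_{\zeta_1}(0),\dots,\mathbf{S}_{\zeta_r}(0)$, such that near $0$ the inverses below exist, the hypersurface $M'$ given by (1) with $$H=\tfrac12\left(\mathbf{H}\big(\mathrm{Id}-\overline{\mathbf{S}(\zeta)}\mathbf{H}^T\mathbf{S}(\zeta)\mathbf{H}\big)^{-1}+\big(\mathrm{Id}-\mathbf{H}\overline{\mathbf{S}(\zeta)}\mathbf{H}^T\mathbf{S}(\zeta)\big)^{-1}\mathbf{H}\right),$$ $$S=\mathbf{H}^T\big(\mathrm{Id}-\mathbf{S}(\zeta)\mathbf{H}\overline{\mathbf{S}(\zeta)}\mathbf{H}^T\big)^{-1}\mathbf{S}(\zeta)\mathbf{H}$$ is a $2$-nondegenerate model, and $M$ is locally equivalent to $M'$ at $0$: some biholomorphism between neighborhoods of $0$ in $\mathbb{C}^{n+1}$ fixes $0$ and maps $M$ onto $M'$ there. -/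

import Mathlib

open Filter Topology
open scoped Matrix ContDiff

noncomputable section

namespace CRHyp

section General

/- A real hypersurface `M` in a complex vector space `E` is handled together with a real defining
function `ρ`: near each of its points, `M` is the zero set of `ρ`, and `dρ ≠ 0` there. The real
tangent space of `M` at `p` is `ker dρ_p`, and the complex structure `J` is multiplication by the
imaginary unit. -/

variable {E : Type*} [NormedAddCommGroup E] [NormedSpace ℂ E] [NormedSpace ℝ E]

/-- The maximal complex subspace `D_p = T_pM ∩ J T_pM` of the tangent space. The map
`v ↦ v - i J v` is a complex isomorphism from `D_p` onto the fibre `𝓗_p` of the CR structure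
(the `(1,0)` vectors in `ℂ ⊗ T_pM`); elements and sections of `𝓗` are represented by elements and
sections of `D` through this isomorphism. -/
def holTangent (ρ : E → ℝ) (p : E) : Submodule ℂ E where
  carrier := {v | ∀ c : ℂ, fderiv ℝ ρ p (c • v) = 0}
  add_mem' := by
    intro a b ha hb c
    rw [smul_add, map_add, ha c, hb c, add_zero]
  zero_mem' := by
    intro c
    rw [smul_zero, map_zero]
  smul_mem' := by
    intro d v hv c
    rw [smul_smul]
    exact hv _

/-- A complexified vector field `V = V₁ + i V₂` on the real space underlying `E` is written as the
pair `(V₁, V₂)` of its real and imaginary parts. This is the complex bilinear extension of the Lie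
bracket of real vector fields. -/
def cBracket (V W : E → E × E) (p : E) : E × E :=
  (VectorField.lieBracket ℝ (fun q => (V q).1) (fun q => (W q).1) p
      - VectorField.lieBracket ℝ (fun q => (V q).2) (fun q => (W q).2) p,
    VectorField.lieBracket ℝ (fun q => (V q).1) (fun q => (W q).2) p
      + VectorField.lieBracket ℝ (fun q => (V q).2) (fun q => (W q).1) p)

/-- The `(1,0)` field `X - i J X`. -/
def field10 (X : E → E) : E → E × E := fun q => (X q, -(Complex.I • X q))

/-- Its complex conjugate `X + i J X`, a `(0,1)` field. -/
def field01 (X : E → E) : E → E × E := fun q => (X q, Complex.I • X q)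

/-- Membership in `𝓗_p ⊕ conj 𝓗_p`, which is the complexification of `D_p`. -/
def InHH (ρ : E → ℝ) (p : E) (V : E × E) : Prop :=
  V.1 ∈ holTangent ρ p ∧ V.2 ∈ holTangent ρ p

/-- `X` is a smooth section, near `p`, of the family `B` of subspaces over `M`
(given by a smooth extension of it to an ambient neighbourhood of `p`). -/
def IsSection (M : Set E) (B : E → Submodule ℂ E) (X : E → E) (p : E) : Prop :=
  ∀ᶠ q in 𝓝 p, ContDiffAt ℝ ∞ X q ∧ (q ∈ M → X q ∈ B q)

/-- The section `X` of `𝓗` is annihilated at `p` by the Levi form: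
`[X, conj Y]_p ∈ 𝓗 ⊕ conj 𝓗` for every local section `Y` of `𝓗`. -/
def LeviNull (M : Set E) (ρ : E → ℝ) (X : E → E) (p : E) : Prop :=
  ∀ Y : E → E, IsSection M (holTangent ρ) Y p →
    InHH ρ p (cBracket (field10 X) (field01 Y) p)

/-- The section `X` of the Levi kernel is annihilated at `p` by the second generalized Levi form:
`[[X, conj Y₁], conj Y₂]_p ∈ 𝓗 ⊕ conj 𝓗` for all local sections `Y₁, Y₂` of `𝓗`. -/
def LeviNull₂ (M : Set E) (ρ : E → ℝ) (X : E → E) (p : E) : Prop :=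
  ∀ Y₁ Y₂ : E → E, IsSection M (holTangent ρ) Y₁ p → IsSection M (holTangent ρ) Y₂ p →
    InHH ρ p (cBracket (cBracket (field10 X) (field01 Y₁)) (field01 Y₂) p)

theorem inHH_cBracket_iff [IsScalarTower ℝ ℂ E] {ρ : E → ℝ} {p : E} {X Y : E → E}
    (hX : DifferentiableAt ℝ X p) (hY : DifferentiableAt ℝ Y p) :
    InHH ρ p (cBracket (field10 X) (field01 Y) p) ↔
      fderiv ℝ Y p (X p) + Complex.I • fderiv ℝ Y p (Complex.I • X p) ∈ holTangent ρ p ∧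
      fderiv ℝ X p (Y p) + Complex.I • fderiv ℝ X p (Complex.I • Y p) ∈ holTangent ρ p := by
  have e1 : fderiv ℝ (fun q => -(Complex.I • X q)) p = -(Complex.I • fderiv ℝ X p) := by
    rw [fderiv_fun_neg, fderiv_fun_const_smul hX]
  have e2 : fderiv ℝ (fun q => Complex.I • Y q) p = Complex.I • fderiv ℝ Y p := by
    rw [fderiv_fun_const_smul hY]
  set u := fderiv ℝ Y p (X p) + Complex.I • fderiv ℝ Y p (Complex.I • X p) with hu
  set v := fderiv ℝ X p (Y p) + Complex.I • fderiv ℝ X p (Complex.I • Y p) with hv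
  have h1 : (cBracket (field10 X) (field01 Y) p).1 = u - v := by
    simp only [cBracket, field10, field01, VectorField.lieBracket, e1, e2, hu, hv]
    simp
    abel
  have h2 : (cBracket (field10 X) (field01 Y) p).2 = Complex.I • (u + v) := by
    simp only [cBracket, field10, field01, VectorField.lieBracket, e1, e2, hu, hv]
    simp [smul_add, smul_smul]
    abel
  unfold InHH
  rw [h1, h2, Submodule.smul_mem_iff _ Complex.I_ne_zero]
  constructor
  · rintro ⟨a, b⟩
    have hs : (2 : ℂ) • u ∈ holTangent ρ p := by
      have h := (holTangent ρ p).add_mem a b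
      have e : u - v + (u + v) = (2 : ℂ) • u := by rw [two_smul]; abel
      rwa [e] at h
    have hu' := (Submodule.smul_mem_iff _ (two_ne_zero' ℂ)).1 hs
    refine ⟨hu', ?_⟩
    have h := (holTangent ρ p).sub_mem b hu'
    rwa [add_sub_cancel_left] at h
  · rintro ⟨a, b⟩
    exact ⟨(holTangent ρ p).sub_mem a b, (holTangent ρ p).add_mem a b⟩

theorem IsSection.differentiableAt {M : Set E} {B : E → Submodule ℂ E} {X : E → E} {p : E}
    (h : IsSection M B X p) : DifferentiableAt ℝ X p :=
  h.self_of_nhds.1.differentiableAt (by simp)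

/-- The Levi kernel `(𝓚₂)_p`. -/
def leviKernel [IsScalarTower ℝ ℂ E] (M : Set E) (ρ : E → ℝ) (p : E) : Submodule ℂ E where
  carrier := {v | ∃ X : E → E, IsSection M (holTangent ρ) X p ∧ X p = v ∧ LeviNull M ρ X p}
  add_mem' := by
    rintro _ _ ⟨X, hX, rfl, nX⟩ ⟨X', hX', rfl, nX'⟩
    refine ⟨fun q => X q + X' q, ?_, rfl, ?_⟩
    · filter_upwards [hX, hX'] with q h h'
      exact ⟨h.1.add h'.1, fun m => (holTangent ρ q).add_mem (h.2 m) (h'.2 m)⟩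
    · intro Y hY
      have dX := hX.differentiableAt
      have dX' := hX'.differentiableAt
      have dY := hY.differentiableAt
      have a := (inHH_cBracket_iff dX dY).1 (nX Y hY)
      have b := (inHH_cBracket_iff dX' dY).1 (nX' Y hY)
      refine (inHH_cBracket_iff (dX.add dX') dY).2 ⟨?_, ?_⟩
      · convert (holTangent ρ p).add_mem a.1 b.1 using 1
        simp only [Pi.add_apply, smul_add, map_add]
        abel
      · convert (holTangent ρ p).add_mem a.2 b.2 using 1
        rw [fderiv_add dX dX']
        simp only [smul_add, add_apply]
        abel
  zero_mem' := by
    refine ⟨fun _ => 0, ?_, rfl, ?_⟩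
    · exact Eventually.of_forall fun q => ⟨contDiffAt_const, fun _ => (holTangent ρ q).zero_mem⟩
    · intro Y hY
      refine (inHH_cBracket_iff (differentiableAt_const _) hY.differentiableAt).2 ?_
      simp
  smul_mem' := by
    rintro c _ ⟨X, hX, rfl, nX⟩
    refine ⟨fun q => c • X q, ?_, rfl, ?_⟩
    · filter_upwards [hX] with q h
      exact ⟨h.1.const_smul c, fun m => (holTangent ρ q).smul_mem c (h.2 m)⟩
    · intro Y hY
      have dX := hX.differentiableAt
      have dY := hY.differentiableAt
      have a := (inHH_cBracket_iff dX dY).1 (nX Y hY)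
      refine (inHH_cBracket_iff (dX.const_smul c) dY).2 ⟨?_, ?_⟩
      · convert (holTangent ρ p).smul_mem (starRingEnd ℂ c) a.1 using 1
        have e : ∀ z : ℂ, ∀ x : E, z • x = z.re • x + z.im • (Complex.I • x) := by
          intro z x
          rw [← smul_assoc, ← smul_one_smul ℂ z.re x, ← add_smul]
          congr 1
          apply Complex.ext <;> simp
        have i2 : Complex.I • Complex.I • X p = -X p := by
          rw [smul_smul, Complex.I_mul_I, neg_smul, one_smul]
        have k1 : fderiv ℝ Y p (c • X p)
            = c.re • fderiv ℝ Y p (X p) + c.im • fderiv ℝ Y p (Complex.I • X p) := by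
          rw [e c, map_add, map_smul, map_smul]
        have k2 : fderiv ℝ Y p (Complex.I • c • X p)
            = c.re • fderiv ℝ Y p (Complex.I • X p) - c.im • fderiv ℝ Y p (X p) := by
          rw [smul_comm, e c (Complex.I • X p), i2, map_add, (fderiv ℝ Y p).map_smul,
            (fderiv ℝ Y p).map_smul, map_neg, smul_neg, sub_eq_add_neg]
        have i3 : ∀ x : E, Complex.I • Complex.I • x = -x := by
          intro x
          rw [smul_smul, Complex.I_mul_I, neg_smul, one_smul]
        rw [Pi.smul_apply, k1, k2, e (starRingEnd ℂ c), Complex.conj_re, Complex.conj_im]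
        have sc : ∀ (t : ℝ) (x : E), Complex.I • t • x = t • Complex.I • x := by
          intro t x
          rw [← smul_one_smul ℂ t x, ← smul_one_smul ℂ t (Complex.I • x), smul_comm]
        simp only [smul_add, smul_sub, neg_smul, sc, i3, smul_neg]
        abel
      · convert (holTangent ρ p).smul_mem c a.2 using 1
        rw [fderiv_const_smul dX]
        simp only [smul_add, smul_apply, smul_smul, mul_comm]

/-- The rank of the Levi form at `p`, i.e. the dimension of `𝓗_p / (𝓚₂)_p`. -/
def leviRank [IsScalarTower ℝ ℂ E] (M : Set E) (ρ : E → ℝ) (p : E) : ℕ :=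
  Module.finrank ℂ (holTangent ρ p ⧸ (leviKernel M ρ p).submoduleOf (holTangent ρ p))

/-- The next term `(𝓚₃)_p` of the Freeman filtration. -/
def freeman₃ [IsScalarTower ℝ ℂ E] (M : Set E) (ρ : E → ℝ) (p : E) : Set E :=
  {v | ∃ X : E → E, IsSection M (leviKernel M ρ) X p ∧ X p = v ∧ LeviNull₂ M ρ X p}

/-- Near the point `o`, the hypersurface `M` has Levi form of constant rank `s` and is everywhere
`2`-nondegenerate, i.e. `𝓚₂ ≠ 0` and `𝓚₃ = 0`. -/
def UniformlyTwoNondegenerateNear [IsScalarTower ℝ ℂ E]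
    (M : Set E) (ρ : E → ℝ) (o : E) (s : ℕ) : Prop :=
  ∀ᶠ p in 𝓝 o, p ∈ M →
    leviRank M ρ p = s ∧ leviKernel M ρ p ≠ ⊥ ∧ freeman₃ M ρ p = {0}

/-- The real part of the holomorphic vector field `X` (a germ at `o`, written through its
coefficients) is tangent to `M`. -/
def IsHolInfinitesimalSymmetry (M : Set E) (ρ : E → ℝ) (o : E) (X : E → E) : Prop :=
  AnalyticAt ℂ X o ∧ ∀ᶠ q in 𝓝 o, q ∈ M → fderiv ℝ ρ q (X q) = 0

/-- The family `𝔛` acts locally transitively at `o` on the local leaf space of the Levi kernel: the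
values at `o` of its members span the tangent space `T_oM / Re (𝓚₂ ⊕ conj 𝓚₂)_o` of the leaf space
at the leaf through `o`. -/
def ActsLocallyTransitivelyOnLeaves [IsScalarTower ℝ ℂ E]
    (M : Set E) (ρ : E → ℝ) (o : E) (𝔛 : Set (E → E)) : Prop :=
  ∀ v : E, fderiv ℝ ρ o v = 0 →
    v ∈ Submodule.span ℝ ((fun X : E → E => X o) '' 𝔛) ⊔ (leviKernel M ρ o).restrictScalars ℝ

/-- There is a biholomorphism between neighbourhoods of `o` that fixes `o` and maps `M` to `M'`. -/
def LocallyEquivalentAt (M M' : Set E) (o : E) : Prop :=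
  ∃ Φ : OpenPartialHomeomorph E E, o ∈ Φ.source ∧ Φ o = o ∧
    DifferentiableOn ℂ Φ Φ.source ∧ DifferentiableOn ℂ Φ.symm Φ.target ∧
    ∀ p ∈ Φ.source, p ∈ M ↔ Φ p ∈ M'

end General

/-- `ℂ^{n+1} = ℂ ⊕ ℂ^s ⊕ ℂ^r` with coordinates `(w, z, ζ)`, where `r = n - s`. -/
abbrev Amb (s r : ℕ) : Type := ℂ × (Fin s → ℂ) × (Fin r → ℂ)

/-- Matrix valued functions of `(ζ, conj ζ)`. -/
abbrev MatFun (s r : ℕ) : Type := (Fin r → ℂ) → Matrix (Fin s) (Fin s) ℂ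

/-- The defining function `zᵀ H(ζ) z̄ + Re (z̄ᵀ S(ζ) z̄) - Re w`; the first term is real when `H(ζ)`
is Hermitian. -/
def defFun {s r : ℕ} (H S : MatFun s r) (p : Amb s r) : ℝ :=
  (p.2.1 ⬝ᵥ (H p.2.2 *ᵥ star p.2.1)).re + (star p.2.1 ⬝ᵥ (S p.2.2 *ᵥ star p.2.1)).re - p.1.re

/-- The hypersurface `Re w = zᵀ H z̄ + Re (z̄ᵀ S z̄)` over `ζ ∈ U`. -/
def hypersurface {s r : ℕ} (U : Set (Fin r → ℂ)) (H S : MatFun s r) : Set (Amb s r) :=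
  {p | p.2.2 ∈ U ∧ defFun H S p = 0}

/-- The standing conventions on the coefficients of the defining equation. -/
structure IsDefiningData {s r : ℕ} (U : Set (Fin r → ℂ)) (H S : MatFun s r) : Prop where
  isOpen : IsOpen U
  zero_mem : 0 ∈ U
  hermitian : ∀ ζ ∈ U, (H ζ).IsHermitian
  symmetric : ∀ ζ ∈ U, (S ζ).IsSymm
  nondegenerate : IsUnit (H 0).det

/-- The hypersurface is uniformly `2`-nondegenerate near `0`, with Levi form of rank `s`. -/
def IsUniformlyTwoNondegenerate {s r : ℕ} (U : Set (Fin r → ℂ)) (H S : MatFun s r) : Prop :=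
  UniformlyTwoNondegenerateNear (hypersurface U H S) (defFun H S) 0 s

/-- A `2`-nondegenerate model: real analytic and uniformly `2`-nondegenerate. -/
structure IsTwoNondegenerateModel {s r : ℕ} (U : Set (Fin r → ℂ)) (H S : MatFun s r) : Prop where
  data : IsDefiningData U H S
  analyticH : ∀ i j, AnalyticOnNhd ℝ (fun ζ => H ζ i j) U
  analyticS : ∀ i j, AnalyticOnNhd ℝ (fun ζ => S ζ i j) U
  nondegenerate : IsUniformlyTwoNondegenerate U H S

/-- Entrywise complex conjugation. -/
def conjMat {s : ℕ} (A : Matrix (Fin s) (Fin s) ℂ) : Matrix (Fin s) (Fin s) ℂ :=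
  A.map (starRingEnd ℂ)

/-- The holomorphic partial derivative of a matrix valued function at `0` in the direction `ζ_α`. -/
def partialAtZero {s r : ℕ} (S : MatFun s r) (α : Fin r) : Matrix (Fin s) (Fin s) ℂ :=
  Matrix.of fun i j => fderiv ℂ (fun ζ => S ζ i j) 0 (Pi.single α 1)

/-- A nondegenerate Hermitian matrix `bH` and a symmetric matrix `bS` of holomorphic functions on
`U`, vanishing at `0`, with linearly independent first partial derivatives at `0`. The determinants
of the three matrices that are inverted in `modelH` and `modelS` all equal the one in the last
condition. -/
structure IsModelPair {s r : ℕ} (U : Set (Fin r → ℂ)) (bH : Matrix (Fin s) (Fin s) ℂ)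
    (bS : MatFun s r) : Prop where
  isOpen : IsOpen U
  zero_mem : 0 ∈ U
  hermitian : bH.IsHermitian
  nondegenerate : IsUnit bH.det
  symmetric : ∀ ζ ∈ U, (bS ζ).IsSymm
  holomorphic : ∀ i j, DifferentiableOn ℂ (fun ζ => bS ζ i j) U
  vanish : bS 0 = 0
  linearIndependent : LinearIndependent ℂ (partialAtZero bS)
  invertible : ∀ ζ ∈ U, IsUnit (1 - conjMat (bS ζ) * bHᵀ * bS ζ * bH).det

/-- `½ (𝐇 (Id - 𝐒̄ 𝐇ᵀ 𝐒 𝐇)⁻¹ + (Id - 𝐇 𝐒̄ 𝐇ᵀ 𝐒)⁻¹ 𝐇)`. -/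
def modelH {s r : ℕ} (bH : Matrix (Fin s) (Fin s) ℂ) (bS : MatFun s r) : MatFun s r := fun ζ =>
  (1 / 2 : ℂ) • (bH * (1 - conjMat (bS ζ) * bHᵀ * bS ζ * bH)⁻¹
    + (1 - bH * conjMat (bS ζ) * bHᵀ * bS ζ)⁻¹ * bH)

/-- `𝐇ᵀ (Id - 𝐒 𝐇 𝐒̄ 𝐇ᵀ)⁻¹ 𝐒 𝐇`. -/
def modelS {s r : ℕ} (bH : Matrix (Fin s) (Fin s) ℂ) (bS : MatFun s r) : MatFun s r := fun ζ =>
  bHᵀ * (1 - bS ζ * bH * conjMat (bS ζ) * bHᵀ)⁻¹ * bS ζ * bH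

end CRHyp

end

/-! Along the slice `w = 0`, `z = 0`, the first `z`-derivative of the tangency condition of a
symmetry reads `H ā + S̄ a = b`. Here `a` is the `z`-component of the symmetry and `b` is half the
`z`-gradient of its `w`-component, so both are holomorphic in `ζ` (`symmetry_components`). A Levi
kernel vector at `0` has no `z`-component (`leviKernel_zero_z`), so transitivity on leaves allows
`a(0)` to be any vector of `ℂ^s`. Separating complex linear from antilinear combinations of these
solutions gives holomorphic matrices with `H Ā + S̄ B = C`, `H B̄ + S̄ A = D`, `A(0) = 1`, `B(0) =
0` (`exists_holomorphic_frame`).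

Put `T = A⁻¹ B`, `H' = Aᵀ H Ā`, `S' = Aᵀ S̄ A`. The two equations say that `Q = H' T̄ + S'` and `E =
H' (1 - T̄ T)` are holomorphic. Since `H'` is Hermitian and `T(0) = 0`, polarization (treat `ζ` and
`ζ̄` as independent, then set `ζ̄ = 0`) forces `E` to be the constant `H(0)`; a second polarization
makes `Q` symmetric (`exists_normalization`). Hence `H' = H(0) (1 - T̄ T)⁻¹` and `S' = Q - H' T̄`.
Replacing `z` by `A⁻¹ z` and subtracting the holomorphic quadratic form of `Q` from `w` carries `M`
to the model with `𝐇 = H(0)` and `𝐒 = -T 𝐇⁻¹` (`IsNormalization.defFun_chart`).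

Uniform `2`-nondegeneracy of the model follows from its biholomorphic invariance
(`CREquiv.uniformlyTwoNondegenerateNear`). It also yields the independence of the derivatives of
`𝐒`. In the model the Levi leaves are `z = k̄ + T k` with `k` constant, which gives explicit
sections `leafField` of the Levi kernel. If `dT(γ) = 0` at `0`, the section in direction `γ` is
annihilated there by the second Levi form (`IsModelForm.leviNull₂_leafField`), so its value lies in
`𝓚₃ = 0`; since its `ζ`-component is `γ`, `γ = 0`. -/

noncomputable section

namespace CRHyp

/-! ### Biholomorphic invariance of the Levi kernel and the Freeman filtration. -/

section Transport

variable {E : Type*} [NormedAddCommGroup E] [NormedSpace ℂ E] [NormedSpace ℝ E]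
  [IsScalarTower ℝ ℂ E]

/-- A local biholomorphism identifying hypersurfaces together with their defining functions. -/
structure CREquiv (Φ : OpenPartialHomeomorph E E) (M M' : Set E) (ρ ρ' : E → ℝ) : Prop where
  holo : DifferentiableOn ℂ Φ Φ.source
  holo_symm : DifferentiableOn ℂ Φ.symm Φ.target
  smooth : ContDiffOn ℝ ∞ Φ Φ.source
  smooth_symm : ContDiffOn ℝ ∞ Φ.symm Φ.target
  mem_iff : ∀ p ∈ Φ.source, p ∈ M ↔ Φ p ∈ M'
  apply_eq : ∀ p ∈ Φ.source, ρ p = ρ' (Φ p)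
  diff : ∀ p ∈ Φ.source, DifferentiableAt ℝ ρ p
  diff' : ∀ p ∈ Φ.target, DifferentiableAt ℝ ρ' p

/-- Pullback of complexified vector fields. -/
def cPullback (f : E → E) (V : E → E × E) : E → E × E := fun q =>
  (VectorField.pullback ℝ f (fun x => (V x).1) q, VectorField.pullback ℝ f (fun x => (V x).2) q)

namespace CREquiv

variable {Φ : OpenPartialHomeomorph E E} {M M' : Set E} {ρ ρ' : E → ℝ}

omit [IsScalarTower ℝ ℂ E] in
theorem symm (h : CREquiv Φ M M' ρ ρ') : CREquiv Φ.symm M' M ρ' ρ where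
  holo := h.holo_symm
  holo_symm := by simpa using h.holo
  smooth := h.smooth_symm
  smooth_symm := by simpa using h.smooth
  mem_iff p hp := by
    have := h.mem_iff (Φ.symm p) (Φ.map_target hp)
    rw [Φ.right_inv hp] at this
    exact this.symm
  apply_eq p hp := by
    rw [h.apply_eq (Φ.symm p) (Φ.map_target hp), Φ.right_inv hp]
  diff := h.diff'
  diff' := by simpa using h.diff

variable (h : CREquiv Φ M M' ρ ρ')
include h

omit [IsScalarTower ℝ ℂ E] in
theorem contDiffAt {p : E} (hp : p ∈ Φ.source) : ContDiffAt ℝ ∞ Φ p :=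
  h.smooth.contDiffAt (Φ.open_source.mem_nhds hp)

omit [IsScalarTower ℝ ℂ E] in
theorem differentiableAt {p : E} (hp : p ∈ Φ.source) : DifferentiableAt ℝ Φ p :=
  (h.contDiffAt hp).differentiableAt (by simp)

theorem fderiv_smul {p : E} (hp : p ∈ Φ.source) (c : ℂ) (v : E) :
    fderiv ℝ Φ p (c • v) = c • fderiv ℝ Φ p v := by
  have := (h.holo.differentiableAt (Φ.open_source.mem_nhds hp)).fderiv_restrictScalars ℝ
  rw [this]
  simp

omit [IsScalarTower ℝ ℂ E] in
theorem fderiv_symm_comp {p : E} (hp : p ∈ Φ.source) (v : E) :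
    fderiv ℝ Φ.symm (Φ p) (fderiv ℝ Φ p v) = v := by
  have h1 := (h.symm.differentiableAt (Φ.map_source hp)).hasFDerivAt.comp p
    (h.differentiableAt hp).hasFDerivAt
  have h2 : HasFDerivAt (fun x : E => x) (ContinuousLinearMap.id ℝ E) p := hasFDerivAt_id p
  have h3 : (Φ.symm ∘ Φ) =ᶠ[𝓝 p] fun x => x := Φ.eventually_left_inverse hp
  have := (h1.congr_of_eventuallyEq h3.symm).unique h2
  exact congrArg (fun f => f v) this

omit [IsScalarTower ℝ ℂ E] in
theorem fderiv_comp_symm {p : E} (hp : p ∈ Φ.source) (v : E) :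
    fderiv ℝ Φ p (fderiv ℝ Φ.symm (Φ p) v) = v := by
  have := h.symm.fderiv_symm_comp (Φ.map_source hp) v
  simpa [Φ.left_inv hp] using this

omit [IsScalarTower ℝ ℂ E] in
theorem inverse_fderiv {p : E} (hp : p ∈ Φ.source) :
    (fderiv ℝ Φ p).inverse = fderiv ℝ Φ.symm (Φ p) := by
  apply ContinuousLinearMap.inverse_eq
  · ext v; exact h.fderiv_comp_symm hp v
  · ext v; exact h.fderiv_symm_comp hp v

omit [IsScalarTower ℝ ℂ E] in
theorem pullback_apply {p : E} (hp : p ∈ Φ.source) (X : E → E) :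
    VectorField.pullback ℝ Φ X p = fderiv ℝ Φ.symm (Φ p) (X (Φ p)) := by
  rw [VectorField.pullback, h.inverse_fderiv hp]

omit [IsScalarTower ℝ ℂ E] in
theorem fderiv_eq {p : E} (hp : p ∈ Φ.source) (v : E) :
    fderiv ℝ ρ p v = fderiv ℝ ρ' (Φ p) (fderiv ℝ Φ p v) := by
  have h1 := (h.diff' _ (Φ.map_source hp)).hasFDerivAt.comp p (h.differentiableAt hp).hasFDerivAt
  have h3 : ρ =ᶠ[𝓝 p] ρ' ∘ Φ := by
    filter_upwards [Φ.open_source.mem_nhds hp] with q hq using h.apply_eq q hq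
  rw [(h1.congr_of_eventuallyEq h3).fderiv]
  rfl

theorem mem_holTangent_iff {p : E} (hp : p ∈ Φ.source) (v : E) :
    v ∈ holTangent ρ p ↔ fderiv ℝ Φ p v ∈ holTangent ρ' (Φ p) := by
  change (∀ c : ℂ, _) ↔ (∀ c : ℂ, _)
  simp only [← h.fderiv_smul hp, ← h.fderiv_eq hp]

-- The bundles are left abstract because this serves both the complex tangent bundle and, once its
-- invariance is known, the Levi kernel.
omit [IsScalarTower ℝ ℂ E] in
theorem isSection_pullback {B B' : E → Submodule ℂ E} {p : E} (hp : p ∈ Φ.source)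
    (hB : ∀ q ∈ Φ.source, ∀ v, fderiv ℝ Φ q v ∈ B' (Φ q) → v ∈ B q) {X : E → E}
    (hX : IsSection M' B' X (Φ p)) : IsSection M B (VectorField.pullback ℝ Φ X) p := by
  have h1 := (Φ.continuousAt hp).eventually hX
  filter_upwards [h1, Φ.open_source.mem_nhds hp] with q hq hqs
  constructor
  · have e : VectorField.pullback ℝ Φ X =ᶠ[𝓝 q] fun x => fderiv ℝ Φ.symm (Φ x) (X (Φ x)) := by
      filter_upwards [Φ.open_source.mem_nhds hqs] with x hx using h.pullback_apply hx X
    refine ContDiffAt.congr_of_eventuallyEq ?_ e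
    have c1 : ContDiffAt ℝ ∞ (fderiv ℝ Φ.symm) (Φ q) :=
      (h.symm.contDiffAt (Φ.map_source hqs)).fderiv_right (by simp)
    exact (c1.comp q (h.contDiffAt hqs)).clm_apply (hq.1.comp q (h.contDiffAt hqs))
  · intro hm
    apply hB q hqs
    rw [h.pullback_apply hqs, h.fderiv_comp_symm hqs]
    exact hq.2 ((h.mem_iff q hqs).1 hm)

theorem field10_pullback {p : E} (hp : p ∈ Φ.source) (X : E → E) :
    field10 (VectorField.pullback ℝ Φ X) p = cPullback Φ (field10 X) p := by
  simp only [field10, cPullback, h.pullback_apply hp, map_neg,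
    h.symm.fderiv_smul (Φ.map_source hp)]

theorem field01_pullback {p : E} (hp : p ∈ Φ.source) (X : E → E) :
    field01 (VectorField.pullback ℝ Φ X) p = cPullback Φ (field01 X) p := by
  simp only [field01, cPullback, h.pullback_apply hp, h.symm.fderiv_smul (Φ.map_source hp)]

-- Naturality of the real Lie bracket, applied to each of the four brackets in the complex bilinear
-- extension.
omit [IsScalarTower ℝ ℂ E] in
theorem cBracket_cPullback [CompleteSpace E] {p : E} (hp : p ∈ Φ.source) {V W : E → E × E}
    (hV : DifferentiableAt ℝ V (Φ p)) (hW : DifferentiableAt ℝ W (Φ p)) :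
    cBracket (cPullback Φ V) (cPullback Φ W) p = cPullback Φ (cBracket V W) p := by
  have hn : minSmoothness ℝ 2 ≤ (2 : WithTop ℕ∞) := by simp
  have c2 : ContDiffAt ℝ 2 Φ p := (h.contDiffAt hp).of_le (by norm_cast)
  simp only [cBracket, cPullback]
  rw [← VectorField.pullback_lieBracket hn c2 hV.fst hW.fst,
    ← VectorField.pullback_lieBracket hn c2 hV.snd hW.snd,
    ← VectorField.pullback_lieBracket hn c2 hV.fst hW.snd,
    ← VectorField.pullback_lieBracket hn c2 hV.snd hW.fst]
  simp only [h.pullback_apply hp, map_sub, map_add]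

theorem inHH_cPullback {p : E} (hp : p ∈ Φ.source) (V : E → E × E) :
    InHH ρ p (cPullback Φ V p) ↔ InHH ρ' (Φ p) (V (Φ p)) := by
  simp only [InHH, h.mem_holTangent_iff hp, cPullback, h.pullback_apply hp, h.fderiv_comp_symm hp]

omit [IsScalarTower ℝ ℂ E] in
theorem pullback_pullback_symm {p : E} (hp : p ∈ Φ.source) (Y : E → E) :
    VectorField.pullback ℝ Φ (VectorField.pullback ℝ Φ.symm Y) p = Y p := by
  rw [h.pullback_apply hp, h.symm.pullback_apply (Φ.map_source hp)]
  simp only [OpenPartialHomeomorph.symm_symm, Φ.left_inv hp]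
  exact h.fderiv_symm_comp hp _

end CREquiv

-- The conclusion holds near `p`, not only at `p`, so that it can be fed into a further bracket.
omit [NormedSpace ℂ E] [IsScalarTower ℝ ℂ E] in
theorem _root_.Filter.EventuallyEq.cBracket {p : E} {V V' W W' : E → E × E}
    (hV : V =ᶠ[𝓝 p] V') (hW : W =ᶠ[𝓝 p] W') : cBracket V W =ᶠ[𝓝 p] cBracket V' W' := by
  filter_upwards [hV.eventuallyEq_nhds, hW.eventuallyEq_nhds] with q h1 h2
  have a1 : (fun x => (V x).1) =ᶠ[𝓝 q] fun x => (V' x).1 := h1.fun_comp Prod.fst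
  have a2 : (fun x => (V x).2) =ᶠ[𝓝 q] fun x => (V' x).2 := h1.fun_comp Prod.snd
  have b1 : (fun x => (W x).1) =ᶠ[𝓝 q] fun x => (W' x).1 := h2.fun_comp Prod.fst
  have b2 : (fun x => (W x).2) =ᶠ[𝓝 q] fun x => (W' x).2 := h2.fun_comp Prod.snd
  simp only [CRHyp.cBracket]
  rw [a1.lieBracket_vectorField_eq b1, a2.lieBracket_vectorField_eq b2,
    a1.lieBracket_vectorField_eq b2, a2.lieBracket_vectorField_eq b1]

theorem contDiffAt_field10 {X : E → E} {p : E} (hX : ContDiffAt ℝ ∞ X p) :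
    ContDiffAt ℝ ∞ (field10 X) p :=
  hX.prodMk (hX.const_smul Complex.I).neg

theorem contDiffAt_field01 {X : E → E} {p : E} (hX : ContDiffAt ℝ ∞ X p) :
    ContDiffAt ℝ ∞ (field01 X) p :=
  hX.prodMk (hX.const_smul Complex.I)

omit [NormedSpace ℂ E] [IsScalarTower ℝ ℂ E] in
theorem contDiffAt_lieBracket {X Y : E → E} {p : E} (hX : ContDiffAt ℝ ∞ X p)
    (hY : ContDiffAt ℝ ∞ Y p) : ContDiffAt ℝ ∞ (VectorField.lieBracket ℝ X Y) p := by
  have a : ContDiffAt ℝ ∞ (fderiv ℝ X) p := hX.fderiv_right (by simp)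
  have b : ContDiffAt ℝ ∞ (fderiv ℝ Y) p := hY.fderiv_right (by simp)
  exact (b.clm_apply hX).sub (a.clm_apply hY)

omit [NormedSpace ℂ E] [IsScalarTower ℝ ℂ E] in
theorem contDiffAt_cBracket {V W : E → E × E} {p : E} (hV : ContDiffAt ℝ ∞ V p)
    (hW : ContDiffAt ℝ ∞ W p) : ContDiffAt ℝ ∞ (cBracket V W) p :=
  ((contDiffAt_lieBracket hV.fst hW.fst).sub (contDiffAt_lieBracket hV.snd hW.snd)).prodMk
    ((contDiffAt_lieBracket hV.fst hW.snd).add (contDiffAt_lieBracket hV.snd hW.fst))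

theorem finrank_quotient_map {V : Type*} [AddCommGroup V] [Module ℂ V] (e : V ≃ₗ[ℂ] V)
    (A K : Submodule ℂ V) :
    Module.finrank ℂ (A ⧸ K.submoduleOf A) =
      Module.finrank ℂ (A.map (e : V →ₗ[ℂ] V) ⧸
        (K.map (e : V →ₗ[ℂ] V)).submoduleOf (A.map (e : V →ₗ[ℂ] V))) := by
  refine LinearEquiv.finrank_eq (Submodule.Quotient.equiv _ _ (e.submoduleMap A) ?_)
  ext ⟨x, hx⟩
  simp only [Submodule.mem_map, Submodule.submoduleOf, Submodule.mem_comap, Submodule.subtype_apply]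
  constructor
  · rintro ⟨⟨y, hy⟩, hyK, hyx⟩
    exact ⟨y, hyK, congrArg Subtype.val hyx⟩
  · rintro ⟨y, hyK, rfl⟩
    obtain ⟨z, hz, hzy⟩ := Submodule.mem_map.1 hx
    have : z = y := e.injective hzy
    subst this
    exact ⟨⟨z, hz⟩, hyK, Subtype.ext rfl⟩

namespace CREquiv

variable {Φ : OpenPartialHomeomorph E E} {M M' : Set E} {ρ ρ' : E → ℝ} [CompleteSpace E]

/-- Every test section on the source side is the pullback of its transport by `Φ.symm`, so the whole
bracket is a pullback of a bracket that is already controlled. -/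
theorem leviNull_pullback (h : CREquiv Φ M M' ρ ρ') {p : E} (hp : p ∈ Φ.source) {X : E → E}
    (hX : ContDiffAt ℝ ∞ X (Φ p)) (nX : LeviNull M' ρ' X (Φ p)) :
    LeviNull M ρ (VectorField.pullback ℝ Φ X) p := by
  intro Y hY
  have hY' : IsSection M' (holTangent ρ') (VectorField.pullback ℝ Φ.symm Y) (Φ p) := by
    refine h.symm.isSection_pullback (Φ.map_source hp)
      (fun q hq v => (h.symm.mem_holTangent_iff hq v).2) ?_
    rwa [Φ.left_inv hp]
  have e1 : field10 (VectorField.pullback ℝ Φ X) =ᶠ[𝓝 p] cPullback Φ (field10 X) := by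
    filter_upwards [Φ.open_source.mem_nhds hp] with x hx using h.field10_pullback hx X
  have e2 : field01 Y =ᶠ[𝓝 p] cPullback Φ (field01 (VectorField.pullback ℝ Φ.symm Y)) := by
    filter_upwards [Φ.open_source.mem_nhds hp] with x hx
    rw [← h.field01_pullback hx]
    simp only [field01, h.pullback_pullback_symm hx]
  rw [(e1.cBracket e2).self_of_nhds, h.cBracket_cPullback hp
    ((contDiffAt_field10 hX).differentiableAt (by simp))
    ((contDiffAt_field01 hY'.self_of_nhds.1).differentiableAt (by simp)), h.inHH_cPullback hp]
  exact nX _ hY'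

theorem leviNull₂_pullback (h : CREquiv Φ M M' ρ ρ') {p : E} (hp : p ∈ Φ.source) {X : E → E}
    (hX : ∀ᶠ q in 𝓝 (Φ p), ContDiffAt ℝ ∞ X q) (nX : LeviNull₂ M' ρ' X (Φ p)) :
    LeviNull₂ M ρ (VectorField.pullback ℝ Φ X) p := by
  have hY' : ∀ Y, IsSection M (holTangent ρ) Y p →
      IsSection M' (holTangent ρ') (VectorField.pullback ℝ Φ.symm Y) (Φ p) := by
    intro Y hY
    refine h.symm.isSection_pullback (Φ.map_source hp)
      (fun q hq v => (h.symm.mem_holTangent_iff hq v).2) ?_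
    rwa [Φ.left_inv hp]
  have e1 : field10 (VectorField.pullback ℝ Φ X) =ᶠ[𝓝 p] cPullback Φ (field10 X) := by
    filter_upwards [Φ.open_source.mem_nhds hp] with x hx using h.field10_pullback hx X
  have e2 : ∀ Y, field01 Y =ᶠ[𝓝 p] cPullback Φ (field01 (VectorField.pullback ℝ Φ.symm Y)) := by
    intro Y
    filter_upwards [Φ.open_source.mem_nhds hp] with x hx
    rw [← h.field01_pullback hx]
    simp only [field01, h.pullback_pullback_symm hx]
  intro Y₁ Y₂ hY₁ hY₂
  have s1 := hY' Y₁ hY₁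
  have s2 := hY' Y₂ hY₂
  have e3 : cBracket (field10 (VectorField.pullback ℝ Φ X)) (field01 Y₁) =ᶠ[𝓝 p]
      cPullback Φ (cBracket (field10 X) (field01 (VectorField.pullback ℝ Φ.symm Y₁))) := by
    refine (e1.cBracket (e2 Y₁)).trans ?_
    filter_upwards [Φ.open_source.mem_nhds hp, (Φ.continuousAt hp).eventually s1,
      (Φ.continuousAt hp).eventually hX] with q hq hq1 hq2
    exact h.cBracket_cPullback hq ((contDiffAt_field10 hq2).differentiableAt (by simp))
      ((contDiffAt_field01 hq1.1).differentiableAt (by simp))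
  rw [(e3.cBracket (e2 Y₂)).self_of_nhds, h.cBracket_cPullback hp
    ((contDiffAt_cBracket (contDiffAt_field10 hX.self_of_nhds)
      (contDiffAt_field01 s1.self_of_nhds.1)).differentiableAt (by simp))
    ((contDiffAt_field01 s2.self_of_nhds.1).differentiableAt (by simp)), h.inHH_cPullback hp]
  exact nX _ _ s1 s2

theorem mem_leviKernel_of_fderiv (h : CREquiv Φ M M' ρ ρ') {p : E} (hp : p ∈ Φ.source) (v : E)
    (hv : fderiv ℝ Φ p v ∈ leviKernel M' ρ' (Φ p)) : v ∈ leviKernel M ρ p := by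
  obtain ⟨X, hX, hXp, nX⟩ := hv
  refine ⟨VectorField.pullback ℝ Φ X, ?_, ?_, ?_⟩
  · exact h.isSection_pullback hp (fun q hq v => (h.mem_holTangent_iff hq v).2) hX
  · rw [h.pullback_apply hp, hXp, h.fderiv_symm_comp hp]
  · exact h.leviNull_pullback hp hX.self_of_nhds.1 nX

theorem mem_leviKernel_iff (h : CREquiv Φ M M' ρ ρ') {p : E} (hp : p ∈ Φ.source) (v : E) :
    v ∈ leviKernel M ρ p ↔ fderiv ℝ Φ p v ∈ leviKernel M' ρ' (Φ p) := by
  refine ⟨fun hv => ?_, h.mem_leviKernel_of_fderiv hp v⟩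
  refine h.symm.mem_leviKernel_of_fderiv (Φ.map_source hp) _ ?_
  rwa [h.fderiv_symm_comp hp, Φ.left_inv hp]

theorem mem_freeman₃_of_fderiv (h : CREquiv Φ M M' ρ ρ') {p : E} (hp : p ∈ Φ.source) (v : E)
    (hv : fderiv ℝ Φ p v ∈ freeman₃ M' ρ' (Φ p)) : v ∈ freeman₃ M ρ p := by
  obtain ⟨X, hX, hXp, nX⟩ := hv
  refine ⟨VectorField.pullback ℝ Φ X, ?_, ?_, ?_⟩
  · exact h.isSection_pullback hp (fun q hq v => (h.mem_leviKernel_iff hq v).2) hX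
  · rw [h.pullback_apply hp, hXp, h.fderiv_symm_comp hp]
  · exact h.leviNull₂_pullback hp (hX.mono fun q hq => hq.1) nX

/-- The complex differential at a point. -/
def differential (h : CREquiv Φ M M' ρ ρ') {p : E} (hp : p ∈ Φ.source) : E ≃ₗ[ℂ] E where
  toFun := fderiv ℝ Φ p
  invFun := fderiv ℝ Φ.symm (Φ p)
  map_add' := map_add _
  map_smul' := h.fderiv_smul hp
  left_inv := h.fderiv_symm_comp hp
  right_inv := h.fderiv_comp_symm hp

/-- Uniform `2`-nondegeneracy is a biholomorphic invariant. -/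
theorem uniformlyTwoNondegenerateNear (h : CREquiv Φ M M' ρ ρ') {o : E} {s : ℕ}
    (ho : o ∈ Φ.source) (hM : UniformlyTwoNondegenerateNear M ρ o s) :
    UniformlyTwoNondegenerateNear M' ρ' (Φ o) s := by
  have hc := Φ.symm.continuousAt (x := Φ o) (Φ.map_source ho)
  rw [ContinuousAt, Φ.left_inv ho] at hc
  filter_upwards [hc.eventually hM, Φ.open_target.mem_nhds (Φ.map_source ho)] with p' hp' ht hm
  obtain ⟨p, hp, rfl⟩ : ∃ p ∈ Φ.source, Φ p = p' := ⟨Φ.symm p', Φ.map_target ht, Φ.right_inv ht⟩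
  rw [Φ.left_inv hp] at hp'
  obtain ⟨h1, h2, h3⟩ := hp' ((h.mem_iff p hp).2 hm)
  have eT : holTangent ρ' (Φ p) = (holTangent ρ p).map (h.differential hp : E →ₗ[ℂ] E) := by
    ext v
    rw [Submodule.mem_map_equiv, h.mem_holTangent_iff hp]
    exact iff_of_eq (congrArg (· ∈ holTangent ρ' (Φ p)) (h.fderiv_comp_symm hp v).symm)
  have eK : leviKernel M' ρ' (Φ p) = (leviKernel M ρ p).map (h.differential hp : E →ₗ[ℂ] E) := by
    ext v
    rw [Submodule.mem_map_equiv, h.mem_leviKernel_iff hp]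
    exact iff_of_eq (congrArg (· ∈ leviKernel M' ρ' (Φ p)) (h.fderiv_comp_symm hp v).symm)
  refine ⟨?_, ?_, ?_⟩
  · rw [← h1, leviRank, leviRank, eT, eK]
    exact (finrank_quotient_map _ _ _).symm
  · rw [eK]
    exact fun hh => h2 (Submodule.map_eq_bot_iff.1 hh)
  · apply Set.Subset.antisymm
    · intro v hv
      have : fderiv ℝ Φ.symm (Φ p) v ∈ freeman₃ M ρ p := by
        refine h.mem_freeman₃_of_fderiv hp _ ?_
        rwa [h.fderiv_comp_symm hp]
      rw [h3, Set.mem_singleton_iff] at this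
      rw [Set.mem_singleton_iff, ← h.fderiv_comp_symm hp v, this, map_zero]
    · rintro _ rfl
      refine h.symm.mem_freeman₃_of_fderiv (Φ.map_source hp) 0 ?_
      rw [map_zero]
      simp only [Φ.left_inv hp, h3, Set.mem_singleton_iff]

end CREquiv

end Transport

/-! ### Type decomposition of brackets of `(1,0)` and `(0,1)` fields. -/

section Brackets

variable {E : Type*} [NormedAddCommGroup E] [NormedSpace ℂ E] [NormedSpace ℝ E]

/-- Twice the derivative of the field `Y` along the `(0,1)` part of `X`. -/
def dbarAlong (X Y : E → E) (q : E) : E :=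
  fderiv ℝ Y q (X q) + Complex.I • fderiv ℝ Y q (Complex.I • X q)

/-- Twice the derivative of the field `Y` along the `(1,0)` part of `X`. -/
def delAlong (X Y : E → E) (q : E) : E :=
  fderiv ℝ Y q (X q) - Complex.I • fderiv ℝ Y q (Complex.I • X q)

theorem contDiffAt_dbarAlong {X Y : E → E} {q : E} (hX : ContDiffAt ℝ ∞ X q)
    (hY : ContDiffAt ℝ ∞ Y q) [IsScalarTower ℝ ℂ E] : ContDiffAt ℝ ∞ (dbarAlong X Y) q := by
  have b : ContDiffAt ℝ ∞ (fderiv ℝ Y) q := hY.fderiv_right (by simp)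
  exact (b.clm_apply hX).add ((b.clm_apply (hX.const_smul Complex.I)).const_smul Complex.I)

omit [NormedSpace ℝ E] in
theorem I_smul_I_smul (x : E) : Complex.I • Complex.I • x = -x := by
  rw [smul_smul, Complex.I_mul_I, neg_smul, one_smul]

variable [IsScalarTower ℝ ℂ E]

/-- The right side is `field01 (dbarAlong X Y) - field10 (dbarAlong Y X)`, the splitting of the
bracket by type; the iterated bracket is computed from it. -/
theorem cBracket_field10_field01 {X Y : E → E} {q : E} (hX : DifferentiableAt ℝ X q)
    (hY : DifferentiableAt ℝ Y q) :
    cBracket (field10 X) (field01 Y) q =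
      (dbarAlong X Y q - dbarAlong Y X q, Complex.I • (dbarAlong X Y q + dbarAlong Y X q)) := by
  have e1 : fderiv ℝ (fun q => -(Complex.I • X q)) q = -(Complex.I • fderiv ℝ X q) := by
    rw [fderiv_fun_neg, fderiv_fun_const_smul hX]
  have e2 : fderiv ℝ (fun q => Complex.I • Y q) q = Complex.I • fderiv ℝ Y q := by
    rw [fderiv_fun_const_smul hY]
  simp only [cBracket, field10, field01, VectorField.lieBracket, e1, e2, dbarAlong]
  ext
  · simp
    abel
  · simp [smul_add, I_smul_I_smul]
    abel

/-- The value is again of type `(0,1)`, with generator `delAlong X Y - delAlong Y X`. -/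
theorem cBracket_field01_field01 {X Y : E → E} {q : E} (hX : DifferentiableAt ℝ X q)
    (hY : DifferentiableAt ℝ Y q) :
    cBracket (field01 X) (field01 Y) q =
      (delAlong X Y q - delAlong Y X q, Complex.I • (delAlong X Y q - delAlong Y X q)) := by
  have e1 : fderiv ℝ (fun q => Complex.I • X q) q = Complex.I • fderiv ℝ X q := by
    rw [fderiv_fun_const_smul hX]
  have e2 : fderiv ℝ (fun q => Complex.I • Y q) q = Complex.I • fderiv ℝ Y q := by
    rw [fderiv_fun_const_smul hY]
  simp only [cBracket, field01, VectorField.lieBracket, e1, e2, delAlong]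
  ext
  · simp
    abel
  · simp [smul_sub, I_smul_I_smul]
    abel

omit [NormedSpace ℂ E] [IsScalarTower ℝ ℂ E] in
theorem cBracket_sub_left {V V' W : E → E × E} {q : E} (hV : DifferentiableAt ℝ V q)
    (hV' : DifferentiableAt ℝ V' q) :
    cBracket (fun x => V x - V' x) W q = cBracket V W q - cBracket V' W q := by
  simp only [cBracket, VectorField.lieBracket, Prod.fst_sub, Prod.snd_sub]
  rw [fderiv_fun_sub hV.fst hV'.fst, fderiv_fun_sub hV.snd hV'.snd]
  ext
  · simp
    abel
  · simp
    abel

/-- A criterion for the vanishing of the second generalized Levi form. -/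
theorem inHH_cBracket_cBracket {ρ : E → ℝ} {p : E} {X Y₁ Y₂ : E → E}
    (hX : ∀ᶠ q in 𝓝 p, ContDiffAt ℝ ∞ X q) (hY₁ : ∀ᶠ q in 𝓝 p, ContDiffAt ℝ ∞ Y₁ q)
    (hY₂ : DifferentiableAt ℝ Y₂ p)
    (h1 : delAlong (dbarAlong X Y₁) Y₂ p - delAlong Y₂ (dbarAlong X Y₁) p ∈ holTangent ρ p)
    (h2 : dbarAlong (dbarAlong Y₁ X) Y₂ p ∈ holTangent ρ p)
    (h3 : dbarAlong Y₂ (dbarAlong Y₁ X) p ∈ holTangent ρ p) :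
    InHH ρ p (cBracket (cBracket (field10 X) (field01 Y₁)) (field01 Y₂) p) := by
  -- Split the inner bracket by type: its `(0,1)` part is handled by `h1`, its `(1,0)` part by `h2`
  -- and `h3`.
  have e : cBracket (field10 X) (field01 Y₁) =ᶠ[𝓝 p]
      fun q => field01 (dbarAlong X Y₁) q - field10 (dbarAlong Y₁ X) q := by
    filter_upwards [hX, hY₁] with q a b
    rw [cBracket_field10_field01 (a.differentiableAt (by simp)) (b.differentiableAt (by simp))]
    simp only [field01, field10]
    ext
    · simp
    · simp
  have cu := contDiffAt_dbarAlong hX.self_of_nhds hY₁.self_of_nhds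
  have cv := contDiffAt_dbarAlong hY₁.self_of_nhds hX.self_of_nhds
  have du := cu.differentiableAt (by simp : (∞ : WithTop ℕ∞) ≠ 0)
  have dv := cv.differentiableAt (by simp : (∞ : WithTop ℕ∞) ≠ 0)
  rw [(e.cBracket (EventuallyEq.refl _ _)).self_of_nhds,
    cBracket_sub_left ((contDiffAt_field01 cu).differentiableAt (by simp))
      ((contDiffAt_field10 cv).differentiableAt (by simp))]
  have b := (inHH_cBracket_iff (ρ := ρ) dv hY₂).2 ⟨h2, h3⟩
  have a : InHH ρ p (cBracket (field01 (dbarAlong X Y₁)) (field01 Y₂) p) := by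
    rw [cBracket_field01_field01 du hY₂]
    exact ⟨h1, Submodule.smul_mem _ _ h1⟩
  exact ⟨Submodule.sub_mem _ a.1 b.1, Submodule.sub_mem _ a.2 b.2⟩

end Brackets

/-! ### Derivatives of complex valued functions along complexified vectors. -/

section Calculus

variable {E : Type*} [NormedAddCommGroup E] [NormedSpace ℝ E]

/-- The function `g` is differentiable at `q`, with derivative `g'` along the complexified tangent
vector `V.1 + i V.2`. -/
def HasCDeriv (g : E → ℂ) (g' : ℂ) (q : E) (V : E × E) : Prop :=
  DifferentiableAt ℝ g q ∧ fderiv ℝ g q V.1 + Complex.I * fderiv ℝ g q V.2 = g'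

namespace HasCDeriv

variable {f g : E → ℂ} {f' g' : ℂ} {q : E} {V : E × E}

theorem of_differentiableAt (hg : DifferentiableAt ℝ g q) :
    HasCDeriv g (fderiv ℝ g q V.1 + Complex.I * fderiv ℝ g q V.2) q V := ⟨hg, rfl⟩

theorem unique (h : HasCDeriv g f' q V) (h' : HasCDeriv g g' q V) : f' = g' :=
  h.2.symm.trans h'.2

theorem congr_deriv (h : HasCDeriv g f' q V) (e : f' = g') : HasCDeriv g g' q V := e ▸ h

theorem congr_of_eventuallyEq (h : HasCDeriv g g' q V) (e : f =ᶠ[𝓝 q] g) :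
    HasCDeriv f g' q V :=
  ⟨h.1.congr_of_eventuallyEq e, by rw [e.fderiv_eq]; exact h.2⟩

theorem const (c : ℂ) : HasCDeriv (fun _ : E => c) 0 q V :=
  ⟨differentiableAt_const c, by simp⟩

theorem add (hf : HasCDeriv f f' q V) (hg : HasCDeriv g g' q V) :
    HasCDeriv (fun p => f p + g p) (f' + g') q V := by
  refine ⟨hf.1.add hg.1, ?_⟩
  rw [fderiv_fun_add hf.1 hg.1, ← hf.2, ← hg.2]
  simp only [_root_.add_apply]
  ring

theorem neg (hf : HasCDeriv f f' q V) : HasCDeriv (fun p => -f p) (-f') q V := by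
  refine ⟨hf.1.neg, ?_⟩
  rw [fderiv_fun_neg, ← hf.2]
  simp only [_root_.neg_apply]
  ring

theorem sub (hf : HasCDeriv f f' q V) (hg : HasCDeriv g g' q V) :
    HasCDeriv (fun p => f p - g p) (f' - g') q V := by
  simpa only [sub_eq_add_neg] using hf.add hg.neg

theorem mul (hf : HasCDeriv f f' q V) (hg : HasCDeriv g g' q V) :
    HasCDeriv (fun p => f p * g p) (f' * g q + f q * g') q V := by
  refine ⟨hf.1.mul hg.1, ?_⟩
  rw [fderiv_fun_mul hf.1 hg.1, ← hf.2, ← hg.2]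
  simp only [_root_.add_apply, _root_.smul_apply, smul_eq_mul]
  ring

theorem const_mul (c : ℂ) (hg : HasCDeriv g g' q V) :
    HasCDeriv (fun p => c * g p) (c * g') q V := by
  simpa using (const c).mul hg

theorem sum {ι : Type*} {s : Finset ι} {F : ι → E → ℂ} {F' : ι → ℂ}
    (h : ∀ i ∈ s, HasCDeriv (F i) (F' i) q V) :
    HasCDeriv (fun p => ∑ i ∈ s, F i p) (∑ i ∈ s, F' i) q V := by
  classical
  induction s using Finset.induction_on with
  | empty => simpa using const (0 : ℂ)
  | insert a s ha ih =>
    simp only [Finset.sum_insert ha]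
    exact (h a (by simp)).add (ih fun i hi => h i (by simp [hi]))

/-- Conjugating the function conjugates the direction as well; this is what exchanges `∂` and `∂̄`
derivatives. -/
theorem conj (hf : HasCDeriv f f' q V) :
    HasCDeriv (fun p => starRingEnd ℂ (f p)) (starRingEnd ℂ f') q (V.1, -V.2) := by
  have h := Complex.conjCLE.hasFDerivAt.comp q hf.1.hasFDerivAt
  refine ⟨h.differentiableAt, ?_⟩
  have e : fderiv ℝ (fun p => starRingEnd ℂ (f p)) q = _ := h.fderiv
  rw [e, ← hf.2]
  simp

theorem dotProduct {n : ℕ} {F G : E → Fin n → ℂ} {F' G' : Fin n → ℂ}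
    (hF : ∀ i, HasCDeriv (fun p => F p i) (F' i) q V)
    (hG : ∀ i, HasCDeriv (fun p => G p i) (G' i) q V) :
    HasCDeriv (fun p => F p ⬝ᵥ G p) (F' ⬝ᵥ G q + F q ⬝ᵥ G') q V := by
  refine (sum (s := Finset.univ) fun i _ => (hF i).mul (hG i)).congr_deriv ?_
  simp only [_root_.dotProduct, Finset.sum_add_distrib]

theorem mulVec {m n : ℕ} {A : E → Matrix (Fin m) (Fin n) ℂ} {A' : Matrix (Fin m) (Fin n) ℂ}
    {G : E → Fin n → ℂ} {G' : Fin n → ℂ}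
    (hA : ∀ i j, HasCDeriv (fun p => A p i j) (A' i j) q V)
    (hG : ∀ i, HasCDeriv (fun p => G p i) (G' i) q V) (i : Fin m) :
    HasCDeriv (fun p => (A p *ᵥ G p) i) ((A' *ᵥ G q + A q *ᵥ G') i) q V :=
  dotProduct (hA i) hG

end HasCDeriv

end Calculus

/-! ### Polarization of identities in `ζ` and `ζ̄`. -/

section Polarization

/-- Polarization: in an identity `∑ conj (f k) * g k = 0` between holomorphic functions on a ball,
the antiholomorphic factors may be evaluated at the centre. -/
theorem sum_conj_mul_eq_zero_polarized {E ι : Type*} [NormedAddCommGroup E] [NormedSpace ℂ E]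
    [Fintype ι] {f g : ι → E → ℂ} {R : ℝ}
    (hf : ∀ k, DifferentiableOn ℂ (f k) (Metric.ball 0 R))
    (hg : ∀ k, DifferentiableOn ℂ (g k) (Metric.ball 0 R))
    (h : ∀ x ∈ Metric.ball (0 : E) R, ∑ k, starRingEnd ℂ (f k x) * g k x = 0)
    {x : E} (hx : x ∈ Metric.ball (0 : E) (R / 2)) :
    ∑ k, starRingEnd ℂ (f k 0) * g k x = 0 := by
  set γ : ℂ → E := fun t => (1 / 2 : ℂ) • x + t • (-(Complex.I / 2) • x) with hγ
  have hγd : Differentiable ℂ γ := by fun_prop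
  have hball : ∀ t ∈ Metric.ball (0 : ℂ) 2, γ t ∈ Metric.ball (0 : E) R := by
    intro t ht
    rw [mem_ball_zero_iff] at ht hx ⊢
    have e : ‖γ t‖ ≤ 1 / 2 * ‖x‖ + ‖t‖ * (1 / 2 * ‖x‖) := by
      refine (norm_add_le _ _).trans (le_of_eq ?_)
      simp [norm_smul]
    nlinarith [norm_nonneg x, norm_nonneg t]
  have hconj : ∀ t ∈ Metric.ball (0 : ℂ) 2, starRingEnd ℂ t ∈ Metric.ball (0 : ℂ) 2 := by
    intro t ht
    rwa [mem_ball_zero_iff, RCLike.norm_conj, ← mem_ball_zero_iff]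
  -- The inner conjugation makes `F` holomorphic, and for real `t` it is the sum in the hypothesis.
  -- The identity theorem gives `F = 0`; at `t = i` the conjugated factors are evaluated at `γ(-i) =
  -- 0`.
  set F : ℂ → ℂ := fun t =>
    ∑ k, starRingEnd ℂ (f k (γ (starRingEnd ℂ t))) * g k (γ t) with hF
  have hFd : DifferentiableOn ℂ F (Metric.ball 0 2) := by
    intro t ht
    refine DifferentiableAt.differentiableWithinAt ?_
    refine DifferentiableAt.fun_sum fun k _ => DifferentiableAt.mul ?_ ?_
    · have d : DifferentiableAt ℂ (fun t => f k (γ t)) (starRingEnd ℂ t) :=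
        ((hf k).differentiableAt (Metric.isOpen_ball.mem_nhds (hball _ (hconj t ht)))).comp _
          (hγd _)
      have := d.hasDerivAt.conj_conj.differentiableAt
      rwa [Complex.conj_conj] at this
    · exact ((hg k).differentiableAt (Metric.isOpen_ball.mem_nhds (hball _ ht))).comp _ (hγd _)
  have hreal : ∀ t : ℝ, (t : ℂ) ∈ Metric.ball (0 : ℂ) 2 → F t = 0 := by
    intro t ht
    simp only [hF, Complex.conj_ofReal]
    exact h _ (hball _ ht)
  have hfreq : ∃ᶠ t in 𝓝[≠] (0 : ℂ), F t = 0 := by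
    have ht : Tendsto (fun t : ℝ => (t : ℂ)) (𝓝[≠] 0) (𝓝[≠] (0 : ℂ)) := by
      refine tendsto_nhdsWithin_of_tendsto_nhds_of_eventually_within _ ?_ ?_
      · have : Tendsto (fun t : ℝ => (t : ℂ)) (𝓝 0) (𝓝 ((0 : ℝ) : ℂ)) :=
          Complex.continuous_ofReal.continuousAt
        rw [Complex.ofReal_zero] at this
        exact this.mono_left nhdsWithin_le_nhds
      · filter_upwards [self_mem_nhdsWithin] with t ht
        simpa using ht
    refine ht.frequently (Eventually.frequently ?_)
    have hb : Metric.ball (0 : ℝ) 2 ∈ 𝓝 (0 : ℝ) := Metric.ball_mem_nhds _ (by norm_num)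
    filter_upwards [nhdsWithin_le_nhds hb] with t ht
    exact hreal t (by simpa using ht)
  have hI : Complex.I ∈ Metric.ball (0 : ℂ) 2 := by simp
  have key := (hFd.analyticOnNhd Metric.isOpen_ball).eqOn_zero_of_preconnected_of_frequently_eq_zero
    (convex_ball (0 : ℂ) 2).isPreconnected (Metric.mem_ball_self two_pos) hfreq hI
  have e1 : γ Complex.I = x := by
    simp only [hγ, smul_smul, ← add_smul]
    convert one_smul ℂ x using 2
    linear_combination (-1 / 2 : ℂ) * Complex.I_mul_I
  have e2 : γ (starRingEnd ℂ Complex.I) = 0 := by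
    simp only [hγ, smul_smul, ← add_smul, Complex.conj_I]
    convert zero_smul ℂ x using 2
    linear_combination (1 / 2 : ℂ) * Complex.I_mul_I
  simpa only [hF, e1, e2, Pi.zero_apply] using key

end Polarization

/-! ### Entrywise analytic matrix functions. -/

section MatrixAnalytic

variable {𝕜 : Type*} [NontriviallyNormedField 𝕜] [NormedAlgebra 𝕜 ℂ]
  {E : Type*} [NormedAddCommGroup E] [NormedSpace 𝕜 E] {l m n : ℕ}

variable (𝕜) in
/-- Entrywise analyticity of a matrix valued function. -/
def MatAnalyticAt (A : E → Matrix (Fin m) (Fin n) ℂ) (x : E) : Prop :=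
  ∀ i j, AnalyticAt 𝕜 (fun y => A y i j) x

namespace MatAnalyticAt

theorem const (A : Matrix (Fin m) (Fin n) ℂ) (x : E) : MatAnalyticAt 𝕜 (fun _ => A) x :=
  fun _ _ => analyticAt_const

variable {A B : E → Matrix (Fin m) (Fin n) ℂ} {x : E}

theorem congr (hA : MatAnalyticAt 𝕜 A x) (h : A =ᶠ[𝓝 x] B) : MatAnalyticAt 𝕜 B x :=
  fun i j => (hA i j).congr (h.mono fun y hy => by simp only [hy])

theorem add (hA : MatAnalyticAt 𝕜 A x) (hB : MatAnalyticAt 𝕜 B x) :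
    MatAnalyticAt 𝕜 (fun y => A y + B y) x := fun i j => (hA i j).add (hB i j)

theorem sub (hA : MatAnalyticAt 𝕜 A x) (hB : MatAnalyticAt 𝕜 B x) :
    MatAnalyticAt 𝕜 (fun y => A y - B y) x := fun i j => (hA i j).sub (hB i j)

theorem neg (hA : MatAnalyticAt 𝕜 A x) :
    MatAnalyticAt 𝕜 (fun y => -A y) x := fun i j => (hA i j).neg

theorem const_smul (c : ℂ) (hA : MatAnalyticAt 𝕜 A x) :
    MatAnalyticAt 𝕜 (fun y => c • A y) x := fun i j => analyticAt_const.mul (hA i j)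

theorem transpose (hA : MatAnalyticAt 𝕜 A x) :
    MatAnalyticAt 𝕜 (fun y => (A y)ᵀ) x := fun i j => hA j i

theorem mul {C : E → Matrix (Fin n) (Fin l) ℂ} (hA : MatAnalyticAt 𝕜 A x)
    (hC : MatAnalyticAt 𝕜 C x) : MatAnalyticAt 𝕜 (fun y => A y * C y) x := fun i j => by
  simp only [Matrix.mul_apply]
  exact Finset.analyticAt_fun_sum _ fun k _ => (hA i k).mul (hC k j)

theorem det {A : E → Matrix (Fin n) (Fin n) ℂ} (hA : MatAnalyticAt 𝕜 A x) :
    AnalyticAt 𝕜 (fun y => (A y).det) x := by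
  simp only [Matrix.det_apply']
  exact Finset.analyticAt_fun_sum _ fun σ _ =>
    analyticAt_const.mul (Finset.analyticAt_fun_prod _ fun i _ => hA _ _)

theorem inv {A : E → Matrix (Fin n) (Fin n) ℂ} (hA : MatAnalyticAt 𝕜 A x)
    (h : IsUnit (A x).det) : MatAnalyticAt 𝕜 (fun y => (A y)⁻¹) x := fun i j => by
  simp only [Matrix.inv_def, Matrix.smul_apply, smul_eq_mul, Ring.inverse_eq_inv']
  refine (hA.det.inv h.ne_zero).mul ?_
  simp only [Matrix.adjugate_apply]
  refine MatAnalyticAt.det fun a b => ?_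
  by_cases hab : a = j
  · subst hab
    simpa using analyticAt_const
  · simpa [Matrix.updateRow_ne hab] using hA a b

theorem restrictScalars {E : Type*} [NormedAddCommGroup E] [NormedSpace ℂ E] [NormedSpace ℝ E]
    [IsScalarTower ℝ ℂ E] {A : E → Matrix (Fin m) (Fin n) ℂ} {x : E}
    (hA : MatAnalyticAt ℂ A x) : MatAnalyticAt ℝ A x :=
  fun i j => (hA i j).restrictScalars

theorem conj {E : Type*} [NormedAddCommGroup E] [NormedSpace ℝ E]
    {A : E → Matrix (Fin m) (Fin m) ℂ} {x : E} (hA : MatAnalyticAt ℝ A x) :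
    MatAnalyticAt ℝ (fun y => conjMat (A y)) x :=
  fun i j => (Complex.conjCLE.toContinuousLinearMap.analyticAt _).comp (hA i j)

theorem eventually_isUnit_det {A : E → Matrix (Fin n) (Fin n) ℂ} (hA : MatAnalyticAt 𝕜 A x)
    (h : IsUnit (A x).det) : ∀ᶠ y in 𝓝 x, IsUnit (A y).det := by
  filter_upwards [hA.det.continuousAt.eventually_ne h.ne_zero] with y hy using hy.isUnit

theorem eventually [CompleteSpace 𝕜] (hA : MatAnalyticAt 𝕜 A x) :
    ∀ᶠ y in 𝓝 x, MatAnalyticAt 𝕜 A y := by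
  simp only [MatAnalyticAt, Filter.eventually_all]
  exact fun i j => (hA i j).eventually_analyticAt

end MatAnalyticAt

end MatrixAnalytic

/-! ### Entrywise conjugation, Hermitian and symmetric forms. -/

section ConjMat

variable {s : ℕ}

theorem conjMat_eq (A : Matrix (Fin s) (Fin s) ℂ) : conjMat A = Aᴴᵀ := rfl

theorem conjMat_mul (A B : Matrix (Fin s) (Fin s) ℂ) :
    conjMat (A * B) = conjMat A * conjMat B := Matrix.map_mul

theorem conjMat_sub (A B : Matrix (Fin s) (Fin s) ℂ) :
    conjMat (A - B) = conjMat A - conjMat B := by ext; simp [conjMat]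

theorem conjMat_neg (A : Matrix (Fin s) (Fin s) ℂ) :
    conjMat (-A) = -conjMat A := by ext; simp [conjMat]

theorem conjMat_one : conjMat (1 : Matrix (Fin s) (Fin s) ℂ) = 1 := by
  simp [conjMat]

theorem conjMat_zero : conjMat (0 : Matrix (Fin s) (Fin s) ℂ) = 0 := by
  simp [conjMat]

theorem conjMat_conjMat (A : Matrix (Fin s) (Fin s) ℂ) : conjMat (conjMat A) = A := by
  ext; simp [conjMat]

theorem conjMat_transpose (A : Matrix (Fin s) (Fin s) ℂ) : conjMat Aᵀ = (conjMat A)ᵀ := rfl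

theorem conjMat_inv (A : Matrix (Fin s) (Fin s) ℂ) : conjMat A⁻¹ = (conjMat A)⁻¹ := by
  rw [conjMat_eq, conjMat_eq, Matrix.conjTranspose_nonsing_inv, Matrix.transpose_nonsing_inv]

theorem conjMat_of_isHermitian {A : Matrix (Fin s) (Fin s) ℂ} (hA : A.IsHermitian) :
    conjMat A = Aᵀ := by
  rw [conjMat_eq, hA.eq]

theorem star_mulVec_eq (A : Matrix (Fin s) (Fin s) ℂ) (v : Fin s → ℂ) :
    star (A *ᵥ v) = conjMat A *ᵥ star v := by
  ext i
  simp [Matrix.mulVec, dotProduct, conjMat]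

theorem conj_dotProduct (v w : Fin s → ℂ) : starRingEnd ℂ (v ⬝ᵥ w) = star v ⬝ᵥ star w := by
  simp [dotProduct]

theorem dotProduct_mulVec_transpose (A : Matrix (Fin s) (Fin s) ℂ) (v w : Fin s → ℂ) :
    v ⬝ᵥ (A *ᵥ w) = w ⬝ᵥ (Aᵀ *ᵥ v) := by
  rw [Matrix.dotProduct_mulVec, dotProduct_comm, Matrix.mulVec_transpose]

theorem re_dotProduct_hermitian {A : Matrix (Fin s) (Fin s) ℂ} (hA : A.IsHermitian)
    (v w : Fin s → ℂ) : (v ⬝ᵥ (A *ᵥ star w)).re = (w ⬝ᵥ (A *ᵥ star v)).re := by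
  rw [← Complex.conj_re, conj_dotProduct, star_mulVec_eq, star_star, conjMat_of_isHermitian hA,
    dotProduct_mulVec_transpose, Matrix.transpose_transpose]

/-- Under the real part the form in `z̄` becomes one in `z` with conjugated matrix. The coefficient
`S` is used below mainly through `conjMat S`, which transforms by holomorphic matrices. -/
theorem re_dotProduct_conjMat (A : Matrix (Fin s) (Fin s) ℂ)
    (v w : Fin s → ℂ) : (star v ⬝ᵥ (A *ᵥ star w)).re = (v ⬝ᵥ (conjMat A *ᵥ w)).re := by
  rw [← Complex.conj_re, conj_dotProduct, star_mulVec_eq, star_star, star_star]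

end ConjMat

/-! ### First derivatives of the defining function. -/

section Ambient

variable {s r : ℕ}

/-- The differential of a matrix valued function. -/
def dMat (A : MatFun s r) (ζ v : Fin r → ℂ) : Matrix (Fin s) (Fin s) ℂ :=
  Matrix.of fun i j => fderiv ℝ (fun ζ => A ζ i j) ζ v

theorem dMat_zero (A : MatFun s r) (ζ : Fin r → ℂ) : dMat A ζ 0 = 0 := by
  ext
  simp [dMat]

/-- The holomorphic gradient of `zᵀ H z̄ + Re (z̄ᵀ S z̄)` in `z`. -/
def zGrad (H S : MatFun s r) (z : Fin s → ℂ) (ζ : Fin r → ℂ) : Fin s → ℂ :=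
  H ζ *ᵥ star z + conjMat (S ζ) *ᵥ z

theorem HasCDeriv.fderiv_re {E : Type*} [NormedAddCommGroup E] [NormedSpace ℝ E] {g : E → ℂ}
    {g' : ℂ} {q v : E} (hg : HasCDeriv g g' q (v, 0)) :
    HasFDerivAt (fun p => (g p).re) (Complex.reCLM.comp (fderiv ℝ g q)) q ∧
      Complex.reCLM.comp (fderiv ℝ g q) v = g'.re := by
  refine ⟨Complex.reCLM.hasFDerivAt.comp q hg.1.hasFDerivAt, ?_⟩
  rw [← hg.2]
  simp

theorem hasCDeriv_w (q : Amb s r) (V : Amb s r × Amb s r) :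
    HasCDeriv (fun p : Amb s r => p.1) (V.1.1 + Complex.I * V.2.1) q V := by
  refine ⟨differentiableAt_fst, ?_⟩
  rw [fderiv_fst]
  rfl

theorem hasCDeriv_z (q : Amb s r) (V : Amb s r × Amb s r) (i : Fin s) :
    HasCDeriv (fun p : Amb s r => p.2.1 i) (V.1.2.1 i + Complex.I * V.2.2.1 i) q V := by
  set L : Amb s r →L[ℝ] ℂ := (ContinuousLinearMap.proj i).comp
    ((ContinuousLinearMap.fst ℝ (Fin s → ℂ) (Fin r → ℂ)).comp
      (ContinuousLinearMap.snd ℝ ℂ ((Fin s → ℂ) × (Fin r → ℂ))))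
  have h : HasFDerivAt (fun p : Amb s r => p.2.1 i) L q := L.hasFDerivAt
  exact ⟨h.differentiableAt, by rw [h.fderiv]; rfl⟩

theorem hasCDeriv_star_z (q : Amb s r) (V : Amb s r × Amb s r) (i : Fin s) :
    HasCDeriv (fun p : Amb s r => (star p.2.1) i)
      ((star V.1.2.1) i + Complex.I * (star V.2.2.1) i) q V := by
  have h := (hasCDeriv_z q (V.1, -V.2) i).conj
  simp only [neg_neg] at h
  refine h.congr_deriv ?_
  simp

theorem hasFDerivAt_comp_zeta {F : Type*} [NormedAddCommGroup F] [NormedSpace ℝ F]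
    {f : (Fin r → ℂ) → F} {q : Amb s r}
    (hf : DifferentiableAt ℝ f q.2.2) :
    HasFDerivAt (fun p : Amb s r => f p.2.2) ((fderiv ℝ f q.2.2).comp
      ((ContinuousLinearMap.snd ℝ (Fin s → ℂ) (Fin r → ℂ)).comp
        (ContinuousLinearMap.snd ℝ ℂ ((Fin s → ℂ) × (Fin r → ℂ))))) q :=
  HasFDerivAt.comp (g := f) (f := fun p : Amb s r => p.2.2) q hf.hasFDerivAt
    ((ContinuousLinearMap.snd ℝ (Fin s → ℂ) (Fin r → ℂ)).comp
        (ContinuousLinearMap.snd ℝ ℂ ((Fin s → ℂ) × (Fin r → ℂ)))).hasFDerivAt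

theorem hasCDeriv_mat {A : MatFun s r} {q : Amb s r} (V : Amb s r × Amb s r) (i j : Fin s)
    (hA : DifferentiableAt ℝ (fun ζ => A ζ i j) q.2.2) :
    HasCDeriv (fun p : Amb s r => A p.2.2 i j)
      ((dMat A q.2.2 V.1.2.2 + Complex.I • dMat A q.2.2 V.2.2.2) i j) q V := by
  have h := hasFDerivAt_comp_zeta (q := q) hA
  refine ⟨h.differentiableAt, ?_⟩
  rw [h.fderiv]
  rfl

theorem hasFDerivAt_defFun_aux {H S : MatFun s r} {q : Amb s r}
    (hH : ∀ i j, DifferentiableAt ℝ (fun ζ => H ζ i j) q.2.2)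
    (hS : ∀ i j, DifferentiableAt ℝ (fun ζ => S ζ i j) q.2.2) :
    DifferentiableAt ℝ (defFun H S) q ∧ ∀ v : Amb s r,
      fderiv ℝ (defFun H S) q v =
        ((v.2.1 ⬝ᵥ (H q.2.2 *ᵥ star q.2.1) +
          q.2.1 ⬝ᵥ (dMat H q.2.2 v.2.2 *ᵥ star q.2.1 + H q.2.2 *ᵥ star v.2.1)) +
        (star v.2.1 ⬝ᵥ (S q.2.2 *ᵥ star q.2.1) +
          star q.2.1 ⬝ᵥ (dMat S q.2.2 v.2.2 *ᵥ star q.2.1 + S q.2.2 *ᵥ star v.2.1)) - v.1).re := by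
  have key : ∀ v : Amb s r, HasCDeriv (fun p : Amb s r => p.2.1 ⬝ᵥ (H p.2.2 *ᵥ star p.2.1) +
      star p.2.1 ⬝ᵥ (S p.2.2 *ᵥ star p.2.1) - p.1) _ q (v, 0) := fun v =>
    ((HasCDeriv.dotProduct (fun i => hasCDeriv_z q (v, 0) i)
      (HasCDeriv.mulVec (fun i j => hasCDeriv_mat (v, 0) i j (hH i j))
        (fun i => hasCDeriv_star_z q (v, 0) i))).add
    (HasCDeriv.dotProduct (fun i => hasCDeriv_star_z q (v, 0) i)
      (HasCDeriv.mulVec (fun i j => hasCDeriv_mat (v, 0) i j (hS i j))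
        (fun i => hasCDeriv_star_z q (v, 0) i)))).sub (hasCDeriv_w q (v, 0))
  have e : defFun H S = fun p : Amb s r => (p.2.1 ⬝ᵥ (H p.2.2 *ᵥ star p.2.1) +
      star p.2.1 ⬝ᵥ (S p.2.2 *ᵥ star p.2.1) - p.1).re := by
    ext p
    simp [defFun]
  rw [e]
  refine ⟨(key 0).fderiv_re.1.differentiableAt, fun v => ?_⟩
  rw [(key v).fderiv_re.1.fderiv, (key v).fderiv_re.2]
  have e1 : (fun i => v.2.1 i) = v.2.1 := rfl
  have e2 : (fun i => star v.2.1 i) = star v.2.1 := rfl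
  simp only [Prod.fst_zero, Prod.snd_zero, Pi.zero_apply, mul_zero, add_zero, dMat_zero, smul_zero,
    star_zero, e1, e2]

theorem differentiableAt_defFun {H S : MatFun s r} {q : Amb s r}
    (hH : ∀ i j, DifferentiableAt ℝ (fun ζ => H ζ i j) q.2.2)
    (hS : ∀ i j, DifferentiableAt ℝ (fun ζ => S ζ i j) q.2.2) :
    DifferentiableAt ℝ (defFun H S) q := (hasFDerivAt_defFun_aux hH hS).1

/-- Hermitian symmetry of `H` and symmetry of `S` allow the derivatives in `z` and `z̄` to be
merged, under the real part, into one expression complex linear in `v.2.1`. -/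
theorem fderiv_defFun {H S : MatFun s r} {q : Amb s r}
    (hH : ∀ i j, DifferentiableAt ℝ (fun ζ => H ζ i j) q.2.2)
    (hS : ∀ i j, DifferentiableAt ℝ (fun ζ => S ζ i j) q.2.2)
    (hHh : (H q.2.2).IsHermitian) (hSs : (S q.2.2).IsSymm) (v : Amb s r) :
    fderiv ℝ (defFun H S) q v =
      (2 * (v.2.1 ⬝ᵥ zGrad H S q.2.1 q.2.2) + (q.2.1 ⬝ᵥ (dMat H q.2.2 v.2.2 *ᵥ star q.2.1) +
        star q.2.1 ⬝ᵥ (dMat S q.2.2 v.2.2 *ᵥ star q.2.1)) - v.1).re := by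
  rw [(hasFDerivAt_defFun_aux hH hS).2 v]
  have h1 := re_dotProduct_hermitian hHh q.2.1 v.2.1
  have h2 := re_dotProduct_conjMat (S q.2.2) v.2.1 q.2.1
  have h3 : star q.2.1 ⬝ᵥ (S q.2.2 *ᵥ star v.2.1) = star v.2.1 ⬝ᵥ (S q.2.2 *ᵥ star q.2.1) := by
    rw [dotProduct_mulVec_transpose, hSs.eq]
  simp only [dotProduct_add, zGrad, h3, Complex.add_re, Complex.sub_re, Complex.mul_re,
    Complex.re_ofNat, Complex.im_ofNat, h1, h2, zero_mul, sub_zero]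
  ring

theorem fst_fderiv {Y : Amb s r → Amb s r} {q : Amb s r} (hY : DifferentiableAt ℝ Y q)
    (v : Amb s r) : (fderiv ℝ Y q v).1 = fderiv ℝ (fun p => (Y p).1) q v := by
  have h := (ContinuousLinearMap.fst ℝ ℂ ((Fin s → ℂ) × (Fin r → ℂ))).hasFDerivAt.comp q
    hY.hasFDerivAt
  have e : fderiv ℝ (fun p => (Y p).1) q = _ := h.fderiv
  rw [e]
  rfl

end Ambient

/-! ### The equation imposed by an infinitesimal symmetry along the slice `w = 0`, `z = 0`. -/

section Symmetries

theorem HasCDeriv.conjMat {E : Type*} [NormedAddCommGroup E] [NormedSpace ℝ E] {n : ℕ}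
    {A : E → Matrix (Fin n) (Fin n) ℂ} {A' : Matrix (Fin n) (Fin n) ℂ} {q : E} {V : E × E}
    (hA : ∀ i j, HasCDeriv (fun p => A p i j) (A' i j) q (V.1, -V.2)) (i j : Fin n) :
    HasCDeriv (fun p => CRHyp.conjMat (A p) i j) (CRHyp.conjMat A' i j) q V := by
  have h := (hA i j).conj
  simp only [neg_neg] at h
  exact h

variable {s r : ℕ} {U : Set (Fin r → ℂ)} {H S : MatFun s r}

/-- Pointwise evaluation of a smooth matrix valued function on an open set. -/
theorem contDiffAt_entry {A : MatFun s r} (hU : IsOpen U)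
    (hA : ∀ i j, ContDiffOn ℝ ∞ (fun ζ => A ζ i j) U) {ζ : Fin r → ℂ} (hζ : ζ ∈ U) (i j : Fin s) :
    ContDiffAt ℝ ∞ (fun ζ => A ζ i j) ζ := (hA i j).contDiffAt (hU.mem_nhds hζ)

theorem differentiableAt_entry {A : MatFun s r} (hU : IsOpen U)
    (hA : ∀ i j, ContDiffOn ℝ ∞ (fun ζ => A ζ i j) U) {ζ : Fin r → ℂ} (hζ : ζ ∈ U) (i j : Fin s) :
    DifferentiableAt ℝ (fun ζ => A ζ i j) ζ :=
  (contDiffAt_entry hU hA hζ i j).differentiableAt (by simp)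

theorem eventually_zeta_mem (hU : IsOpen U) {q : Amb s r} (hq : q.2.2 ∈ U) :
    ∀ᶠ p in 𝓝 q, p.2.2 ∈ U :=
  (continuous_snd.snd.continuousAt (x := q)).eventually (hU.mem_nhds hq)

theorem contDiffAt_zeta (q : Amb s r) : ContDiffAt ℝ ∞ (fun p : Amb s r => p.2.2) q :=
  contDiff_snd.snd.contDiffAt

theorem contDiffAt_z (q : Amb s r) : ContDiffAt ℝ ∞ (fun p : Amb s r => p.2.1) q :=
  contDiff_snd.fst.contDiffAt

theorem contDiffAt_conj {E : Type*} [NormedAddCommGroup E] [NormedSpace ℝ E] {f : E → ℂ} {q : E}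
    (hf : ContDiffAt ℝ ∞ f q) : ContDiffAt ℝ ∞ (fun p => starRingEnd ℂ (f p)) q :=
  Complex.conjCLE.contDiff.contDiffAt.comp q hf

theorem contDiffAt_dotProduct {E : Type*} [NormedAddCommGroup E] [NormedSpace ℝ E] {n : ℕ}
    {f g : E → Fin n → ℂ} {q : E} (hf : ∀ i, ContDiffAt ℝ ∞ (fun p => f p i) q)
    (hg : ∀ i, ContDiffAt ℝ ∞ (fun p => g p i) q) :
    ContDiffAt ℝ ∞ (fun p => f p ⬝ᵥ g p) q := by
  simp only [dotProduct]
  exact ContDiffAt.sum fun i _ => (hf i).mul (hg i)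

theorem contDiffAt_mat {A : MatFun s r} (hU : IsOpen U)
    (hA : ∀ i j, ContDiffOn ℝ ∞ (fun ζ => A ζ i j) U) {q : Amb s r} (hq : q.2.2 ∈ U) (i j : Fin s) :
    ContDiffAt ℝ ∞ (fun p : Amb s r => A p.2.2 i j) q :=
  ContDiffAt.comp (g := fun ζ => A ζ i j) q (contDiffAt_entry hU hA hq i j) (contDiffAt_zeta q)

/-- The `(1,0)` field with constant `z`-component `y` and no `ζ`-component. -/
def zField (H S : MatFun s r) (y : Fin s → ℂ) : Amb s r → Amb s r := fun q =>
  (2 * (y ⬝ᵥ zGrad H S q.2.1 q.2.2), y, 0)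

theorem contDiffAt_zField (hU : IsOpen U) (hH : ∀ i j, ContDiffOn ℝ ∞ (fun ζ => H ζ i j) U)
    (hS : ∀ i j, ContDiffOn ℝ ∞ (fun ζ => S ζ i j) U) (y : Fin s → ℂ) {q : Amb s r}
    (hq : q.2.2 ∈ U) : ContDiffAt ℝ ∞ (zField H S y) q := by
  have hz : ∀ i, ContDiffAt ℝ ∞ (fun p : Amb s r => p.2.1 i) q := fun i =>
    contDiffAt_pi.1 (contDiffAt_z q) i
  refine ContDiffAt.prodMk (contDiffAt_const.mul (contDiffAt_dotProduct
    (fun i => contDiffAt_const) fun i => ?_)) contDiffAt_const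
  refine ContDiffAt.add (contDiffAt_dotProduct (fun j => contDiffAt_mat hU hH hq i j)
    fun j => contDiffAt_conj (hz j)) (contDiffAt_dotProduct (fun j => ?_) hz)
  exact contDiffAt_conj (contDiffAt_mat hU hS hq i j)

theorem isSection_zField (hd : IsDefiningData U H S)
    (hH : ∀ i j, ContDiffOn ℝ ∞ (fun ζ => H ζ i j) U)
    (hS : ∀ i j, ContDiffOn ℝ ∞ (fun ζ => S ζ i j) U) (y : Fin s → ℂ) {q : Amb s r}
    (hq : q.2.2 ∈ U) (M : Set (Amb s r)) :
    IsSection M (holTangent (defFun H S)) (zField H S y) q := by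
  filter_upwards [eventually_zeta_mem hd.isOpen hq] with p hp
  refine ⟨contDiffAt_zField hd.isOpen hH hS y hp, fun _ c => ?_⟩
  rw [fderiv_defFun (differentiableAt_entry hd.isOpen hH hp)
    (differentiableAt_entry hd.isOpen hS hp) (hd.hermitian _ hp) (hd.symmetric _ hp)]
  simp only [zField, Prod.smul_mk, smul_zero, dMat_zero, Matrix.zero_mulVec, dotProduct_zero,
    add_zero, smul_dotProduct, smul_eq_mul]
  rw [mul_left_comm, sub_self, Complex.zero_re]

theorem fderiv_defFun_zero (hd : IsDefiningData U H S)
    (hH : ∀ i j, ContDiffOn ℝ ∞ (fun ζ => H ζ i j) U)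
    (hS : ∀ i j, ContDiffOn ℝ ∞ (fun ζ => S ζ i j) U) (v : Amb s r) :
    fderiv ℝ (defFun H S) 0 v = -v.1.re := by
  have h0 : (0 : Amb s r).2.2 ∈ U := hd.zero_mem
  rw [fderiv_defFun (differentiableAt_entry hd.isOpen hH h0)
    (differentiableAt_entry hd.isOpen hS h0) (hd.hermitian _ h0) (hd.symmetric _ h0)]
  simp [zGrad]

theorem mem_holTangent_zero (hd : IsDefiningData U H S)
    (hH : ∀ i j, ContDiffOn ℝ ∞ (fun ζ => H ζ i j) U)
    (hS : ∀ i j, ContDiffOn ℝ ∞ (fun ζ => S ζ i j) U) {v : Amb s r} :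
    v ∈ holTangent (defFun H S) 0 ↔ v.1 = 0 := by
  change (∀ c : ℂ, _) ↔ _
  simp only [fderiv_defFun_zero hd hH hS]
  constructor
  · intro h
    have h1 := h 1
    have h2 := h Complex.I
    simp at h1 h2
    exact Complex.ext h1 h2
  · intro h c
    simp [h]

theorem hasCDeriv_zGrad {q : Amb s r} (hH : ∀ i j, DifferentiableAt ℝ (fun ζ => H ζ i j) q.2.2)
    (hS : ∀ i j, DifferentiableAt ℝ (fun ζ => S ζ i j) q.2.2) (V : Amb s r × Amb s r) (i : Fin s) :
    HasCDeriv (fun p : Amb s r => zGrad H S p.2.1 p.2.2 i)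
      ((((dMat H q.2.2 V.1.2.2 + Complex.I • dMat H q.2.2 V.2.2.2) *ᵥ star q.2.1 +
          H q.2.2 *ᵥ (star V.1.2.1 + Complex.I • star V.2.2.1)) +
        (conjMat (dMat S q.2.2 V.1.2.2 + Complex.I • dMat S q.2.2 (-V.2).2.2) *ᵥ q.2.1 +
          conjMat (S q.2.2) *ᵥ (V.1.2.1 + Complex.I • V.2.2.1))) i) q V :=
  (HasCDeriv.mulVec (fun i j => hasCDeriv_mat V i j (hH i j)) (hasCDeriv_star_z q V) i).add
    (HasCDeriv.mulVec (HasCDeriv.conjMat fun i j => hasCDeriv_mat (V.1, -V.2) i j (hS i j))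
      (hasCDeriv_z q V) i)

/-- Bracketing with the fields `zField` shows that the Levi form at `0` restricted to the
`z`-directions is given by the nondegenerate matrix `H 0`. -/
theorem leviKernel_zero_z (hd : IsDefiningData U H S)
    (hH : ∀ i j, ContDiffOn ℝ ∞ (fun ζ => H ζ i j) U)
    (hS : ∀ i j, ContDiffOn ℝ ∞ (fun ζ => S ζ i j) U) {M : Set (Amb s r)} {v : Amb s r}
    (hv : v ∈ leviKernel M (defFun H S) 0) : v.2.1 = 0 := by
  obtain ⟨X, hX, rfl, nX⟩ := hv
  have h0 : (0 : Amb s r).2.2 ∈ U := hd.zero_mem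
  have key : ∀ y : Fin s → ℂ, y ⬝ᵥ (H 0 *ᵥ star (X 0).2.1) = 0 := by
    intro y
    have hY := isSection_zField hd hH hS y h0 M
    have h := ((inHH_cBracket_iff hX.differentiableAt hY.differentiableAt).1 (nX _ hY)).1
    rw [mem_holTangent_zero hd hH hS] at h
    set V : Amb s r × Amb s r := (X 0, Complex.I • X 0)
    have hc : HasCDeriv (fun p : Amb s r => (zField H S y p).1) _ 0 V :=
      HasCDeriv.const_mul 2 (HasCDeriv.dotProduct (fun i => HasCDeriv.const (y i))
        (hasCDeriv_zGrad (differentiableAt_entry hd.isOpen hH h0)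
          (differentiableAt_entry hd.isOpen hS h0) V))
    have e := hc.2
    rw [← fst_fderiv hY.differentiableAt, ← fst_fderiv hY.differentiableAt] at e
    change (fderiv ℝ (zField H S y) 0 (X 0)).1 + Complex.I *
      (fderiv ℝ (zField H S y) 0 (Complex.I • X 0)).1 = 0 at h
    rw [h] at e
    -- Along `X + i J X` the variable `z̄` is differentiated twice over and `z` not at all, so only
    -- the `H 0` term of `hasCDeriv_zGrad` survives at the origin.
    have e1 : star (X 0).2.1 + Complex.I • star (Complex.I • X 0).2.1
        = (2 : ℂ) • star (X 0).2.1 := by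
      ext i
      simp only [Prod.smul_snd, Prod.smul_fst, Pi.star_apply, Pi.smul_apply, Pi.add_apply,
        smul_eq_mul, star_mul', RCLike.star_def, Complex.conj_I]
      linear_combination (-(starRingEnd ℂ ((X 0).2.1 i))) * Complex.I_mul_I
    have e2 : (X 0).2.1 + Complex.I • (Complex.I • X 0).2.1 = 0 := by
      rw [Prod.smul_snd, Prod.smul_fst, smul_smul, Complex.I_mul_I, neg_smul, one_smul,
        add_neg_cancel]
    simp only [V, Prod.snd_zero, Prod.fst_zero, star_zero, Matrix.mulVec_zero, zero_add,
      e1, e2, Matrix.mulVec_smul, add_zero] at e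
    have e3 : (fun _ : Fin s => (0 : ℂ)) = 0 := rfl
    rw [e3, zero_dotProduct, zero_add, dotProduct_smul] at e
    simpa using e.symm
  have h1 : H 0 *ᵥ star (X 0).2.1 = 0 := by
    ext i
    simpa using key (Pi.single i 1)
  have h2 : star (X 0).2.1 = 0 := Matrix.eq_zero_of_mulVec_eq_zero hd.nondegenerate.ne_zero h1
  simpa using h2

/-- The equation satisfied by the leading components of a holomorphic infinitesimal symmetry. -/
theorem symmetry_components (hd : IsDefiningData U H S)
    (hH : ∀ i j, ContDiffOn ℝ ∞ (fun ζ => H ζ i j) U)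
    (hS : ∀ i j, ContDiffOn ℝ ∞ (fun ζ => S ζ i j) U) {X : Amb s r → Amb s r}
    (hX : IsHolInfinitesimalSymmetry (hypersurface U H S) (defFun H S) 0 X) :
    ∃ a b : (Fin r → ℂ) → Fin s → ℂ, (∀ i, AnalyticAt ℂ (fun ζ => a ζ i) 0) ∧
      (∀ i, AnalyticAt ℂ (fun ζ => b ζ i) 0) ∧ a 0 = (X 0).2.1 ∧
      ∀ᶠ ζ in 𝓝 0, H ζ *ᵥ star (a ζ) + conjMat (S ζ) *ᵥ a ζ = b ζ := by
  obtain ⟨hXa, hXt⟩ := hX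
  set ι : (Fin r → ℂ) → Amb s r := fun ζ => (0, 0, ζ) with hι
  have hιc : Continuous ι := by fun_prop
  have hιa : AnalyticAt ℂ ι 0 := analyticAt_const.prod (analyticAt_const.prod analyticAt_id)
  have hX0 : AnalyticAt ℂ X (ι 0) := hXa
  have hDX : AnalyticAt ℂ (fun ζ => fderiv ℂ X (ι ζ)) 0 := hX0.fderiv.comp hιa
  -- `a` is the `z`-component of the field on the slice; `b` is half the `z`-gradient of its
  -- `w`-component there.
  refine ⟨fun ζ => (X (ι ζ)).2.1, fun ζ i =>
    (1 / 2 : ℂ) * (fderiv ℂ X (ι ζ) (0, Pi.single i 1, 0)).1, ?_, ?_, rfl, ?_⟩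
  · intro i
    have h1 : AnalyticAt ℂ (fun ζ => X (ι ζ)) 0 := hX0.comp hιa
    have h2 : AnalyticAt ℂ (fun p : Amb s r => p.2.1 i) (X (ι 0)) :=
      ((ContinuousLinearMap.proj i).comp ((ContinuousLinearMap.fst ℂ (Fin s → ℂ) (Fin r → ℂ)).comp
        (ContinuousLinearMap.snd ℂ ℂ ((Fin s → ℂ) × (Fin r → ℂ))))).analyticAt _
    exact h2.comp_of_eq h1 rfl
  · intro i
    refine analyticAt_const.mul ?_
    have h2 : AnalyticAt ℂ (fun L : Amb s r →L[ℂ] Amb s r => (L (0, Pi.single i 1, 0)).1)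
        (fderiv ℂ X (ι 0)) :=
      ((ContinuousLinearMap.fst ℂ ℂ ((Fin s → ℂ) × (Fin r → ℂ))).comp
        (ContinuousLinearMap.apply ℂ (Amb s r) ((0, Pi.single i 1, 0) : Amb s r))).analyticAt _
    exact h2.comp_of_eq hDX rfl
  have hev : ∀ᶠ q in 𝓝 (ι 0), (AnalyticAt ℂ X q ∧
      (q ∈ hypersurface U H S → fderiv ℝ (defFun H S) q (X q) = 0)) ∧ q.2.2 ∈ U :=
    (hXa.eventually_analyticAt.and hXt).and
      (eventually_zeta_mem hd.isOpen (q := (0 : Amb s r)) hd.zero_mem)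
  filter_upwards [hιc.continuousAt.eventually hev.eventually_nhds] with ζ hζ
  have hζU : ζ ∈ U := hζ.self_of_nhds.2
  set a := (X (ι ζ)).2.1 with ha
  set c := H ζ *ᵥ star a + conjMat (S ζ) *ᵥ a with hc
  have hre : ∀ z : Fin s → ℂ, (fderiv ℂ X (ι ζ) (0, z, 0)).1.re = (2 * (z ⬝ᵥ c)).re := by
    intro z
    set g := zGrad H S z ζ with hg
    set P : ℝ := (z ⬝ᵥ (H ζ *ᵥ star z)).re + (star z ⬝ᵥ (S ζ *ᵥ star z)).re with hP
    -- The `w`-coordinate `t² P` keeps the curve on the hypersurface without affecting its velocity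
    -- `(0, z, 0)` at `t = 0`.
    set γ : ℝ → Amb s r := fun t => ((t : ℂ) * (t * P), (t : ℂ) • z, ζ) with hγ
    have hγ0 : γ 0 = ι ζ := by simp [hγ, hι]
    have hγd : HasDerivAt γ (0, z, 0) 0 := by
      have h1 : HasDerivAt (fun t : ℝ => (t : ℂ)) 1 0 := Complex.ofRealCLM.hasDerivAt
      have h2 : HasDerivAt (fun t : ℝ => (t : ℂ) * (t * P)) 0 0 := by
        simpa using h1.fun_mul (h1.mul_const (P : ℂ))
      have h3 : HasDerivAt (fun t : ℝ => (t : ℂ) • z) z 0 := by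
        simpa using h1.smul_const z
      exact h2.prodMk (h3.prodMk (hasDerivAt_const _ _))
    have hXζ : HasFDerivAt X ((fderiv ℂ X (ι ζ)).restrictScalars ℝ) (γ 0) := by
      rw [hγ0]
      exact hζ.self_of_nhds.1.1.differentiableAt.hasFDerivAt.restrictScalars ℝ
    have hXγ : HasDerivAt (fun t => X (γ t)) (fderiv ℂ X (ι ζ) (0, z, 0)) 0 :=
      hXζ.comp_hasDerivAt 0 hγd
    -- The contribution of the `ζ`-derivatives of `H` and `S`. It enters the tangency condition with
    -- the factor `t²`, hence drops out of the first derivative at `t = 0`.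
    set h : ℝ → ℂ := fun t => z ⬝ᵥ (dMat H ζ (X (γ t)).2.2 *ᵥ star z) +
      star z ⬝ᵥ (dMat S ζ (X (γ t)).2.2 *ᵥ star z) with hh
    set V : ℝ × ℝ := (1, 0)
    have hζd : DifferentiableAt ℝ (fun t => (X (γ t)).2.2) 0 :=
      hXγ.differentiableAt.snd.snd
    have hmat : ∀ A : MatFun s r, ∀ i j, DifferentiableAt ℝ
        (fun t => dMat A ζ (X (γ t)).2.2 i j) 0 := fun A i j =>
      ((fderiv ℝ (fun ζ => A ζ i j) ζ).differentiableAt).comp 0 hζd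
    have hhd : DifferentiableAt ℝ h 0 := by
      refine DifferentiableAt.add ?_ ?_
      · exact (HasCDeriv.dotProduct (V := V) (fun i => HasCDeriv.const (z i)) (HasCDeriv.mulVec
          (fun i j => HasCDeriv.of_differentiableAt (hmat H i j))
            fun i => HasCDeriv.const (star z i))).1
      · exact (HasCDeriv.dotProduct (V := V) (fun i => HasCDeriv.const (star z i))
          (HasCDeriv.mulVec (fun i j => HasCDeriv.of_differentiableAt (hmat S i j))
            fun i => HasCDeriv.const (star z i))).1
    have ht : HasCDeriv (fun t : ℝ => (t : ℂ)) 1 0 V := by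
      have h1 : HasDerivAt (fun t : ℝ => (t : ℂ)) 1 0 := Complex.ofRealCLM.hasDerivAt
      refine ⟨h1.differentiableAt, ?_⟩
      simp [V, h1.deriv]
    have hw : HasCDeriv (fun t => (X (γ t)).1) (fderiv ℂ X (ι ζ) (0, z, 0)).1 0 V := by
      have h1 : HasDerivAt (fun t => (X (γ t)).1) (fderiv ℂ X (ι ζ) (0, z, 0)).1 0 :=
        (ContinuousLinearMap.fst ℝ ℂ ((Fin s → ℂ) × (Fin r → ℂ))).hasFDerivAt.comp_hasDerivAt 0 hXγ
      refine ⟨h1.differentiableAt, ?_⟩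
      simp [V, h1.deriv]
    have hzd : ∀ i, DifferentiableAt ℝ (fun t => (X (γ t)).2.1 i) 0 := fun i =>
      differentiableAt_pi.1 hXγ.differentiableAt.snd.fst i
    have hF := (((ht.mul (HasCDeriv.dotProduct (fun i => HasCDeriv.of_differentiableAt (hzd i))
      fun i => HasCDeriv.const (g i))).const_mul 2).add
        (ht.mul (ht.mul (HasCDeriv.of_differentiableAt hhd)))).sub hw
    have hF0 : (fun t : ℝ => (2 * ((t : ℂ) * ((X (γ t)).2.1 ⬝ᵥ fun i => g i)) +
        (t : ℂ) * ((t : ℂ) * h t) - (X (γ t)).1).re) =ᶠ[𝓝 0] fun _ => 0 := by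
      have hc0 : ContinuousAt γ 0 := hγd.continuousAt
      rw [ContinuousAt, hγ0] at hc0
      filter_upwards [hc0.eventually hζ] with t ht'
      have hm : γ t ∈ hypersurface U H S := by
        refine ⟨hζU, ?_⟩
        have e1 : star ((t : ℂ) • z) = (t : ℂ) • star z := by
          rw [star_smul]
          simp
        simp only [defFun, hγ, e1, Matrix.mulVec_smul, smul_dotProduct, dotProduct_smul,
          smul_eq_mul, Complex.re_ofReal_mul, hP, Complex.ofReal_re]
        ring
      have h1 := ht'.1.2 hm
      rw [fderiv_defFun (differentiableAt_entry hd.isOpen hH hζU)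
        (differentiableAt_entry hd.isOpen hS hζU) (hd.hermitian _ hζU) (hd.symmetric _ hζU)] at h1
      rw [← h1]
      have e1 : star ((t : ℂ) • z) = (t : ℂ) • star z := by
        rw [star_smul]
        simp
      simp only [hγ, hh, zGrad, e1, Matrix.mulVec_smul, ← smul_add, smul_dotProduct,
        dotProduct_smul, smul_eq_mul, hg]
      ring_nf
    have h1 := hF.fderiv_re
    have h2 : fderiv ℝ (fun t : ℝ => (2 * ((t : ℂ) * ((X (γ t)).2.1 ⬝ᵥ fun i => g i)) +
        (t : ℂ) * ((t : ℂ) * h t) - (X (γ t)).1).re) 0 = 0 := by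
      rw [hF0.fderiv_eq]
      simp
    rw [h1.1.fderiv] at h2
    have h3 := h1.2
    rw [h2] at h3
    -- The polarized real quadratic form is symmetric, so the roles of `a` and `z` can be exchanged.
    have e2 : (a ⬝ᵥ g).re = (z ⬝ᵥ c).re := by
      have e3 : a ⬝ᵥ (conjMat (S ζ) *ᵥ z) = z ⬝ᵥ (conjMat (S ζ) *ᵥ a) := by
        rw [dotProduct_mulVec_transpose, ← conjMat_transpose, (hd.symmetric _ hζU).eq]
      simp only [hg, hc, zGrad, dotProduct_add, Complex.add_re, e3,
        re_dotProduct_hermitian (hd.hermitian _ hζU) a z]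
    have e4 : ((X (γ 0)).2.1 ⬝ᵥ fun i => g i) = a ⬝ᵥ g := by rw [hγ0]
    simp only [Complex.ofReal_zero, e4, zero_mul, one_mul, add_zero, Complex.sub_re,
      zero_apply] at h3
    simp only [Complex.mul_re, Complex.re_ofNat, Complex.im_ofNat, zero_mul, sub_zero] at h3 ⊢
    linarith
  -- Both sides are complex linear in `z`, so replacing `z` by `i z` in the real identity recovers
  -- the imaginary parts.
  have hcx : ∀ z : Fin s → ℂ, (fderiv ℂ X (ι ζ) (0, z, 0)).1 = 2 * (z ⬝ᵥ c) := by
    intro z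
    refine Complex.ext (hre z) ?_
    have h := hre (Complex.I • z)
    have e : ((0, Complex.I • z, 0) : Amb s r) = Complex.I • (0, z, 0) := by simp
    rw [e, map_smul, smul_dotProduct] at h
    simpa using h
  ext i
  rw [hcx]
  simp
end Symmetries

/-! ### Holomorphic frame of symmetries and normalization of the coefficients. -/

section NormalForm

variable {s r : ℕ} {U : Set (Fin r → ℂ)} {H S : MatFun s r}

theorem IsHolInfinitesimalSymmetry.add {E : Type*} [NormedAddCommGroup E] [NormedSpace ℂ E]
    [NormedSpace ℝ E] {M : Set E} {ρ : E → ℝ} {o : E} {X Y : E → E}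
    (hX : IsHolInfinitesimalSymmetry M ρ o X) (hY : IsHolInfinitesimalSymmetry M ρ o Y) :
    IsHolInfinitesimalSymmetry M ρ o (fun q => X q + Y q) := by
  refine ⟨hX.1.add hY.1, ?_⟩
  filter_upwards [hX.2, hY.2] with q h1 h2 hq
  rw [map_add, h1 hq, h2 hq, add_zero]

theorem IsHolInfinitesimalSymmetry.const_smul {E : Type*} [NormedAddCommGroup E] [NormedSpace ℂ E]
    [NormedSpace ℝ E] [IsScalarTower ℝ ℂ E] {M : Set E} {ρ : E → ℝ} {o : E} {X : E → E} (t : ℝ)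
    (hX : IsHolInfinitesimalSymmetry M ρ o X) :
    IsHolInfinitesimalSymmetry M ρ o (fun q => t • X q) := by
  refine ⟨?_, ?_⟩
  · have h : AnalyticAt ℂ (fun q => (t : ℂ) • X q) o := analyticAt_const.smul hX.1
    refine h.congr (Eventually.of_forall fun q => ?_)
    exact algebraMap_smul ℂ t (X q)
  · filter_upwards [hX.2] with q h1 hq
    rw [map_smul, h1 hq, smul_zero]

/-- Transitivity on the leaf space provides symmetries with arbitrary `z`-component at `0`. -/
theorem exists_symmetry_z (hd : IsDefiningData U H S)
    (hH : ∀ i j, ContDiffOn ℝ ∞ (fun ζ => H ζ i j) U)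
    (hS : ∀ i j, ContDiffOn ℝ ∞ (fun ζ => S ζ i j) U) {𝔛 : Set (Amb s r → Amb s r)}
    (h𝔛 : ∀ X ∈ 𝔛, IsHolInfinitesimalSymmetry (hypersurface U H S) (defFun H S) 0 X)
    (ht : ActsLocallyTransitivelyOnLeaves (hypersurface U H S) (defFun H S) 0 𝔛)
    (a : Fin s → ℂ) :
    ∃ X, IsHolInfinitesimalSymmetry (hypersurface U H S) (defFun H S) 0 X ∧ (X 0).2.1 = a := by
  have h := ht (0, a, 0) (by rw [fderiv_defFun_zero hd hH hS]; simp)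
  obtain ⟨y, hy, κ, hκ, hyκ⟩ := Submodule.mem_sup.1 h
  -- The Levi kernel correction in the span has no `z`-component, so the symmetry part alone
  -- realizes `a`.
  have hκ0 := leviKernel_zero_z hd hH hS hκ
  have hX : ∃ X, IsHolInfinitesimalSymmetry (hypersurface U H S) (defFun H S) 0 X ∧ X 0 = y := by
    clear hyκ
    induction hy using Submodule.span_induction with
    | mem x hx =>
      obtain ⟨X, hX, rfl⟩ := hx
      exact ⟨X, h𝔛 X hX, rfl⟩
    | zero =>
      exact ⟨fun _ => 0, ⟨analyticAt_const, Eventually.of_forall fun q _ => map_zero _⟩, rfl⟩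
    | add x y _ _ h1 h2 =>
      obtain ⟨X, hX, rfl⟩ := h1
      obtain ⟨Y, hY, rfl⟩ := h2
      exact ⟨_, hX.add hY, rfl⟩
    | smul t x _ h1 =>
      obtain ⟨X, hX, rfl⟩ := h1
      exact ⟨_, hX.const_smul t, rfl⟩
  obtain ⟨X, hX, rfl⟩ := hX
  refine ⟨X, hX, ?_⟩
  have := congrArg (fun p : Amb s r => p.2.1) hyκ
  simpa [hκ0] using this

/-- The matrix form of the symmetry equations. -/
theorem exists_holomorphic_frame (hd : IsDefiningData U H S)
    (hH : ∀ i j, ContDiffOn ℝ ∞ (fun ζ => H ζ i j) U)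
    (hS : ∀ i j, ContDiffOn ℝ ∞ (fun ζ => S ζ i j) U) {𝔛 : Set (Amb s r → Amb s r)}
    (h𝔛 : ∀ X ∈ 𝔛, IsHolInfinitesimalSymmetry (hypersurface U H S) (defFun H S) 0 X)
    (ht : ActsLocallyTransitivelyOnLeaves (hypersurface U H S) (defFun H S) 0 𝔛) :
    ∃ A B C D : MatFun s r, MatAnalyticAt ℂ A 0 ∧ MatAnalyticAt ℂ B 0 ∧ MatAnalyticAt ℂ C 0 ∧
      MatAnalyticAt ℂ D 0 ∧ A 0 = 1 ∧ B 0 = 0 ∧ ∀ᶠ ζ in 𝓝 0,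
        H ζ * conjMat (A ζ) + conjMat (S ζ) * B ζ = C ζ ∧
        H ζ * conjMat (B ζ) + conjMat (S ζ) * A ζ = D ζ := by
  choose X hX hX0 using exists_symmetry_z hd hH hS h𝔛 ht
  choose a b ha hb ha0 hab using fun v => symmetry_components hd hH hS (hX v)
  set e : Fin s → Fin s → ℂ := fun k => Pi.single k 1
  -- With `c = -i` this takes the part of `v ↦ f v` that behaves complex linearly on `e k` and `i e
  -- k`, with `c = i` the antilinear part. At `0` one has `a v = v`, which gives `A 0 = 1` and `B 0
  -- = 0`.
  have hlin : ∀ (c : ℂ) (f : (Fin s → ℂ) → (Fin r → ℂ) → Fin s → ℂ),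
      (∀ v i, AnalyticAt ℂ (fun ζ => f v ζ i) 0) → MatAnalyticAt ℂ
        (fun ζ => Matrix.of fun i k => (f (e k) ζ i + c * f (Complex.I • e k) ζ i) / 2) 0 :=
    fun c f hf i k => ((hf _ _).add (analyticAt_const.mul (hf _ _))).div analyticAt_const two_ne_zero
  -- The equation contains both `a` and `ā`, so conjugating one coefficient turns it into the other:
  -- `C` (with `i`) pairs `Ā` with `B`, and `D` (with `-i`) pairs `B̄` with `A`.
  refine ⟨_, _, _, _, hlin (-Complex.I) a ha, hlin Complex.I a ha, hlin Complex.I b hb,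
    hlin (-Complex.I) b hb, ?_, ?_, ?_⟩
  · ext i k
    simp only [ha0, hX0, Matrix.of_apply, Pi.smul_apply, smul_eq_mul, Matrix.one_apply, e,
      Pi.single_apply]
    linear_combination (-(if i = k then (1 : ℂ) else 0) / 2) * Complex.I_mul_I
  · ext i k
    simp only [ha0, hX0, Matrix.of_apply, Pi.smul_apply, smul_eq_mul, Matrix.zero_apply, e,
      Pi.single_apply]
    linear_combination ((if i = k then (1 : ℂ) else 0) / 2) * Complex.I_mul_I
  · have h1 : ∀ᶠ ζ in 𝓝 (0 : Fin r → ℂ), ∀ k,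
        H ζ *ᵥ star (a (e k) ζ) + conjMat (S ζ) *ᵥ a (e k) ζ = b (e k) ζ :=
      Filter.eventually_all.2 fun k => hab _
    have h2 : ∀ᶠ ζ in 𝓝 (0 : Fin r → ℂ), ∀ k,
        H ζ *ᵥ star (a (Complex.I • e k) ζ) + conjMat (S ζ) *ᵥ a (Complex.I • e k) ζ =
          b (Complex.I • e k) ζ :=
      Filter.eventually_all.2 fun k => hab _
    filter_upwards [h1, h2] with ζ h1 h2
    constructor
    · ext i k
      have e1 := congrFun (h1 k) i
      have e2 := congrFun (h2 k) i
      simp only [Pi.add_apply, Matrix.mulVec, dotProduct, Pi.star_apply] at e1 e2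
      simp only [Matrix.add_apply, Matrix.mul_apply, Matrix.of_apply, ← e1, ← e2,
        Finset.mul_sum, ← Finset.sum_add_distrib, Finset.sum_div]
      refine Finset.sum_congr rfl fun j _ => ?_
      simp only [conjMat, Matrix.map_apply, Matrix.of_apply, map_div₀, map_add, map_mul, map_neg,
        Complex.conj_I, Complex.conj_ofNat, RCLike.star_def]
      ring
    · ext i k
      have e1 := congrFun (h1 k) i
      have e2 := congrFun (h2 k) i
      simp only [Pi.add_apply, Matrix.mulVec, dotProduct, Pi.star_apply] at e1 e2
      simp only [Matrix.add_apply, Matrix.mul_apply, Matrix.of_apply, ← e1, ← e2,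
        Finset.mul_sum, ← Finset.sum_add_distrib, Finset.sum_div]
      refine Finset.sum_congr rfl fun j _ => ?_
      simp only [conjMat, Matrix.map_apply, Matrix.of_apply, map_div₀, map_add, map_mul,
        Complex.conj_I, Complex.conj_ofNat, RCLike.star_def]
      ring

/-- Polarization of a matrix identity. -/
theorem matrix_polarization {R : ℝ} {X Y K L N W : MatFun s r}
    (hX : ∀ ζ ∈ Metric.ball 0 R, MatAnalyticAt ℂ X ζ)
    (hY : ∀ ζ ∈ Metric.ball 0 R, MatAnalyticAt ℂ Y ζ)
    (hK : ∀ ζ ∈ Metric.ball 0 R, MatAnalyticAt ℂ K ζ)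
    (hL : ∀ ζ ∈ Metric.ball 0 R, MatAnalyticAt ℂ L ζ)
    (hN : ∀ ζ ∈ Metric.ball 0 R, MatAnalyticAt ℂ N ζ)
    (hW : ∀ ζ ∈ Metric.ball 0 R, MatAnalyticAt ℂ W ζ)
    (hK0 : K 0 = 0) (hN0 : N 0 = 0)
    (h : ∀ ζ ∈ Metric.ball 0 R,
      X ζ - conjMat (Y ζ) = conjMat (K ζ) * L ζ - conjMat (N ζ) * W ζ)
    {ζ : Fin r → ℂ} (hζ : ζ ∈ Metric.ball 0 (R / 2)) : X ζ = conjMat (Y 0) := by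
  ext i j
  have d : ∀ {A : MatFun s r}, (∀ ζ ∈ Metric.ball 0 R, MatAnalyticAt ℂ A ζ) → ∀ i j,
      DifferentiableOn ℂ (fun ζ => A ζ i j) (Metric.ball 0 R) := fun hA i j ζ hζ =>
    (hA ζ hζ i j).differentiableAt.differentiableWithinAt
  -- One entry of the identity as a sum of terms `conj f * g`: the two `Unit` summands carry `X` and
  -- `Y`, the two copies of `Fin s` expand the matrix products.
  have key := sum_conj_mul_eq_zero_polarized (R := R)
    (f := fun k : (Unit ⊕ Unit) ⊕ (Fin s ⊕ Fin s) => Sum.elim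
      (Sum.elim (fun _ _ => (1 : ℂ)) (fun _ ζ => Y ζ i j))
      (Sum.elim (fun k ζ => K ζ i k) (fun k ζ => N ζ i k)) k)
    (g := fun k : (Unit ⊕ Unit) ⊕ (Fin s ⊕ Fin s) => Sum.elim
      (Sum.elim (fun _ ζ => X ζ i j) (fun _ _ => (-1 : ℂ)))
      (Sum.elim (fun k ζ => -L ζ k j) (fun k ζ => W ζ k j)) k)
    (by
      rintro ((k | k) | (k | k))
      · exact differentiableOn_const _
      · exact d hY i j
      · exact d hK i k
      · exact d hN i k)
    (by
      rintro ((k | k) | (k | k))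
      · exact d hX i j
      · exact differentiableOn_const _
      · exact (d hL k j).neg
      · exact d hW k j)
    (by
      intro ζ hζ
      have e := congrFun (congrFun (h ζ hζ) i) j
      simp only [Matrix.sub_apply, Matrix.mul_apply, conjMat, Matrix.map_apply] at e
      simp only [Fintype.sum_sum_type, Sum.elim_inl, Sum.elim_inr, Finset.univ_unique,
        Finset.sum_singleton, mul_neg, Finset.sum_neg_distrib, map_one, one_mul, mul_one]
      linear_combination e)
    hζ
  simp only [Fintype.sum_sum_type, Sum.elim_inl, Sum.elim_inr, Finset.univ_unique,
    Finset.sum_singleton, mul_neg, Finset.sum_neg_distrib, map_one, one_mul, mul_one, hK0, hN0,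
    Matrix.zero_apply, map_zero, zero_mul, Finset.sum_const_zero, neg_zero, add_zero] at key
  simp only [conjMat, Matrix.map_apply]
  linear_combination key

/-- Holomorphic coefficients that bring the defining equation into normal form. -/
structure IsNormalization (V : Set (Fin r → ℂ)) (H S A T Q : MatFun s r) : Prop where
  isOpen : IsOpen V
  zero_mem : 0 ∈ V
  analyticA : ∀ ζ ∈ V, MatAnalyticAt ℂ A ζ
  analyticT : ∀ ζ ∈ V, MatAnalyticAt ℂ T ζ
  analyticQ : ∀ ζ ∈ V, MatAnalyticAt ℂ Q ζ
  T_zero : T 0 = 0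
  isUnitA : ∀ ζ ∈ V, IsUnit (A ζ).det
  isUnitT : ∀ ζ ∈ V, IsUnit (1 - conjMat (T ζ) * T ζ).det
  symmQ : ∀ ζ ∈ V, (Q ζ).IsSymm
  symmT : ∀ ζ ∈ V, ((H 0)ᵀ * T ζ).IsSymm
  hermitian_eq : ∀ ζ ∈ V,
    (A ζ)ᵀ * H ζ * conjMat (A ζ) = H 0 * (1 - conjMat (T ζ) * T ζ)⁻¹
  symm_eq : ∀ ζ ∈ V, (A ζ)ᵀ * conjMat (S ζ) * A ζ =
    Q ζ - H 0 * (1 - conjMat (T ζ) * T ζ)⁻¹ * conjMat (T ζ)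

theorem exists_normalization (hd : IsDefiningData U H S)
    (hH : ∀ i j, ContDiffOn ℝ ∞ (fun ζ => H ζ i j) U)
    (hS : ∀ i j, ContDiffOn ℝ ∞ (fun ζ => S ζ i j) U) {𝔛 : Set (Amb s r → Amb s r)}
    (h𝔛 : ∀ X ∈ 𝔛, IsHolInfinitesimalSymmetry (hypersurface U H S) (defFun H S) 0 X)
    (ht : ActsLocallyTransitivelyOnLeaves (hypersurface U H S) (defFun H S) 0 𝔛) :
    ∃ V ⊆ U, ∃ A T Q : MatFun s r, IsNormalization V H S A T Q := by
  obtain ⟨A, B, C, D, hA, hB, hC, hD, hA0, hB0, hABCD⟩ :=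
    exists_holomorphic_frame hd hH hS h𝔛 ht
  have hdetA : IsUnit (A 0).det := by simp [hA0]
  obtain ⟨T, hTdef⟩ : ∃ F : MatFun s r, F = fun ζ => (A ζ)⁻¹ * B ζ := ⟨_, rfl⟩
  have hT : MatAnalyticAt ℂ T 0 := by
    rw [hTdef]
    exact (hA.inv hdetA).mul hB
  have hT0 : T 0 = 0 := by simp [hTdef, hB0]
  have hTT : ∀ᶠ ζ in 𝓝 (0 : Fin r → ℂ), IsUnit (1 - conjMat (T ζ) * T ζ).det := by
    refine MatAnalyticAt.eventually_isUnit_det (𝕜 := ℝ)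
      ((MatAnalyticAt.const 1 0).sub (hT.restrictScalars.conj.mul hT.restrictScalars)) ?_
    simp [hT0]
  have hev := ((hA.eventually.and hT.eventually).and (hC.eventually.and hD.eventually)).and
    (((hA.eventually_isUnit_det hdetA).and hTT).and
      (hABCD.and (hd.isOpen.mem_nhds hd.zero_mem)))
  obtain ⟨R, hR, hball⟩ := Metric.eventually_nhds_iff_ball.1 hev
  have aA : ∀ ζ ∈ Metric.ball 0 R, MatAnalyticAt ℂ A ζ := fun ζ hζ => (hball ζ hζ).1.1.1
  have aT : ∀ ζ ∈ Metric.ball 0 R, MatAnalyticAt ℂ T ζ := fun ζ hζ => (hball ζ hζ).1.1.2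
  have aC : ∀ ζ ∈ Metric.ball 0 R, MatAnalyticAt ℂ C ζ := fun ζ hζ => (hball ζ hζ).1.2.1
  have aD : ∀ ζ ∈ Metric.ball 0 R, MatAnalyticAt ℂ D ζ := fun ζ hζ => (hball ζ hζ).1.2.2
  have uA : ∀ ζ ∈ Metric.ball 0 R, IsUnit (A ζ).det := fun ζ hζ => (hball ζ hζ).2.1.1
  have uT : ∀ ζ ∈ Metric.ball 0 R, IsUnit (1 - conjMat (T ζ) * T ζ).det :=
    fun ζ hζ => (hball ζ hζ).2.1.2
  have eC : ∀ ζ ∈ Metric.ball 0 R, H ζ * conjMat (A ζ) + conjMat (S ζ) * B ζ = C ζ :=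
    fun ζ hζ => (hball ζ hζ).2.2.1.1
  have eD : ∀ ζ ∈ Metric.ball 0 R, H ζ * conjMat (B ζ) + conjMat (S ζ) * A ζ = D ζ :=
    fun ζ hζ => (hball ζ hζ).2.2.1.2
  have hU : ∀ ζ ∈ Metric.ball 0 R, ζ ∈ U := fun ζ hζ => (hball ζ hζ).2.2.2
  have eB : ∀ ζ ∈ Metric.ball 0 R, B ζ = A ζ * T ζ := fun ζ hζ => by
    simp only [hTdef, Matrix.mul_nonsing_inv_cancel_left _ _ (uA ζ hζ)]
  -- `Q` and `E` are holomorphic by construction; `e1` and `e2` express them through the merely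
  -- smooth `H'` and `S'`. This tension is what polarization exploits.
  obtain ⟨Q, hQdef⟩ : ∃ F : MatFun s r, F = fun ζ => (A ζ)ᵀ * D ζ := ⟨_, rfl⟩
  obtain ⟨E, hEdef⟩ : ∃ F : MatFun s r, F = fun ζ => (A ζ)ᵀ * C ζ - Q ζ * T ζ := ⟨_, rfl⟩
  obtain ⟨H', hH'def⟩ : ∃ F : MatFun s r, F = fun ζ => (A ζ)ᵀ * H ζ * conjMat (A ζ) := ⟨_, rfl⟩
  obtain ⟨S', hS'def⟩ : ∃ F : MatFun s r, F = fun ζ => (A ζ)ᵀ * conjMat (S ζ) * A ζ := ⟨_, rfl⟩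
  have aQ : ∀ ζ ∈ Metric.ball 0 R, MatAnalyticAt ℂ Q ζ := by
    rw [hQdef]
    exact fun ζ hζ => (aA ζ hζ).transpose.mul (aD ζ hζ)
  have aE : ∀ ζ ∈ Metric.ball 0 R, MatAnalyticAt ℂ E ζ := by
    rw [hEdef]
    exact fun ζ hζ => ((aA ζ hζ).transpose.mul (aC ζ hζ)).sub ((aQ ζ hζ).mul (aT ζ hζ))
  have e1 : ∀ ζ ∈ Metric.ball 0 R, Q ζ = H' ζ * conjMat (T ζ) + S' ζ := by
    intro ζ hζ
    simp only [hQdef, ← eD ζ hζ, eB ζ hζ, conjMat_mul, hH'def, hS'def]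
    noncomm_ring
  have e2 : ∀ ζ ∈ Metric.ball 0 R, E ζ = H' ζ * (1 - conjMat (T ζ) * T ζ) := by
    intro ζ hζ
    simp only [hEdef]
    rw [e1 ζ hζ, ← eC ζ hζ, eB ζ hζ]
    simp only [hH'def, hS'def]
    noncomm_ring
  have h0 : (0 : Fin r → ℂ) ∈ Metric.ball 0 R := Metric.mem_ball_self hR
  have hE0 : E 0 = H 0 := by
    rw [e2 0 h0, hT0, mul_zero, sub_zero, mul_one]
    simp only [hH'def, hA0, conjMat_one, Matrix.transpose_one, one_mul, mul_one]
  have hH' : ∀ ζ ∈ Metric.ball 0 R, conjMat (H' ζ) = (H' ζ)ᵀ := by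
    intro ζ hζ
    simp only [hH'def, conjMat_mul, conjMat_conjMat, Matrix.transpose_mul, Matrix.transpose_transpose,
      conjMat_of_isHermitian (hd.hermitian ζ (hU ζ hζ)), conjMat_transpose, Matrix.mul_assoc]
  have hS' : ∀ ζ ∈ Metric.ball 0 R, (S' ζ)ᵀ = S' ζ := by
    intro ζ hζ
    simp only [hS'def, Matrix.transpose_mul, Matrix.transpose_transpose, ← conjMat_transpose,
      (hd.symmetric ζ (hU ζ hζ)).eq, Matrix.mul_assoc]
  have hEconst : ∀ ζ ∈ Metric.ball 0 (R / 2), E ζ = H 0 := by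
    intro ζ hζ
    -- Since `H'` is Hermitian, `E - Ēᵀ = T̄ᵀ Tᵀ H' - H' T̄ T`. Rewriting `H'` through `E` and `Ēᵀ`
    -- only produces two copies of `T̄ᵀ Tᵀ H' T̄ T`, which cancel, so every factor becomes
    -- holomorphic or antiholomorphic.
    have := matrix_polarization (X := E) (Y := fun ζ => (E ζ)ᵀ) (K := fun ζ => (T ζ)ᵀ)
      (L := fun ζ => (T ζ)ᵀ * E ζ) (N := fun ζ => (E ζ)ᵀ * T ζ) (W := T) aE
      (fun ζ hζ => (aE ζ hζ).transpose) (fun ζ hζ => (aT ζ hζ).transpose)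
      (fun ζ hζ => (aT ζ hζ).transpose.mul (aE ζ hζ))
      (fun ζ hζ => (aE ζ hζ).transpose.mul (aT ζ hζ)) aT
      (by simp [hT0]) (by simp [hT0]) (fun ζ hζ => ?_) hζ
    · rw [this, hE0, conjMat_transpose, conjMat_of_isHermitian (hd.hermitian 0 hd.zero_mem),
        Matrix.transpose_transpose]
    · have h3 : conjMat (E ζ)ᵀ = (1 - conjMat (T ζ)ᵀ * (T ζ)ᵀ) * H' ζ := by
        rw [e2 ζ hζ, conjMat_transpose, conjMat_mul, hH' ζ hζ, conjMat_sub, conjMat_mul,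
          conjMat_conjMat, conjMat_one, Matrix.transpose_mul, Matrix.transpose_sub,
          Matrix.transpose_mul, Matrix.transpose_one, Matrix.transpose_transpose, conjMat_transpose]
      have h4 : conjMat ((E ζ)ᵀ * T ζ) = conjMat (E ζ)ᵀ * conjMat (T ζ) := conjMat_mul _ _
      simp only [h4, h3]
      rw [e2 ζ hζ]
      noncomm_ring
  have eH : ∀ ζ ∈ Metric.ball 0 (R / 2), H' ζ * (1 - conjMat (T ζ) * T ζ) = H 0 := fun ζ hζ => by
    rw [← e2 ζ (Metric.ball_subset_ball (by linarith) hζ), hEconst ζ hζ]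
  obtain ⟨Δ, hΔdef⟩ : ∃ F : MatFun s r, F = fun ζ => Q ζ - (Q ζ)ᵀ := ⟨_, rfl⟩
  -- As `S'` is symmetric, `Δ = H' T̄ - T̄ᵀ H'ᵀ`. Multiplying by `1 - T T̄` turns `H'` into the
  -- constant `H 0`, so the right side is antiholomorphic.
  have eΔ : ∀ ζ ∈ Metric.ball 0 (R / 2), Δ ζ - Δ ζ * T ζ * conjMat (T ζ) =
      H 0 * conjMat (T ζ) - conjMat (T ζ)ᵀ * (H 0)ᵀ := by
    intro ζ hζ
    have hζ' := Metric.ball_subset_ball (by linarith : R / 2 ≤ R) hζ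
    have h5 : (H 0)ᵀ = (H' ζ)ᵀ * (1 - T ζ * conjMat (T ζ)) := by
      rw [← hH' ζ hζ', ← conjMat_of_isHermitian (hd.hermitian 0 hd.zero_mem), ← eH ζ hζ,
        conjMat_mul, conjMat_sub, conjMat_mul, conjMat_conjMat, conjMat_one]
    rw [h5, ← eH ζ hζ]
    simp only [hΔdef]
    rw [e1 ζ hζ', Matrix.transpose_add, hS' ζ hζ', Matrix.transpose_mul, conjMat_transpose]
    noncomm_ring
  have hR4 : R / 2 / 2 ≤ R / 2 := by linarith
  have hR2 : R / 2 ≤ R := by linarith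
  have hΔ0 : ∀ ζ ∈ Metric.ball 0 (R / 2 / 2), Δ ζ = 0 := by
    intro ζ hζ
    have aT' := fun ζ hζ => aT ζ (Metric.ball_subset_ball hR2 hζ)
    have aQ' := fun ζ hζ => aQ ζ (Metric.ball_subset_ball hR2 hζ)
    have aΔ : ∀ ζ ∈ Metric.ball 0 (R / 2), MatAnalyticAt ℂ Δ ζ := by
      rw [hΔdef]
      exact fun ζ hζ => (aQ' ζ hζ).sub (aQ' ζ hζ).transpose
    -- The identity is transposed because `matrix_polarization` expects the conjugated factor on the
    -- left.
    have := matrix_polarization (X := fun ζ => (Δ ζ)ᵀ)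
      (Y := fun ζ => (T ζ)ᵀ * H 0 - (H 0)ᵀ * T ζ) (K := fun ζ => (T ζ)ᵀ)
      (L := fun ζ => (Δ ζ * T ζ)ᵀ) (N := fun _ => 0) (W := fun _ => 0)
      (fun ζ hζ => (aΔ ζ hζ).transpose)
      (fun ζ hζ => ((aT' ζ hζ).transpose.mul (MatAnalyticAt.const _ _)).sub
        ((MatAnalyticAt.const _ _).mul (aT' ζ hζ)))
      (fun ζ hζ => (aT' ζ hζ).transpose)
      (fun ζ hζ => ((aΔ ζ hζ).mul (aT' ζ hζ)).transpose)
      (fun ζ hζ => MatAnalyticAt.const _ _) (fun ζ hζ => MatAnalyticAt.const _ _)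
      (by simp [hT0]) rfl (fun ζ hζ => ?_) hζ
    · have h6 : (Δ ζ)ᵀ = 0 := by
        rw [this]
        simp [hT0, conjMat_zero]
      rw [← Matrix.transpose_transpose (Δ ζ), h6, Matrix.transpose_zero]
    · have h6 := congrArg Matrix.transpose (eΔ ζ hζ)
      have h7 := conjMat_of_isHermitian (hd.hermitian 0 hd.zero_mem)
      have h8 : conjMat (H 0)ᵀ = H 0 := by rw [← h7, conjMat_conjMat]
      simp only [Matrix.transpose_sub, Matrix.transpose_mul, conjMat_transpose,
        Matrix.transpose_transpose] at h6 ⊢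
      simp only [conjMat_sub, conjMat_mul, conjMat_transpose, mul_zero, sub_zero]
      rw [← conjMat_transpose (H 0), h8, h7, ← sub_eq_zero]
      rw [← sub_eq_zero] at h6
      rw [← h6]
      noncomm_ring
  -- The radius has been halved once for each of the two polarizations.
  refine ⟨Metric.ball 0 (R / 2 / 2), fun ζ hζ => hU ζ
    (Metric.ball_subset_ball (hR4.trans hR2) hζ), A, T, Q, Metric.isOpen_ball,
    Metric.mem_ball_self (by positivity),
    fun ζ hζ => aA ζ (Metric.ball_subset_ball (hR4.trans hR2) hζ),
    fun ζ hζ => aT ζ (Metric.ball_subset_ball (hR4.trans hR2) hζ),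
    fun ζ hζ => aQ ζ (Metric.ball_subset_ball (hR4.trans hR2) hζ), hT0,
    fun ζ hζ => uA ζ (Metric.ball_subset_ball (hR4.trans hR2) hζ),
    fun ζ hζ => uT ζ (Metric.ball_subset_ball (hR4.trans hR2) hζ), ?_, ?_, ?_, ?_⟩
  · intro ζ hζ
    have h9 := hΔ0 ζ hζ
    rw [hΔdef] at h9
    exact (sub_eq_zero.1 h9).symm
  · intro ζ hζ
    -- With `Δ = 0` the same identity says that `H 0 * T̄` is symmetric; conjugating gives the
    -- claim.
    have h9 := eΔ ζ (Metric.ball_subset_ball hR4 hζ)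
    rw [hΔ0 ζ hζ, zero_mul, zero_mul, sub_zero, eq_comm, sub_eq_zero] at h9
    have h7 := conjMat_of_isHermitian (hd.hermitian 0 hd.zero_mem)
    have h8 : conjMat (H 0)ᵀ = H 0 := by rw [← h7, conjMat_conjMat]
    have h10 := congrArg conjMat h9
    rw [conjMat_mul, conjMat_mul, conjMat_conjMat, conjMat_conjMat, h8, h7] at h10
    rw [Matrix.IsSymm, h10, Matrix.transpose_mul, Matrix.transpose_transpose, ← h10]
  · intro ζ hζ
    have hζ2 := Metric.ball_subset_ball hR4 hζ
    rw [← eH ζ hζ2, Matrix.mul_nonsing_inv_cancel_right _ _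
      (uT ζ (Metric.ball_subset_ball hR2 hζ2)), hH'def]
  · intro ζ hζ
    have hζ2 := Metric.ball_subset_ball hR4 hζ
    have hζ1 := Metric.ball_subset_ball hR2 hζ2
    rw [← eH ζ hζ2, Matrix.mul_nonsing_inv_cancel_right _ _ (uT ζ hζ1), e1 ζ hζ1,
      add_sub_cancel_left, hS'def]

end NormalForm

/-! ### The model and the biholomorphism onto it. -/

section Equivalence

variable {s r : ℕ} {U V : Set (Fin r → ℂ)} {H S A T Q : MatFun s r}
  {bH : Matrix (Fin s) (Fin s) ℂ} {bS : MatFun s r} {ζ : Fin r → ℂ}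

/-- The holomorphic matrix `𝐒` of the model determined by `𝐇` and `T = -𝐒 𝐇`. -/
def symmOf (bH : Matrix (Fin s) (Fin s) ℂ) (T : MatFun s r) : MatFun s r := fun ζ => -(T ζ * bH⁻¹)

theorem symmOf_mul (hu : IsUnit bH.det) : symmOf bH T ζ * bH = -T ζ := by
  rw [symmOf, neg_mul, Matrix.nonsing_inv_mul_cancel_right _ _ hu]

theorem conjMat_symmOf_mul (hh : bH.IsHermitian) (hu : IsUnit bH.det) :
    conjMat (symmOf bH T ζ) * bHᵀ = -conjMat (T ζ) := by
  rw [← conjMat_of_isHermitian hh, ← conjMat_mul, symmOf_mul hu, conjMat_neg]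

theorem conjMat_symmOf_mul_mul (hh : bH.IsHermitian) (hu : IsUnit bH.det) :
    conjMat (symmOf bH T ζ) * bHᵀ * symmOf bH T ζ * bH = conjMat (T ζ) * T ζ := by
  rw [Matrix.mul_assoc, symmOf_mul hu, conjMat_symmOf_mul hh hu, neg_mul_neg]

/-- The second inverted matrix is the first one conjugated by `bH`, so the two summands of `modelH`
coincide and the factor `1/2` disappears. -/
theorem modelH_symmOf (hh : bH.IsHermitian) (hu : IsUnit bH.det) :
    modelH bH (symmOf bH T) ζ = bH * (1 - conjMat (T ζ) * T ζ)⁻¹ := by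
  have e : 1 - bH * conjMat (symmOf bH T ζ) * bHᵀ * symmOf bH T ζ =
      bH * (1 - conjMat (T ζ) * T ζ) * bH⁻¹ := by
    rw [Matrix.mul_assoc bH, conjMat_symmOf_mul hh hu, symmOf, Matrix.mul_sub, Matrix.sub_mul,
      Matrix.mul_one, Matrix.mul_nonsing_inv _ hu]
    noncomm_ring
  simp only [modelH]
  rw [conjMat_symmOf_mul_mul hh hu, e, Matrix.mul_inv_rev, Matrix.mul_inv_rev,
    Matrix.nonsing_inv_nonsing_inv _ hu, Matrix.mul_assoc, Matrix.nonsing_inv_mul_cancel_right _ _ hu,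
    ← two_smul ℂ, smul_smul]
  norm_num

theorem conjMat_modelS_symmOf (hh : bH.IsHermitian) (hu : IsUnit bH.det) :
    conjMat (modelS bH (symmOf bH T) ζ) = -(bH * (1 - conjMat (T ζ) * T ζ)⁻¹ * conjMat (T ζ)) := by
  have h1 : conjMat bHᵀ = bH := by
    rw [← conjMat_of_isHermitian hh, conjMat_conjMat]
  simp only [modelS]
  rw [Matrix.mul_assoc _ _ bH, symmOf_mul hu, Matrix.mul_assoc (-T ζ), conjMat_symmOf_mul hh hu,
    neg_mul_neg, conjMat_mul, conjMat_mul, h1, conjMat_inv, conjMat_sub, conjMat_mul,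
    conjMat_conjMat, conjMat_one, conjMat_neg, mul_neg]

namespace IsNormalization

theorem bH_isHermitian (hd : IsDefiningData U H S) : (H 0).IsHermitian := hd.hermitian 0 hd.zero_mem

theorem analytic_modelH (h : IsNormalization V H S A T Q) (hd : IsDefiningData U H S)
    (hζ : ζ ∈ V) : MatAnalyticAt ℝ (modelH (H 0) (symmOf (H 0) T)) ζ := by
  have hT := (h.analyticT ζ hζ).restrictScalars
  have h1 := (MatAnalyticAt.const (H 0) ζ).mul
    (((MatAnalyticAt.const 1 ζ).sub (hT.conj.mul hT)).inv (h.isUnitT ζ hζ))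
  refine h1.congr (Eventually.of_forall fun ζ => ?_)
  exact (modelH_symmOf (bH_isHermitian hd) hd.nondegenerate).symm

theorem analytic_modelS (h : IsNormalization V H S A T Q) (hd : IsDefiningData U H S)
    (hζ : ζ ∈ V) : MatAnalyticAt ℝ (modelS (H 0) (symmOf (H 0) T)) ζ := by
  have hT := (h.analyticT ζ hζ).restrictScalars
  have h1 := (((MatAnalyticAt.const (H 0) ζ).mul
    (((MatAnalyticAt.const 1 ζ).sub (hT.conj.mul hT)).inv (h.isUnitT ζ hζ))).mul hT.conj).neg.conj
  refine h1.congr (Eventually.of_forall fun ζ => ?_)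
  simp only [← conjMat_modelS_symmOf (bH_isHermitian hd) hd.nondegenerate, conjMat_conjMat]

/-- Hermitian and symmetric coefficients are inherited from `H`, `S` and `Q` through the congruence
by `A`, rather than read off from the inverse matrices. -/
theorem model_data (h : IsNormalization V H S A T Q) (hd : IsDefiningData U H S) (hVU : V ⊆ U) :
    IsDefiningData V (modelH (H 0) (symmOf (H 0) T)) (modelS (H 0) (symmOf (H 0) T)) where
  isOpen := h.isOpen
  zero_mem := h.zero_mem
  hermitian ζ hζ := by
    rw [modelH_symmOf (bH_isHermitian hd) hd.nondegenerate, ← h.hermitian_eq ζ hζ]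
    have := Matrix.isHermitian_mul_mul_conjTranspose (A ζ)ᵀ (hd.hermitian ζ (hVU hζ))
    exact this
  symmetric ζ hζ := by
    have h1 := conjMat_modelS_symmOf (ζ := ζ) (T := T) (bH_isHermitian hd) hd.nondegenerate
    have h2 := h.symm_eq ζ hζ
    have h3 : conjMat (modelS (H 0) (symmOf (H 0) T) ζ) = (A ζ)ᵀ * conjMat (S ζ) * A ζ - Q ζ := by
      rw [h1, h2]
      abel
    have h4 := congrArg conjMat h3
    rw [conjMat_conjMat] at h4
    rw [h4, Matrix.IsSymm, ← conjMat_transpose, Matrix.transpose_sub, (h.symmQ ζ hζ).eq,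
      Matrix.transpose_mul, Matrix.transpose_mul, Matrix.transpose_transpose, ← conjMat_transpose,
      (hd.symmetric ζ (hVU hζ)).eq, Matrix.mul_assoc]
  nondegenerate := by
    rw [modelH_symmOf (bH_isHermitian hd) hd.nondegenerate, h.T_zero]
    simpa using hd.nondegenerate

theorem analyticAt_dotProduct {E : Type*} [NormedAddCommGroup E] [NormedSpace ℂ E] {n : ℕ}
    {f g : E → Fin n → ℂ} {q : E} (hf : ∀ i, AnalyticAt ℂ (fun p => f p i) q)
    (hg : ∀ i, AnalyticAt ℂ (fun p => g p i) q) : AnalyticAt ℂ (fun p => f p ⬝ᵥ g p) q := by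
  simp only [dotProduct]
  exact Finset.analyticAt_fun_sum _ fun i _ => (hf i).mul (hg i)

theorem analyticAt_zeta (q : Amb s r) : AnalyticAt ℂ (fun p : Amb s r => p.2.2) q :=
  ((ContinuousLinearMap.snd ℂ (Fin s → ℂ) (Fin r → ℂ)).comp
    (ContinuousLinearMap.snd ℂ ℂ ((Fin s → ℂ) × (Fin r → ℂ)))).analyticAt q

theorem analyticAt_z (q : Amb s r) (i : Fin s) : AnalyticAt ℂ (fun p : Amb s r => p.2.1 i) q :=
  ((ContinuousLinearMap.proj i).comp ((ContinuousLinearMap.fst ℂ (Fin s → ℂ) (Fin r → ℂ)).comp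
    (ContinuousLinearMap.snd ℂ ℂ ((Fin s → ℂ) × (Fin r → ℂ))))).analyticAt q

theorem analyticAt_mat {B : MatFun s r} {q : Amb s r} (hB : MatAnalyticAt ℂ B q.2.2) :
    MatAnalyticAt ℂ (fun p : Amb s r => B p.2.2) q := fun i j =>
  AnalyticAt.comp_of_eq (hB i j) (analyticAt_zeta q) rfl

theorem analyticAt_forward (h : IsNormalization V H S A T Q) {q : Amb s r} (hq : q.2.2 ∈ V) :
    AnalyticAt ℂ (fun p : Amb s r => (p.1 - ((A p.2.2)⁻¹ *ᵥ p.2.1) ⬝ᵥ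
      (Q p.2.2 *ᵥ ((A p.2.2)⁻¹ *ᵥ p.2.1)), (A p.2.2)⁻¹ *ᵥ p.2.1, p.2.2)) q := by
  have hA := analyticAt_mat ((h.analyticA _ hq).inv (h.isUnitA _ hq))
  have hQ := analyticAt_mat (h.analyticQ _ hq)
  have hz : ∀ i, AnalyticAt ℂ (fun p : Amb s r => ((A p.2.2)⁻¹ *ᵥ p.2.1) i) q := fun i =>
    analyticAt_dotProduct (hA i) (analyticAt_z q)
  refine (analyticAt_fst.sub (analyticAt_dotProduct hz fun i => analyticAt_dotProduct (hQ i) hz)).prod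
    ((AnalyticAt.pi hz).prod (analyticAt_zeta q))

theorem analyticAt_backward (h : IsNormalization V H S A T Q) {q : Amb s r} (hq : q.2.2 ∈ V) :
    AnalyticAt ℂ (fun p : Amb s r => (p.1 + p.2.1 ⬝ᵥ (Q p.2.2 *ᵥ p.2.1),
      A p.2.2 *ᵥ p.2.1, p.2.2)) q := by
  have hA := analyticAt_mat (h.analyticA _ hq)
  have hQ := analyticAt_mat (h.analyticQ _ hq)
  refine (analyticAt_fst.add (analyticAt_dotProduct (analyticAt_z q)
    fun i => analyticAt_dotProduct (hQ i) (analyticAt_z q))).prod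
    ((AnalyticAt.pi fun i => analyticAt_dotProduct (hA i) (analyticAt_z q)).prod
      (analyticAt_zeta q))

/-- The change of coordinates bringing the defining equation into normal form. -/
def chart (h : IsNormalization V H S A T Q) : OpenPartialHomeomorph (Amb s r) (Amb s r) where
  toFun p := (p.1 - ((A p.2.2)⁻¹ *ᵥ p.2.1) ⬝ᵥ
      (Q p.2.2 *ᵥ ((A p.2.2)⁻¹ *ᵥ p.2.1)), (A p.2.2)⁻¹ *ᵥ p.2.1, p.2.2)
  invFun p := (p.1 + p.2.1 ⬝ᵥ (Q p.2.2 *ᵥ p.2.1), A p.2.2 *ᵥ p.2.1, p.2.2)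
  source := {p | p.2.2 ∈ V}
  target := {p | p.2.2 ∈ V}
  map_source' _ hp := hp
  map_target' _ hp := hp
  left_inv' p hp := by
    have e : A p.2.2 *ᵥ ((A p.2.2)⁻¹ *ᵥ p.2.1) = p.2.1 := by
      rw [Matrix.mulVec_mulVec, Matrix.mul_nonsing_inv _ (h.isUnitA _ hp), Matrix.one_mulVec]
    simp only [sub_add_cancel, e]
  right_inv' p hp := by
    have e : (A p.2.2)⁻¹ *ᵥ (A p.2.2 *ᵥ p.2.1) = p.2.1 := by
      rw [Matrix.mulVec_mulVec, Matrix.nonsing_inv_mul _ (h.isUnitA _ hp), Matrix.one_mulVec]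
    simp only [e, add_sub_cancel_right]
  open_source := h.isOpen.preimage continuous_snd.snd
  open_target := h.isOpen.preimage continuous_snd.snd
  continuousOn_toFun p hp := (h.analyticAt_forward hp).continuousAt.continuousWithinAt
  continuousOn_invFun p hp := (h.analyticAt_backward hp).continuousAt.continuousWithinAt

theorem chart_zero (h : IsNormalization V H S A T Q) : h.chart 0 = 0 := by
  simp [chart]

/-- The substitution for `z` acts on `H` and `S̄` by `Aᵀ · Ā` and `Aᵀ · A`; the leftover `Re (zᵀ Q
z)` is the real part of a holomorphic function and is absorbed into `w`. -/
theorem defFun_chart (h : IsNormalization V H S A T Q) (hd : IsDefiningData U H S)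
    {p : Amb s r} (hp : p.2.2 ∈ V) : defFun H S p =
      defFun (modelH (H 0) (symmOf (H 0) T)) (modelS (H 0) (symmOf (H 0) T)) (h.chart p) := by
  set ζ := p.2.2 with hζ
  set z := (A ζ)⁻¹ *ᵥ p.2.1 with hz
  have hc : h.chart p = (p.1 - z ⬝ᵥ (Q ζ *ᵥ z), z, ζ) := rfl
  have e : p.2.1 = A ζ *ᵥ z := by
    rw [hz, Matrix.mulVec_mulVec, Matrix.mul_nonsing_inv _ (h.isUnitA _ hp), Matrix.one_mulVec]
  have pull : ∀ (B : Matrix (Fin s) (Fin s) ℂ) (v : Fin s → ℂ),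
      (A ζ *ᵥ z) ⬝ᵥ (B *ᵥ v) = z ⬝ᵥ (((A ζ)ᵀ * B) *ᵥ v) := by
    intro B v
    rw [← Matrix.mulVec_mulVec, ← Matrix.vecMul_transpose, ← Matrix.dotProduct_mulVec]
  simp only [hc, defFun, ← hζ]
  rw [re_dotProduct_conjMat, re_dotProduct_conjMat, e, star_mulVec_eq, pull, pull,
    Matrix.mulVec_mulVec, Matrix.mulVec_mulVec, h.hermitian_eq ζ hp, h.symm_eq ζ hp,
    conjMat_modelS_symmOf (bH_isHermitian hd) hd.nondegenerate,
    modelH_symmOf (bH_isHermitian hd) hd.nondegenerate, Matrix.sub_mulVec, Matrix.neg_mulVec,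
    dotProduct_sub, dotProduct_neg, Complex.sub_re, Complex.sub_re, Complex.neg_re]
  ring

theorem crEquiv (h : IsNormalization V H S A T Q) (hd : IsDefiningData U H S) (hVU : V ⊆ U)
    (hH : ∀ i j, ContDiffOn ℝ ∞ (fun ζ => H ζ i j) U)
    (hS : ∀ i j, ContDiffOn ℝ ∞ (fun ζ => S ζ i j) U) :
    CREquiv h.chart (hypersurface U H S)
      (hypersurface V (modelH (H 0) (symmOf (H 0) T)) (modelS (H 0) (symmOf (H 0) T)))
      (defFun H S)
      (defFun (modelH (H 0) (symmOf (H 0) T)) (modelS (H 0) (symmOf (H 0) T))) where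
  holo p hp := (h.analyticAt_forward hp).differentiableAt.differentiableWithinAt
  holo_symm p hp := (h.analyticAt_backward hp).differentiableAt.differentiableWithinAt
  smooth p hp := (h.analyticAt_forward hp).restrictScalars.contDiffAt.contDiffWithinAt
  smooth_symm p hp := (h.analyticAt_backward hp).restrictScalars.contDiffAt.contDiffWithinAt
  mem_iff p hp := by
    have e : (h.chart p).2.2 = p.2.2 := rfl
    have hp' : p.2.2 ∈ V := hp
    simp only [hypersurface, Set.mem_ofPred_eq, e, h.defFun_chart hd hp', hp', hVU hp']
  apply_eq p hp := h.defFun_chart hd hp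
  diff p hp := differentiableAt_defFun (differentiableAt_entry hd.isOpen hH (hVU hp))
    (differentiableAt_entry hd.isOpen hS (hVU hp))
  diff' p hp := differentiableAt_defFun (fun i j => (h.analytic_modelH hd hp i j).differentiableAt)
    (fun i j => (h.analytic_modelS hd hp i j).differentiableAt)

end IsNormalization

end Equivalence

/-! ### Leaf coordinate and complex tangent space of the model. -/

section ModelForm

variable {s r : ℕ} {V : Set (Fin r → ℂ)} {bH : Matrix (Fin s) (Fin s) ℂ} {T H S : MatFun s r}

/-- A defining equation in normal form, with coefficients expressed through a constant Hermitian
matrix and a holomorphic matrix. -/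
structure IsModelForm (V : Set (Fin r → ℂ)) (bH : Matrix (Fin s) (Fin s) ℂ)
    (T H S : MatFun s r) : Prop where
  isOpen : IsOpen V
  zero_mem : 0 ∈ V
  hermitian : bH.IsHermitian
  analytic : ∀ ζ ∈ V, MatAnalyticAt ℂ T ζ
  T_zero : T 0 = 0
  isUnit : ∀ ζ ∈ V, IsUnit (1 - conjMat (T ζ) * T ζ).det
  symm : ∀ ζ ∈ V, (bHᵀ * T ζ).IsSymm
  eqH : ∀ ζ ∈ V, H ζ = bH * (1 - conjMat (T ζ) * T ζ)⁻¹
  eqS : ∀ ζ ∈ V, conjMat (S ζ) = -(bH * (1 - conjMat (T ζ) * T ζ)⁻¹ * conjMat (T ζ))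

/-- The holomorphic differential of a matrix valued function. -/
def dHol (T : MatFun s r) (ζ γ : Fin r → ℂ) : Matrix (Fin s) (Fin s) ℂ :=
  Matrix.of fun i j => fderiv ℂ (fun ζ => T ζ i j) ζ γ

/-- The conjugate leaf coordinate: the leaf of the Levi kernel through `(w, z, ζ)` is given by
`z = k̄ + T k` with `k` constant. -/
def leafCoord (T : MatFun s r) (q : Amb s r) : Fin s → ℂ :=
  (1 - conjMat (T q.2.2) * T q.2.2)⁻¹ *ᵥ (star q.2.1 - conjMat (T q.2.2) *ᵥ q.2.1)

/-- The complex linear form on the ambient space cutting out the complex tangent space. -/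
def cotangent (bH : Matrix (Fin s) (Fin s) ℂ) (T : MatFun s r) (q v : Amb s r) : ℂ :=
  2 * (v.2.1 ⬝ᵥ (bH *ᵥ leafCoord T q)) -
    leafCoord T q ⬝ᵥ (bHᵀ *ᵥ (dHol T q.2.2 v.2.2 *ᵥ leafCoord T q)) - v.1

/-- A `(1,0)` field along the leaves of the Levi kernel. -/
def leafField (bH : Matrix (Fin s) (Fin s) ℂ) (T : MatFun s r) (γ : Fin r → ℂ) (q : Amb s r) :
    Amb s r :=
  (leafCoord T q ⬝ᵥ (bHᵀ *ᵥ (dHol T q.2.2 γ *ᵥ leafCoord T q)),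
    dHol T q.2.2 γ *ᵥ leafCoord T q, γ)

theorem dHol_smul (ζ γ : Fin r → ℂ) (c : ℂ) : dHol T ζ (c • γ) = c • dHol T ζ γ := by
  ext
  simp [dHol]

theorem dHol_zero (ζ : Fin r → ℂ) : dHol T ζ 0 = 0 := by
  ext
  simp [dHol]

theorem cotangent_smul (q v : Amb s r) (c : ℂ) :
    cotangent bH T q (c • v) = c * cotangent bH T q v := by
  simp only [cotangent, Prod.smul_fst, Prod.smul_snd, dHol_smul, Matrix.smul_mulVec,
    Matrix.mulVec_smul, smul_dotProduct, dotProduct_smul, smul_eq_mul]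
  ring

theorem hasCDeriv_holo_mat {q : Amb s r} (hT : MatAnalyticAt ℂ T q.2.2) (W : Amb s r × Amb s r)
    (i j : Fin s) : HasCDeriv (fun p : Amb s r => T p.2.2 i j)
      (dHol T q.2.2 (W.1.2.2 + Complex.I • W.2.2.2) i j) q W := by
  refine (hasCDeriv_mat W i j ((hT i j).differentiableAt.restrictScalars ℝ)).congr_deriv ?_
  simp only [dMat, dHol, Matrix.add_apply, Matrix.smul_apply, Matrix.of_apply,
    (hT i j).differentiableAt.fderiv_restrictScalars ℝ, map_add, map_smul,
    ContinuousLinearMap.coe_restrictScalars']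

/-- Vanishing on the hypersurface implies vanishing of tangential derivatives. -/
theorem fderiv_eq_zero_of_tangent (hV : IsOpen V) {q v : Amb s r} {g : Amb s r → ℂ}
    (hq : q ∈ hypersurface V H S) (hρ : DifferentiableAt ℝ (defFun H S) q)
    (hg : DifferentiableAt ℝ g q) (h0 : ∀ᶠ p in 𝓝 q, p ∈ hypersurface V H S → g p = 0)
    (hv : fderiv ℝ (defFun H S) q v = 0) : fderiv ℝ g q v = 0 := by
  -- `π` slides points along `Re w` onto the hypersurface, since `defFun` contains `-Re w`. Thus `g
  -- ∘ π` vanishes near `q`, while the differential of `π` at `q` fixes `v` because `dρ(v) = 0`.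
  set π : Amb s r → Amb s r := fun p => (p.1 + (defFun H S p : ℂ), p.2) with hπ
  have hπq : π q = q := by simp [hπ, hq.2]
  have hρ' : HasFDerivAt (fun p => (defFun H S p : ℂ))
      (Complex.ofRealCLM.comp (fderiv ℝ (defFun H S) q)) q :=
    Complex.ofRealCLM.hasFDerivAt.comp q hρ.hasFDerivAt
  have hπd := ((ContinuousLinearMap.fst ℝ ℂ ((Fin s → ℂ) × (Fin r → ℂ))).hasFDerivAt.add hρ').prodMk
    ((ContinuousLinearMap.snd ℝ ℂ ((Fin s → ℂ) × (Fin r → ℂ))).hasFDerivAt (x := q))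
  have hgπ : HasFDerivAt g (fderiv ℝ g q) (π q) := by
    rw [hπq]
    exact hg.hasFDerivAt
  have hcomp := hgπ.comp q hπd
  have hπc : Tendsto π (𝓝 q) (𝓝 q) := by
    have := hπd.continuousAt
    rw [ContinuousAt] at this
    change Tendsto π _ (𝓝 (π q)) at this
    rwa [hπq] at this
  have hz : (g ∘ π) =ᶠ[𝓝 q] fun _ => 0 := by
    filter_upwards [hπc.eventually h0, eventually_zeta_mem hV hq.1] with p hp hpV
    refine hp ⟨hpV, ?_⟩
    simp only [defFun, hπ, Complex.add_re, Complex.ofReal_re]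
    ring
  have e : fderiv ℝ (g ∘ π) q v = 0 := by
    rw [hz.fderiv_eq]
    simp
  have e2 : fderiv ℝ (g ∘ π) q = _ := hcomp.fderiv
  rw [e2] at e
  simpa [hv] using e

namespace IsModelForm

variable (h : IsModelForm V bH T H S) {q : Amb s r}
include h

/-- The defect `d = z - k̄ - T k` satisfies `d̄ = T̄ d`, hence `(1 - T̄ T) d̄ = 0`, and this matrix
is invertible. -/
theorem z_eq (hq : q.2.2 ∈ V) :
    q.2.1 = star (leafCoord T q) + T q.2.2 *ᵥ leafCoord T q := by
  set k := leafCoord T q with hk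
  set t := T q.2.2 with ht
  have h1 : k - conjMat t *ᵥ (t *ᵥ k) = star q.2.1 - conjMat t *ᵥ q.2.1 := by
    have : (1 - conjMat t * t) *ᵥ k = star q.2.1 - conjMat t *ᵥ q.2.1 := by
      rw [hk, leafCoord, Matrix.mulVec_mulVec, Matrix.mul_nonsing_inv _ (h.isUnit _ hq),
        Matrix.one_mulVec]
    rwa [Matrix.sub_mulVec, Matrix.one_mulVec, ← Matrix.mulVec_mulVec] at this
  set d := q.2.1 - star k - t *ᵥ k with hd
  have h2 : star d = conjMat t *ᵥ (d + star k) - conjMat t *ᵥ star k := by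
    have e : d + star k = q.2.1 - t *ᵥ k := by rw [hd]; abel
    have e' : star d = star q.2.1 - k - conjMat t *ᵥ star k := by
      rw [hd, star_sub, star_sub, star_star, star_mulVec_eq]
    rw [e, e', Matrix.mulVec_sub]
    have : star q.2.1 - k = conjMat t *ᵥ q.2.1 - conjMat t *ᵥ (t *ᵥ k) := by
      rw [sub_eq_sub_iff_add_eq_add] at h1 ⊢
      rw [add_comm k] at h1
      exact h1.symm
    rw [this]
  have h3 : star d = conjMat t *ᵥ d := by
    rw [h2, Matrix.mulVec_add, add_sub_cancel_right]
  have h4 : (1 - conjMat t * t) *ᵥ star d = 0 := by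
    have e : d = t *ᵥ star d := by
      have := congrArg star h3
      rwa [star_star, star_mulVec_eq, conjMat_conjMat] at this
    rw [Matrix.sub_mulVec, Matrix.one_mulVec, ← Matrix.mulVec_mulVec, ← e, ← h3, sub_self]
  have h5 : star d = 0 := Matrix.eq_zero_of_mulVec_eq_zero (h.isUnit _ hq).ne_zero h4
  have h6 : d = 0 := by simpa using h5
  rw [hd, sub_sub, sub_eq_zero] at h6
  exact h6

theorem contDiffAt_leafCoord (hq : q.2.2 ∈ V) (i : Fin s) :
    ContDiffAt ℝ ∞ (fun p => leafCoord T p i) q := by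
  have hT := (h.analytic _ hq).restrictScalars
  have hN := ((MatAnalyticAt.const 1 _).sub (hT.conj.mul hT)).inv (h.isUnit _ hq)
  have hc : ∀ {B : MatFun s r}, MatAnalyticAt ℝ B q.2.2 → ∀ i j,
      ContDiffAt ℝ ∞ (fun p : Amb s r => B p.2.2 i j) q := fun {B} hB i j =>
    ContDiffAt.comp (g := fun ζ => B ζ i j) q (hB i j).contDiffAt (contDiffAt_zeta q)
  have hz : ∀ i, ContDiffAt ℝ ∞ (fun p : Amb s r => p.2.1 i) q := fun i =>
    contDiffAt_pi.1 (contDiffAt_z q) i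
  exact contDiffAt_dotProduct (hc hN i) fun j => (contDiffAt_conj (hz j)).sub
    (contDiffAt_dotProduct (hc hT.conj j) hz)

theorem hasCDeriv_leafCoord (hq : q.2.2 ∈ V) (W : Amb s r × Amb s r) :
    ∃ k' : Fin s → ℂ, ∀ i, HasCDeriv (fun p => leafCoord T p i) (k' i) q W :=
  ⟨_, fun i => HasCDeriv.of_differentiableAt
    ((h.contDiffAt_leafCoord hq i).differentiableAt (by simp))⟩

/-- Derivative of `z = k̄ + T k`. The term `k̄` needs the derivative of `k` along the conjugate
direction, whence the second family `b`. -/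
theorem deriv_z_eq (hq : q.2.2 ∈ V) {W : Amb s r × Amb s r} {a b : Fin s → ℂ}
    (ha : ∀ i, HasCDeriv (fun p => leafCoord T p i) (a i) q W)
    (hb : ∀ i, HasCDeriv (fun p => leafCoord T p i) (b i) q (W.1, -W.2)) :
    W.1.2.1 + Complex.I • W.2.2.1 = star b +
      (dHol T q.2.2 (W.1.2.2 + Complex.I • W.2.2.2) *ᵥ leafCoord T q + T q.2.2 *ᵥ a) := by
  ext i
  have h1 := hasCDeriv_z q W i
  have h2 : ∀ i, HasCDeriv (fun p => star (leafCoord T p) i) (star b i) q W := fun i => by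
    have := (hb i).conj
    simp only [neg_neg] at this
    exact this
  have h3 := (h2 i).add (HasCDeriv.mulVec (hasCDeriv_holo_mat (h.analytic _ hq) W) ha i)
  refine h1.unique (h3.congr_of_eventuallyEq ?_)
  filter_upwards [eventually_zeta_mem h.isOpen hq] with p hp
  exact congrFun (h.z_eq hp) i

theorem symm_dHol {ζ : Fin r → ℂ} (hζ : ζ ∈ V) (γ : Fin r → ℂ) :
    (bHᵀ * dHol T ζ γ).IsSymm := by
  have key : ∀ i j, (bHᵀ * dHol T ζ γ) i j = fderiv ℂ (fun ζ => (bHᵀ * T ζ) i j) ζ γ := by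
    intro i j
    have h1 : HasFDerivAt (fun ζ => ∑ k, bHᵀ i k * T ζ k j)
        (∑ k, bHᵀ i k • fderiv ℂ (fun ζ => T ζ k j) ζ) ζ :=
      HasFDerivAt.fun_sum fun k _ =>
        ((h.analytic ζ hζ k j).differentiableAt.hasFDerivAt.const_mul (bHᵀ i k))
    simp only [Matrix.mul_apply, h1.fderiv, dHol, Matrix.of_apply]
    simp
  ext i j
  rw [Matrix.transpose_apply, key, key]
  have e : (fun ζ => (bHᵀ * T ζ) j i) =ᶠ[𝓝 ζ] fun ζ => (bHᵀ * T ζ) i j := by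
    filter_upwards [h.isOpen.mem_nhds hζ] with x hx using (h.symm x hx).apply i j
  rw [e.fderiv_eq]

omit h in
theorem dot_symm {B : Matrix (Fin s) (Fin s) ℂ} (hB : (bHᵀ * B).IsSymm) (x y : Fin s → ℂ) :
    x ⬝ᵥ (bHᵀ *ᵥ (B *ᵥ y)) = y ⬝ᵥ (bHᵀ *ᵥ (B *ᵥ x)) := by
  rw [Matrix.mulVec_mulVec, dotProduct_mulVec_transpose, hB.eq, ← Matrix.mulVec_mulVec]

/-- Both coefficients contain `bH (1 - T̄ T)⁻¹`, so the Hermitian and quadratic terms merge into one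
pairing of `z` with `bH k`. -/
theorem defFun_eq (hq : q.2.2 ∈ V) :
    defFun H S q = (q.2.1 ⬝ᵥ (bH *ᵥ leafCoord T q) - q.1).re := by
  simp only [defFun, leafCoord]
  rw [re_dotProduct_conjMat, h.eqH _ hq, h.eqS _ hq, Matrix.mulVec_mulVec, Matrix.mulVec_sub,
    Matrix.neg_mulVec, dotProduct_neg, dotProduct_sub, Complex.sub_re, Complex.neg_re,
    Complex.sub_re, Matrix.mulVec_mulVec]
  ring

/-- The unknown derivative `k'` is eliminated: by `z = k̄ + T k`, the Hermitian property of `bH` and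
the symmetry of `bHᵀ T`, the real part of `z ⬝ᵥ bH k'` is expressed by `v` alone. -/
theorem fderiv_defFun_eq (hq : q.2.2 ∈ V) : DifferentiableAt ℝ (defFun H S) q ∧
    ∀ v : Amb s r, fderiv ℝ (defFun H S) q v = (cotangent bH T q v).re := by
  have main : ∀ v : Amb s r, DifferentiableAt ℝ (defFun H S) q ∧
      fderiv ℝ (defFun H S) q v = (cotangent bH T q v).re := by
    intro v
    obtain ⟨k', hk'⟩ := h.hasCDeriv_leafCoord hq (v, 0)
    have hz := h.deriv_z_eq hq hk' (by simpa using hk')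
    simp only [Prod.snd_zero, Prod.fst_zero, smul_zero, add_zero] at hz
    have hc := (HasCDeriv.dotProduct (hasCDeriv_z q (v, 0))
      (HasCDeriv.mulVec (A := fun _ => bH) (A' := 0) (fun i j => HasCDeriv.const (bH i j)) hk')).sub
      (hasCDeriv_w q (v, 0))
    have e : defFun H S =ᶠ[𝓝 q] fun p => (p.2.1 ⬝ᵥ (bH *ᵥ leafCoord T p) - p.1).re := by
      filter_upwards [eventually_zeta_mem h.isOpen hq] with p hp using h.defFun_eq hp
    refine ⟨hc.fderiv_re.1.differentiableAt.congr_of_eventuallyEq e, ?_⟩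
    rw [e.fderiv_eq]
    rw [hc.fderiv_re.1.fderiv, hc.fderiv_re.2]
    set k := leafCoord T q with hk
    have e2 : (fun i => v.2.1 i + Complex.I * (0 : Amb s r).2.1 i) = v.2.1 := by
      ext i
      simp
    have e3 : v.2.1 ⬝ᵥ (bH *ᵥ k) = star k' ⬝ᵥ (bH *ᵥ k) +
        (k ⬝ᵥ (bHᵀ *ᵥ (dHol T q.2.2 v.2.2 *ᵥ k)) + k' ⬝ᵥ (bHᵀ *ᵥ (T q.2.2 *ᵥ k))) := by
      rw [hz, add_dotProduct, add_dotProduct, dotProduct_mulVec_transpose bH (_ *ᵥ k),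
        dotProduct_mulVec_transpose bH (_ *ᵥ k'), dot_symm (h.symm _ hq) k' k]
    have e4 : q.2.1 ⬝ᵥ (bH *ᵥ k') = star k ⬝ᵥ (bH *ᵥ k') + k' ⬝ᵥ (bHᵀ *ᵥ (T q.2.2 *ᵥ k)) := by
      conv_lhs => rw [h.z_eq hq]
      rw [add_dotProduct, dotProduct_mulVec_transpose bH (_ *ᵥ _)]
    have e5 : (star k ⬝ᵥ (bH *ᵥ k')).re = (star k' ⬝ᵥ (bH *ᵥ k)).re := by
      simpa using re_dotProduct_hermitian h.hermitian (star k) (star k')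
    have e6 : v.1 + Complex.I * (0 : Amb s r).1 = v.1 := by simp
    simp only [e2, e6, Matrix.zero_mulVec, zero_add, cotangent, ← hk]
    rw [e4, e3]
    simp only [Complex.add_re, Complex.sub_re, Complex.mul_re, Complex.re_ofNat, Complex.im_ofNat,
      zero_mul, sub_zero, e5]
    ring
  exact ⟨(main 0).1, fun v => (main v).2⟩

theorem mem_holTangent_iff (hq : q.2.2 ∈ V) {v : Amb s r} :
    v ∈ holTangent (defFun H S) q ↔ cotangent bH T q v = 0 := by
  change (∀ c : ℂ, _) ↔ _
  simp only [(h.fderiv_defFun_eq hq).2, cotangent_smul]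
  constructor
  · intro hc
    have h1 := hc 1
    have h2 := hc (-Complex.I)
    simp only [one_mul] at h1
    have h3 : (-Complex.I * cotangent bH T q v).re = (cotangent bH T q v).im := by simp
    rw [h3] at h2
    exact Complex.ext h1 h2
  · intro hc c
    rw [hc, mul_zero, Complex.zero_re]

theorem leafField_mem (hq : q.2.2 ∈ V) (γ : Fin r → ℂ) :
    leafField bH T γ q ∈ holTangent (defFun H S) q := by
  rw [h.mem_holTangent_iff hq]
  simp only [cotangent, leafField]
  rw [dotProduct_mulVec_transpose bH]
  ring

/-- The `z`-component of the leaf field is exactly the variation of `T k` with `k` frozen, so the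
derivatives of `k` solve a homogeneous system with invertible matrix `1 - T̄ T`. -/
theorem deriv_leafCoord_leafField (hq : q.2.2 ∈ V) (γ : Fin r → ℂ) (i : Fin s) :
    HasCDeriv (fun p => leafCoord T p i) 0 q
      (leafField bH T γ q, Complex.I • leafField bH T γ q) := by
  set x := leafField bH T γ q with hx
  obtain ⟨a, ha⟩ := h.hasCDeriv_leafCoord hq (x, Complex.I • x)
  obtain ⟨b, hb⟩ := h.hasCDeriv_leafCoord hq (x, -(Complex.I • x))
  have e1 := h.deriv_z_eq hq ha hb
  have e2 := h.deriv_z_eq hq hb (by simpa using ha)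
  simp only [Prod.smul_fst, Prod.smul_snd, Prod.fst_neg, Prod.snd_neg, I_smul_I_smul, smul_neg,
    add_neg_cancel, dHol_zero, Matrix.zero_mulVec, zero_add, neg_neg] at e1 e2
  rw [← two_smul ℂ, ← two_smul ℂ x.2.2, dHol_smul] at e2
  have e3 : star a + T q.2.2 *ᵥ b = 0 := by
    have e4 : x.2.1 = dHol T q.2.2 x.2.2 *ᵥ leafCoord T q := rfl
    rw [Matrix.smul_mulVec, ← e4, add_left_comm] at e2
    exact left_eq_add.1 e2
  have e5 : a = -(conjMat (T q.2.2) *ᵥ star b) := by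
    have := congrArg star (eq_neg_of_add_eq_zero_left e3)
    rwa [star_star, star_neg, star_mulVec_eq] at this
  have e6 : (1 - conjMat (T q.2.2) * T q.2.2) *ᵥ a = 0 := by
    rw [Matrix.sub_mulVec, Matrix.one_mulVec, ← Matrix.mulVec_mulVec,
      eq_neg_of_add_eq_zero_right e1.symm, Matrix.mulVec_neg, sub_neg_eq_add]
    nth_rw 1 [e5]
    exact neg_add_cancel _
  have e7 : a = 0 := Matrix.eq_zero_of_mulVec_eq_zero (h.isUnit _ hq).ne_zero e6
  have := ha i
  rwa [e7] at this

end IsModelForm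

end ModelForm

/-! ### Sections along the leaves and the second Levi form at the origin. -/

section LeafSections

variable {s r : ℕ} {V : Set (Fin r → ℂ)} {bH : Matrix (Fin s) (Fin s) ℂ} {T H S : MatFun s r}

theorem HasCDeriv.clm_comp {E F : Type*} [NormedAddCommGroup E] [NormedSpace ℝ E]
    [NormedAddCommGroup F] [NormedSpace ℝ F] [NormedSpace ℂ F] [IsScalarTower ℝ ℂ F]
    (L : F →L[ℂ] ℂ) {Y : E → F} {q : E} (hY : DifferentiableAt ℝ Y q) (W : E × E) :
    HasCDeriv (fun p => L (Y p))
      (L (fderiv ℝ Y q W.1 + Complex.I • fderiv ℝ Y q W.2)) q W := by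
  have h := (L.restrictScalars ℝ).hasFDerivAt.comp q hY.hasFDerivAt
  refine ⟨h.differentiableAt, ?_⟩
  have e : fderiv ℝ (fun p => L (Y p)) q = _ := h.fderiv
  rw [e]
  simp

theorem hasCDeriv_fst {Y : Amb s r → Amb s r} {q : Amb s r} (hY : DifferentiableAt ℝ Y q)
    (W : Amb s r × Amb s r) : HasCDeriv (fun p => (Y p).1)
      (fderiv ℝ Y q W.1 + Complex.I • fderiv ℝ Y q W.2).1 q W :=
  HasCDeriv.clm_comp (ContinuousLinearMap.fst ℂ ℂ ((Fin s → ℂ) × (Fin r → ℂ))) hY W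

theorem hasCDeriv_snd_fst {Y : Amb s r → Amb s r} {q : Amb s r} (hY : DifferentiableAt ℝ Y q)
    (W : Amb s r × Amb s r) (i : Fin s) : HasCDeriv (fun p => (Y p).2.1 i)
      ((fderiv ℝ Y q W.1 + Complex.I • fderiv ℝ Y q W.2).2.1 i) q W :=
  HasCDeriv.clm_comp ((ContinuousLinearMap.proj i).comp
    ((ContinuousLinearMap.fst ℂ (Fin s → ℂ) (Fin r → ℂ)).comp
      (ContinuousLinearMap.snd ℂ ℂ ((Fin s → ℂ) × (Fin r → ℂ))))) hY W

theorem hasCDeriv_snd_snd {Y : Amb s r → Amb s r} {q : Amb s r} (hY : DifferentiableAt ℝ Y q)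
    (W : Amb s r × Amb s r) (b : Fin r) : HasCDeriv (fun p => (Y p).2.2 b)
      ((fderiv ℝ Y q W.1 + Complex.I • fderiv ℝ Y q W.2).2.2 b) q W :=
  HasCDeriv.clm_comp ((ContinuousLinearMap.proj b).comp
    ((ContinuousLinearMap.snd ℂ (Fin s → ℂ) (Fin r → ℂ)).comp
      (ContinuousLinearMap.snd ℂ ℂ ((Fin s → ℂ) × (Fin r → ℂ))))) hY W

theorem dHol_eq_sum (ζ v : Fin r → ℂ) (i j : Fin s) :
    dHol T ζ v i j = ∑ b, v b * dHol T ζ (Pi.single b 1) i j := by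
  simp only [dHol, Matrix.of_apply]
  conv_lhs => rw [pi_eq_sum_univ' v, map_sum]
  refine Finset.sum_congr rfl fun b _ => ?_
  rw [map_smul, smul_eq_mul]

theorem analytic_dHol {ζ : Fin r → ℂ} (hT : MatAnalyticAt ℂ T ζ) (γ : Fin r → ℂ) :
    MatAnalyticAt ℂ (fun ζ => dHol T ζ γ) ζ := fun i j =>
  ((ContinuousLinearMap.apply ℂ ℂ γ).analyticAt _).comp_of_eq (hT i j).fderiv rfl

theorem hasCDeriv_dHol_const {q : Amb s r} (hT : MatAnalyticAt ℂ T q.2.2) (γ : Fin r → ℂ)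
    (x : Amb s r) (i j : Fin s) :
    HasCDeriv (fun p : Amb s r => dHol T p.2.2 γ i j) 0 q (x, Complex.I • x) := by
  refine (hasCDeriv_holo_mat (analytic_dHol hT γ) (x, Complex.I • x) i j).congr_deriv ?_
  simp only [Prod.smul_snd, I_smul_I_smul, add_neg_cancel, dHol_zero, Matrix.zero_apply]

/-- The derivatives of `T` are holomorphic, so along a `(0,1)` vector only the `ζ`-component of `Y`
is differentiated. -/
theorem hasCDeriv_dHol {q : Amb s r} (hT : MatAnalyticAt ℂ T q.2.2) {Y : Amb s r → Amb s r}
    (hY : DifferentiableAt ℝ Y q) (x : Amb s r) (i j : Fin s) :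
    HasCDeriv (fun p : Amb s r => dHol T p.2.2 (Y p).2.2 i j)
      (dHol T q.2.2 (fderiv ℝ Y q x + Complex.I • fderiv ℝ Y q (Complex.I • x)).2.2 i j) q
      (x, Complex.I • x) := by
  have e := HasCDeriv.sum (s := Finset.univ) fun b _ =>
    (hasCDeriv_snd_snd hY (x, Complex.I • x) b).mul
      (hasCDeriv_dHol_const hT (Pi.single b 1) x i j)
  simp only [mul_zero, add_zero, ← dHol_eq_sum] at e
  exact e

namespace IsModelForm

variable (h : IsModelForm V bH T H S) {q : Amb s r}
include h

theorem contDiffAt_leafField (hq : q.2.2 ∈ V) (γ : Fin r → ℂ) :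
    ContDiffAt ℝ ∞ (leafField bH T γ) q := by
  have hk := h.contDiffAt_leafCoord hq
  have hD : ∀ i j, ContDiffAt ℝ ∞ (fun p : Amb s r => dHol T p.2.2 γ i j) q := fun i j =>
    ContDiffAt.comp (g := fun ζ => dHol T ζ γ i j) q
      ((analytic_dHol (h.analytic _ hq) γ).restrictScalars i j).contDiffAt (contDiffAt_zeta q)
  have hz : ∀ i, ContDiffAt ℝ ∞ (fun p => (dHol T p.2.2 γ *ᵥ leafCoord T p) i) q := fun i =>
    contDiffAt_dotProduct (hD i) hk
  have hb : ∀ i, ContDiffAt ℝ ∞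
      (fun p => (bHᵀ *ᵥ (dHol T p.2.2 γ *ᵥ leafCoord T p)) i) q := fun i =>
    contDiffAt_dotProduct (f := fun _ => bHᵀ i) (fun j => contDiffAt_const) hz
  have hw : ContDiffAt ℝ ∞ (fun p => leafCoord T p ⬝ᵥ
      (bHᵀ *ᵥ (dHol T p.2.2 γ *ᵥ leafCoord T p))) q := contDiffAt_dotProduct hk hb
  have hz' : ContDiffAt ℝ ∞ (fun p => dHol T p.2.2 γ *ᵥ leafCoord T p) q := contDiffAt_pi.2 hz
  have hγ : ContDiffAt ℝ ∞ (fun _ : Amb s r => γ) q := contDiffAt_const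
  exact hw.prodMk (hz'.prodMk hγ)

/-- Only `k` has a `∂̄` derivative here; the factor `2` comes from the symmetry of `bHᵀ dT(γ)`. -/
theorem dbarAlong_leafField (hq : q.2.2 ∈ V) (γ : Fin r → ℂ) (Y : Amb s r → Amb s r) :
    ∃ k' : Fin s → ℂ, dbarAlong Y (leafField bH T γ) q =
      (2 * (leafCoord T q ⬝ᵥ (bHᵀ *ᵥ (dHol T q.2.2 γ *ᵥ k'))), dHol T q.2.2 γ *ᵥ k', 0) := by
  have hX := (h.contDiffAt_leafField hq γ).differentiableAt (by simp)
  set W : Amb s r × Amb s r := (Y q, Complex.I • Y q)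
  obtain ⟨k', hk'⟩ := h.hasCDeriv_leafCoord hq W
  have hD := hasCDeriv_dHol_const (h.analytic _ hq) γ (Y q)
  have hz := HasCDeriv.mulVec (A' := 0) hD hk'
  refine ⟨k', Prod.ext ?_ (Prod.ext ?_ ?_)⟩
  · have h1 := HasCDeriv.dotProduct hk' (HasCDeriv.mulVec (A := fun _ => bHᵀ) (A' := 0)
      (fun i j => HasCDeriv.const (bHᵀ i j)) hz)
    refine (hasCDeriv_fst hX W).unique (h1.congr_deriv ?_)
    simp only [Matrix.zero_mulVec, zero_add]
    rw [dot_symm (h.symm_dHol hq γ) k']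
    ring
  · ext i
    refine (hasCDeriv_snd_fst hX W i).unique ((hz i).congr_deriv ?_)
    simp
  · ext b
    exact (hasCDeriv_snd_snd hX W b).unique (HasCDeriv.const (γ b))

theorem dbarAlong_leafField_mem (hq : q.2.2 ∈ V) (γ : Fin r → ℂ) (Y : Amb s r → Amb s r) :
    dbarAlong Y (leafField bH T γ) q ∈ holTangent (defFun H S) q := by
  obtain ⟨k', e⟩ := h.dbarAlong_leafField hq γ Y
  rw [h.mem_holTangent_iff hq, e]
  simp only [cotangent, dHol_zero, Matrix.zero_mulVec, Matrix.mulVec_zero, dotProduct_zero]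
  rw [dotProduct_mulVec_transpose bH]
  ring

omit h in
theorem hasCDeriv_cotangent {Y : Amb s r → Amb s r} (hY : DifferentiableAt ℝ Y q)
    {W : Amb s r × Amb s r} {k' : Fin s → ℂ} {D' : Matrix (Fin s) (Fin s) ℂ}
    (hk' : ∀ i, HasCDeriv (fun p => leafCoord T p i) (k' i) q W)
    (hD' : ∀ i j, HasCDeriv (fun p => dHol T p.2.2 (Y p).2.2 i j) (D' i j) q W) :
    HasCDeriv (fun p => cotangent bH T p (Y p))
      (2 * ((fderiv ℝ Y q W.1 + Complex.I • fderiv ℝ Y q W.2).2.1 ⬝ᵥ (bH *ᵥ leafCoord T q) +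
          (Y q).2.1 ⬝ᵥ (bH *ᵥ k')) -
        (k' ⬝ᵥ (bHᵀ *ᵥ (dHol T q.2.2 (Y q).2.2 *ᵥ leafCoord T q)) +
          leafCoord T q ⬝ᵥ (bHᵀ *ᵥ (D' *ᵥ leafCoord T q + dHol T q.2.2 (Y q).2.2 *ᵥ k'))) -
        (fderiv ℝ Y q W.1 + Complex.I • fderiv ℝ Y q W.2).1) q W := by
  have h1 := ((HasCDeriv.dotProduct (hasCDeriv_snd_fst hY W)
    (HasCDeriv.mulVec (A := fun _ => bH) (A' := 0) (fun i j => HasCDeriv.const (bH i j))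
      hk')).const_mul 2).sub (HasCDeriv.dotProduct hk' (HasCDeriv.mulVec (A := fun _ => bHᵀ)
        (A' := 0) (fun i j => HasCDeriv.const (bHᵀ i j)) (HasCDeriv.mulVec hD' hk')))
  refine (h1.sub (hasCDeriv_fst hY W)).congr_deriv ?_
  simp only [Matrix.zero_mulVec, zero_add]

theorem cotangent_eq_zero {Y : Amb s r → Amb s r} (hq : q ∈ hypersurface V H S)
    (hY : IsSection (hypersurface V H S) (holTangent (defFun H S)) Y q) :
    ∀ᶠ p in 𝓝 q, p ∈ hypersurface V H S → cotangent bH T p (Y p) = 0 := by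
  filter_upwards [hY, eventually_zeta_mem h.isOpen hq.1] with p hp hpV hm
  exact (h.mem_holTangent_iff hpV).1 (hp.2 hm)

/-- The coefficients of `cotangent` are built from `k` and `dT`, both constant along the conjugate
of the leaf field. Differentiating `cotangent(Y) = 0` therefore only differentiates `Y`. -/
theorem dbarAlong_section_mem (hq : q ∈ hypersurface V H S) (γ : Fin r → ℂ)
    {Y : Amb s r → Amb s r}
    (hY : IsSection (hypersurface V H S) (holTangent (defFun H S)) Y q) :
    dbarAlong (leafField bH T γ) Y q ∈ holTangent (defFun H S) q := by
  have dY := hY.differentiableAt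
  have hV : q.2.2 ∈ V := hq.1
  have hc := hasCDeriv_cotangent (bH := bH) dY
    (k' := 0) (h.deriv_leafCoord_leafField hV γ)
    (hasCDeriv_dHol (h.analytic _ hV) dY (leafField bH T γ q))
  have h0 := h.cotangent_eq_zero hq hY
  have hmem := h.leafField_mem hV γ
  have t : ∀ c : ℂ, fderiv ℝ (fun p => cotangent bH T p (Y p)) q (c • leafField bH T γ q) = 0 :=
    fun c => fderiv_eq_zero_of_tangent h.isOpen hq (h.fderiv_defFun_eq hV).1 hc.1 h0 (hmem c)
  have e := hc.2
  have t1 := t 1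
  rw [one_smul] at t1
  rw [t1, t Complex.I] at e
  rw [h.mem_holTangent_iff hV]
  simp only [Matrix.mulVec_zero, dotProduct_zero, zero_dotProduct, add_zero, zero_add, mul_zero] at e
  exact e.symm

/-- The leaf field is a section of the Levi kernel. -/
theorem isSection_leafField (hq : q.2.2 ∈ V) (γ : Fin r → ℂ) :
    IsSection (hypersurface V H S) (leviKernel (hypersurface V H S) (defFun H S))
      (leafField bH T γ) q := by
  filter_upwards [eventually_zeta_mem h.isOpen hq] with p hp
  refine ⟨h.contDiffAt_leafField hp γ, fun hm => ⟨leafField bH T γ, ?_, rfl, ?_⟩⟩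
  · filter_upwards [eventually_zeta_mem h.isOpen hp] with x hx
    exact ⟨h.contDiffAt_leafField hx γ, fun _ => h.leafField_mem hx γ⟩
  · intro Y hY
    exact (inHH_cBracket_iff ((h.contDiffAt_leafField hp γ).differentiableAt (by simp))
      hY.differentiableAt).2 ⟨h.dbarAlong_section_mem hm γ hY, h.dbarAlong_leafField_mem hp γ Y⟩

omit h in
theorem leafCoord_zero : leafCoord T (0 : Amb s r) = 0 := by
  simp [leafCoord]

theorem zero_mem_hypersurface : (0 : Amb s r) ∈ hypersurface V H S :=
  ⟨h.zero_mem, by simp [defFun]⟩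

theorem mem_holTangent_zero_iff {v : Amb s r} :
    v ∈ holTangent (defFun H S) 0 ↔ v.1 = 0 := by
  rw [h.mem_holTangent_iff h.zero_mem]
  simp [cotangent, leafCoord_zero]

/-- The tangential derivatives at `0` of the first component of a section of the complex tangent
bundle. -/
theorem fderiv_section_zero {Y : Amb s r → Amb s r} {v : Amb s r} (dY : DifferentiableAt ℝ Y 0)
    (hY : ∀ᶠ p in 𝓝 0, p ∈ hypersurface V H S → cotangent bH T p (Y p) = 0)
    (hv : v.1 = 0) : (fderiv ℝ Y 0 v).1 = 2 * ((Y 0).2.1 ⬝ᵥ (bH *ᵥ star v.2.1)) := by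
  have h0 : (0 : Amb s r).2.2 ∈ V := h.zero_mem
  obtain ⟨k', hk'⟩ := h.hasCDeriv_leafCoord h0 (v, 0)
  have hz := h.deriv_z_eq h0 hk' (by simpa using hk')
  simp only [leafCoord_zero, Matrix.mulVec_zero, Prod.snd_zero, Prod.fst_zero, smul_zero, add_zero,
    h.T_zero, Matrix.zero_mulVec] at hz
  have hD : ∀ i j, DifferentiableAt ℝ (fun p : Amb s r => dHol T p.2.2 (Y p).2.2 i j) 0 :=
    fun i j => (hasCDeriv_dHol (h.analytic _ h0) dY 0 i j).1
  have hc := hasCDeriv_cotangent (bH := bH) dY (D' := Matrix.of fun i j => _) hk'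
    (fun i j => HasCDeriv.of_differentiableAt (hD i j))
  have hv' : fderiv ℝ (defFun H S) 0 v = 0 := by
    have := (h.mem_holTangent_zero_iff.2 hv) 1
    rwa [one_smul] at this
  have t := fderiv_eq_zero_of_tangent h.isOpen h.zero_mem_hypersurface
    (h.fderiv_defFun_eq h0).1 hc.1 hY hv'
  have e := hc.2
  simp only [t, leafCoord_zero, map_zero, mul_zero, add_zero, Matrix.mulVec_zero, dotProduct_zero,
    zero_add, smul_zero, zero_dotProduct, sub_zero] at e
  rw [hz, star_star]
  exact (sub_eq_zero.1 e.symm).symm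

/-- By `fderiv_section_zero` the derivative is antilinear in the complex tangent direction, so its
`(1,0)` part vanishes. -/
theorem delAlong_section_zero {Y u : Amb s r → Amb s r} (dY : DifferentiableAt ℝ Y 0)
    (hY : ∀ᶠ p in 𝓝 0, p ∈ hypersurface V H S → cotangent bH T p (Y p) = 0)
    (hu : (u 0).1 = 0) : (delAlong u Y 0).1 = 0 := by
  simp only [delAlong, Prod.fst_sub, Prod.smul_fst]
  rw [h.fderiv_section_zero dY hY hu, h.fderiv_section_zero dY hY (by simp [hu])]
  simp only [Prod.smul_snd, Prod.smul_fst, star_smul, RCLike.star_def, Complex.conj_I,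
    Matrix.mulVec_smul, dotProduct_smul, smul_eq_mul]
  linear_combination (2 * ((Y 0).2.1 ⬝ᵥ (bH *ᵥ star (u 0).2.1))) * Complex.I_mul_I

/-- The obstruction is the `(1,0)` part `dbarAlong Y₁ (leafField γ)` of the inner bracket, which is
built from `dT(γ)` and vanishes at `0` by `hγ`. The remaining terms vanish because the fields
involved are complex tangent. -/
theorem leviNull₂_leafField {γ : Fin r → ℂ} (hγ : dHol T 0 γ = 0) :
    LeviNull₂ (hypersurface V H S) (defFun H S) (leafField bH T γ) 0 := by
  intro Y₁ Y₂ hY₁ hY₂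
  have h0 : (0 : Amb s r).2.2 ∈ V := h.zero_mem
  have hm := h.zero_mem_hypersurface
  have hX : ∀ᶠ p in 𝓝 (0 : Amb s r), ContDiffAt ℝ ∞ (leafField bH T γ) p := by
    filter_upwards [eventually_zeta_mem h.isOpen h0] with p hp using h.contDiffAt_leafField hp γ
  have cu := contDiffAt_dbarAlong hX.self_of_nhds hY₁.self_of_nhds.1
  have cv := contDiffAt_dbarAlong hY₁.self_of_nhds.1 hX.self_of_nhds
  have du := cu.differentiableAt (by simp : (∞ : WithTop ℕ∞) ≠ 0)
  have dv := cv.differentiableAt (by simp : (∞ : WithTop ℕ∞) ≠ 0)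
  have hu : ∀ᶠ p in 𝓝 (0 : Amb s r), p ∈ hypersurface V H S →
      cotangent bH T p (dbarAlong (leafField bH T γ) Y₁ p) = 0 := by
    filter_upwards [hY₁.eventually_nhds, eventually_zeta_mem h.isOpen h0] with p hp hpV hpm
    exact (h.mem_holTangent_iff hpV).1 (h.dbarAlong_section_mem hpm γ hp)
  have hv : ∀ᶠ p in 𝓝 (0 : Amb s r), p ∈ hypersurface V H S →
      cotangent bH T p (dbarAlong Y₁ (leafField bH T γ) p) = 0 := by
    filter_upwards [eventually_zeta_mem h.isOpen h0] with p hpV _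
    exact (h.mem_holTangent_iff hpV).1 (h.dbarAlong_leafField_mem hpV γ Y₁)
  have hv0 : dbarAlong Y₁ (leafField bH T γ) 0 = 0 := by
    obtain ⟨k', e⟩ := h.dbarAlong_leafField h0 γ Y₁
    rw [e]
    simp only [Prod.snd_zero, hγ, Matrix.zero_mulVec, Matrix.mulVec_zero, dotProduct_zero, mul_zero]
    rfl
  have hu0 : (dbarAlong (leafField bH T γ) Y₁ 0).1 = 0 :=
    h.mem_holTangent_zero_iff.1 (h.dbarAlong_section_mem hm γ hY₁)
  have hY0 : (Y₂ 0).1 = 0 := h.mem_holTangent_zero_iff.1 (hY₂.self_of_nhds.2 hm)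
  have hY₂c := h.cotangent_eq_zero hm hY₂
  refine inHH_cBracket_cBracket hX (hY₁.mono fun p hp => hp.1) hY₂.differentiableAt ?_ ?_ ?_
  · rw [h.mem_holTangent_zero_iff, Prod.fst_sub,
      h.delAlong_section_zero hY₂.differentiableAt hY₂c hu0,
      h.delAlong_section_zero du hu hY0, sub_zero]
  · simp only [dbarAlong] at hv0 ⊢
    simp [hv0]
  · rw [h.mem_holTangent_zero_iff]
    simp only [dbarAlong, Prod.fst_add, Prod.smul_fst]
    change (fderiv ℝ (dbarAlong Y₁ (leafField bH T γ)) 0 (Y₂ 0)).1 + Complex.I •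
      (fderiv ℝ (dbarAlong Y₁ (leafField bH T γ)) 0 (Complex.I • Y₂ 0)).1 = 0
    rw [h.fderiv_section_zero dv hv hY0, h.fderiv_section_zero dv hv (by simp [hY0]), hv0]
    simp

/-- `2`-nondegeneracy forces the first derivatives of `T` to be independent. -/
theorem eq_zero_of_dHol_eq_zero
    (hf : freeman₃ (hypersurface V H S) (defFun H S) 0 = {0}) {γ : Fin r → ℂ}
    (hγ : dHol T 0 γ = 0) : γ = 0 := by
  have hmem : leafField bH T γ 0 ∈ freeman₃ (hypersurface V H S) (defFun H S) 0 :=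
    ⟨leafField bH T γ, h.isSection_leafField h.zero_mem γ, rfl, h.leviNull₂_leafField hγ⟩
  rw [hf, Set.mem_singleton_iff] at hmem
  exact congrArg (fun p : Amb s r => p.2.2) hmem

end IsModelForm

end LeafSections

/-! ### The model pair obtained from a normalization. -/

section Main

variable {s r : ℕ} {U V : Set (Fin r → ℂ)} {H S A T Q : MatFun s r}

namespace IsNormalization

theorem isModelForm (h : IsNormalization V H S A T Q) (hd : IsDefiningData U H S) :
    IsModelForm V (H 0) T (modelH (H 0) (symmOf (H 0) T)) (modelS (H 0) (symmOf (H 0) T)) where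
  isOpen := h.isOpen
  zero_mem := h.zero_mem
  hermitian := bH_isHermitian hd
  analytic := h.analyticT
  T_zero := h.T_zero
  isUnit := h.isUnitT
  symm := h.symmT
  eqH _ _ := modelH_symmOf (bH_isHermitian hd) hd.nondegenerate
  eqS _ _ := conjMat_modelS_symmOf (bH_isHermitian hd) hd.nondegenerate

theorem analytic_symmOf (h : IsNormalization V H S A T Q) {ζ : Fin r → ℂ} (hζ : ζ ∈ V) :
    MatAnalyticAt ℂ (symmOf (H 0) T) ζ :=
  ((h.analyticT ζ hζ).mul (MatAnalyticAt.const (H 0)⁻¹ ζ)).neg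

theorem partialAtZero_eq (γ : Fin r → ℂ) (hT : MatAnalyticAt ℂ T 0)
    (bH : Matrix (Fin s) (Fin s) ℂ) :
    ∑ α, γ α • partialAtZero (symmOf bH T) α = -(dHol T 0 γ * bH⁻¹) := by
  have key : ∀ v, dHol (symmOf bH T) 0 v = -(dHol T 0 v * bH⁻¹) := by
    intro v
    ext i j
    have h1 : HasFDerivAt (fun ζ => -∑ k, T ζ i k * bH⁻¹ k j)
        (-∑ k, bH⁻¹ k j • fderiv ℂ (fun ζ => T ζ i k) 0) 0 :=
      (HasFDerivAt.fun_sum fun k _ =>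
        ((hT i k).differentiableAt.hasFDerivAt.mul_const (bH⁻¹ k j))).fun_neg
    simp only [dHol, symmOf, Matrix.neg_apply, Matrix.mul_apply, h1.fderiv, Matrix.of_apply]
    simp [mul_comm]
  rw [← key]
  ext i j
  rw [dHol_eq_sum, Matrix.sum_apply]
  rfl

theorem isModelPair (h : IsNormalization V H S A T Q) (hd : IsDefiningData U H S)
    (hf : freeman₃ (hypersurface V (modelH (H 0) (symmOf (H 0) T)) (modelS (H 0) (symmOf (H 0) T)))
      (defFun (modelH (H 0) (symmOf (H 0) T)) (modelS (H 0) (symmOf (H 0) T))) 0 = {0}) :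
    IsModelPair V (H 0) (symmOf (H 0) T) where
  isOpen := h.isOpen
  zero_mem := h.zero_mem
  hermitian := bH_isHermitian hd
  nondegenerate := hd.nondegenerate
  symmetric ζ hζ := by
    have e : T ζ = ((H 0)ᵀ)⁻¹ * ((H 0)ᵀ * T ζ) :=
      (Matrix.nonsing_inv_mul_cancel_left _ _ (by
        rw [Matrix.det_transpose]
        exact hd.nondegenerate)).symm
    -- Up to sign `𝐒` is congruent by `(H 0)⁻¹` to the symmetric matrix `(H 0)ᵀ T`.
    have e1 : symmOf (H 0) T ζ = -(((H 0)⁻¹)ᵀ * ((H 0)ᵀ * T ζ) * (H 0)⁻¹) := by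
      rw [Matrix.transpose_nonsing_inv, ← e, symmOf]
    rw [e1, Matrix.IsSymm, Matrix.transpose_neg, Matrix.transpose_mul, Matrix.transpose_mul,
      (h.symmT ζ hζ).eq, Matrix.transpose_transpose]
    simp only [Matrix.mul_assoc]
  holomorphic i j ζ hζ :=
    (h.analytic_symmOf hζ i j).differentiableAt.differentiableWithinAt
  vanish := by simp [symmOf, h.T_zero]
  linearIndependent := by
    rw [Fintype.linearIndependent_iff]
    intro γ hγ α
    rw [partialAtZero_eq γ (h.analyticT 0 h.zero_mem), neg_eq_zero] at hγ
    have hT : dHol T 0 γ = 0 := by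
      rw [← Matrix.nonsing_inv_mul_cancel_right _ (dHol T 0 γ) hd.nondegenerate, hγ,
        Matrix.zero_mul]
    rw [(h.isModelForm hd).eq_zero_of_dHol_eq_zero hf hT, Pi.zero_apply]
  invertible ζ hζ := by
    rw [conjMat_symmOf_mul_mul (bH_isHermitian hd) hd.nondegenerate]
    exact h.isUnitT ζ hζ

end IsNormalization

end Main

end CRHyp

end

theorem theorem1p4 {s r : ℕ} (U : Set (Fin r → ℂ)) (H S : CRHyp.MatFun s r)
    (hdata : CRHyp.IsDefiningData U H S)
    (hH : ∀ i j, ContDiffOn ℝ ∞ (fun ζ => H ζ i j) U)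
    (hS : ∀ i j, ContDiffOn ℝ ∞ (fun ζ => S ζ i j) U)
    (hnondeg : CRHyp.IsUniformlyTwoNondegenerate U H S)
    (hsym : ∃ 𝔛 : Set (CRHyp.Amb s r → CRHyp.Amb s r),
      (∀ X ∈ 𝔛, CRHyp.IsHolInfinitesimalSymmetry
        (CRHyp.hypersurface U H S) (CRHyp.defFun H S) 0 X) ∧
      CRHyp.ActsLocallyTransitivelyOnLeaves
        (CRHyp.hypersurface U H S) (CRHyp.defFun H S) 0 𝔛) :
    ∃ (V : Set (Fin r → ℂ)) (bH : Matrix (Fin s) (Fin s) ℂ) (bS : CRHyp.MatFun s r),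
      CRHyp.IsModelPair V bH bS ∧
      CRHyp.IsTwoNondegenerateModel V (CRHyp.modelH bH bS) (CRHyp.modelS bH bS) ∧
      CRHyp.LocallyEquivalentAt (CRHyp.hypersurface U H S)
        (CRHyp.hypersurface V (CRHyp.modelH bH bS) (CRHyp.modelS bH bS)) 0 := by
  obtain ⟨𝔛, h𝔛, ht⟩ := hsym
  obtain ⟨V, hVU, A, T, Q, h⟩ := CRHyp.exists_normalization hdata hH hS h𝔛 ht
  have e := h.crEquiv hdata hVU hH hS
  -- Nondegeneracy is carried to the model first, since the independence of the derivatives of `𝐒`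
  -- is deduced from `𝓚₃ = 0` for the model at `0`.
  have hM := e.uniformlyTwoNondegenerateNear (o := 0) (s := s) h.zero_mem hnondeg
  rw [h.chart_zero] at hM
  have hf := (hM.self_of_nhds (h.isModelForm hdata).zero_mem_hypersurface).2.2
  exact ⟨V, H 0, CRHyp.symmOf (H 0) T, h.isModelPair hdata hf,
    ⟨h.model_data hdata hVU, fun i j ζ hζ => h.analytic_modelH hdata hζ i j,
      fun i j ζ hζ => h.analytic_modelS hdata hζ i j, hM⟩,
    ⟨h.chart, h.zero_mem, h.chart_zero, e.holo, e.holo_symm, e.mem_iff⟩⟩
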